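/- Fix $q\in\mathbb C$ with $0<|q|<1$ and a square root $q^{1/2}$, put $(z;q)_\infty=\prod_{k\ge0}(1-zq^k)$ and $(z_1,\dots,z_r;q)_\infty=\prod_i(z_i;q)_\infty$, and for integers $n,m$ put $$\mathcal B[a,n;b,m]=(-q^{1/2})^{\frac{|n|+|m|-|n+m|}{2}}\,a^{-\frac{|n|}{2}}\,b^{-\frac{|m|}{2}}\,(ab)^{\frac{|n+m|}{2}}\,\frac{(q^{1+\frac{|n|}{2}}a^{-1},\;q^{1+\frac{|m|}{2}}b^{-1},\;q^{\frac{|n+m|}{2}}ab;\,q)_\infty}{(q^{\frac{|n|}{2}}a,\;q^{\frac{|m|}{2}}b,\;q^{1+\frac{|n+m|}{2}}(ab)^{-1};\,q)_\infty}.$$ Here $q^{k/2}=(q^{1/2})^k$. The arguments $a,b$ below are monomials in nonzero variables, each of which is given a square root (the principal one, say); half-integer powers of $a$, $b$, $ab$ are formed multiplicatively from these roots. The kernels and integrands below do not depend on the choice of these roots. Let $\mathbb T$ be the positively oriented unit circle. Let $t\neq0$, $n_t\in\mathbb Z$, and let $D\supseteq\mathbb T$ be a set of nonzero complex numbers. Sequences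 of functions $\alpha_m(\cdot\,;t),\beta_m(\cdot\,;t)$, $m\in\mathbb Z$, form a Bailey pair with respect to $t$ (and $n_t$) on $D$ if for all $m\in\mathbb Z$ and $w\in D$ $$\beta_m(w;t)=\sum_{n\in\mathbb Z}\int_{\mathbb T}\mathcal B[twz^{-1},m-n+n_t;\;tw^{-1}z,-m+n+n_t]\,\alpha_n(z;t)\,dz,$$ the sum/integral being absolutely convergent (every integrand is integrable on $\mathbb T$ and the integrals of the absolute values are summable over $n$). Lemma. Let $n_s,n_t,n_u\in\mathbb Z$ with $n_u+n_s+n_t=0$, let $s,t,u\in\mathbb C$ with $|s|,|t|,|u|<1$ and $|q|<|s^2t^2u|$, and let $D\supseteq\mathbb T$ be contained in $\{w:|s|<|w|<|s|^{-1}\}$. If $\alpha_m(\cdot\,;t),\beta_m(\cdot\,;t)$ form a Bailey pair with respect to $t$ (and $n_t$) on $D$, then $$\alpha'_n(w;st)=\mathcal B[tuw,n+n_u+n_t;\;s^2,2n_s]\,\alpha_n(w;t),$$ $$\beta'_n(w;st)=\sum_{m\in\mathbb Z}\int_{\mathbb T}\frac{dx}{2\pi i x}\,\mathcal B[swx^{-1},-m+n+n_s;\;ux,n_u+m]\;\mathcal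 B[st^2uw,n+2n_t+n_u+n_s;\;sw^{-1}x,-n+m+n_s]\,\beta_m(x;t)$$ form a Bailey pair with respect to $st$ (and $n_{st}=n_s+n_t$) on $D$; moreover the sum/integral defining $\beta'_n(w;st)$ is absolutely convergent for all $n\in\mathbb Z$ and $w\in D$. -/

import Mathlib

open MeasureTheory Complex

noncomputable section

/-- The infinite q-product `(z; q)_∞ = ∏_{k ≥ 0} (1 - z q ^ k)`. -/
def qPoch (z q : ℂ) : ℂ := ∏' k : ℕ, (1 - z * q ^ k)

/-- The principal square root. It fixes a determination of the half-integer powers of the arguments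
of the kernel; roots of products are formed multiplicatively, see `pentB`. -/
def csqrt (z : ℂ) : ℂ := z ^ (1 / 2 : ℂ)

/-- The kernel `𝓑[a, n; b, m]`. The base is `q = h ^ 2`, so `h` is the chosen `q ^ (1/2)`.
The arguments `a` and `b` are passed through square roots `ra`, `rb` (so `a = ra ^ 2`,
`b = rb ^ 2`), with the square root `ra * rb` of `a * b`. Hence `a ^ (-|n|/2) = ra ^ (-|n|)`,
`q ^ (|n|/2) = h ^ |n|`, and so on. The integer `|n| + |m| - |n + m|` is even, so the division
by `2` in the exponent of `-h = -q ^ (1/2)` is exact. -/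
def pentB (h ra : ℂ) (n : ℤ) (rb : ℂ) (m : ℤ) : ℂ :=
  (-h) ^ ((|n| + |m| - |n + m|) / 2) *
    ra ^ (-|n|) * rb ^ (-|m|) * (ra * rb) ^ |n + m| *
    ((qPoch (h ^ 2 * h ^ |n| * (ra ^ 2)⁻¹) (h ^ 2) *
        qPoch (h ^ 2 * h ^ |m| * (rb ^ 2)⁻¹) (h ^ 2) *
        qPoch (h ^ |n + m| * (ra ^ 2 * rb ^ 2)) (h ^ 2)) /
      (qPoch (h ^ |n| * ra ^ 2) (h ^ 2) *
        qPoch (h ^ |m| * rb ^ 2) (h ^ 2) *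
        qPoch (h ^ 2 * h ^ |n + m| * (ra ^ 2 * rb ^ 2)⁻¹) (h ^ 2)))

/-- Absolute convergence of the sum/integral `∑_{n ∈ ℤ} ∮ F n z dz` over the unit circle. -/
def AbsConvOnCircle (F : ℤ → ℂ → ℂ) : Prop :=
  (∀ n, CircleIntegrable (F n) 0 1) ∧
    Summable fun n : ℤ => ∫ θ in (0 : ℝ)..(2 * Real.pi), ‖F n (circleMap 0 1 θ)‖

/-- The sum/integral `∑_{n ∈ ℤ} ∮ F n z dz` over the positively oriented unit circle. -/
def sumCircleIntegral (F : ℤ → ℂ → ℂ) : ℂ := ∑' n : ℤ, ∮ z in C(0, 1), F n z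

/-- The kernel `𝓑[t w z⁻¹, m - n + nt; t w⁻¹ z, -m + n + nt]`. -/
def baileyKernel (h t : ℂ) (nt m : ℤ) (w : ℂ) (n : ℤ) (z : ℂ) : ℂ :=
  pentB h (csqrt t * csqrt w * (csqrt z)⁻¹) (m - n + nt)
    (csqrt t * (csqrt w)⁻¹ * csqrt z) (-m + n + nt)

/-- `α`, `β` form a Bailey pair with respect to the parameter `t` (with discrete companion `nt`),
for `w` in the domain `D`: the sum/integral converges absolutely and
`β_m(w) = ∑_n ∮ 𝓑[t w z⁻¹, m - n + nt; t w⁻¹ z, -m + n + nt] α_n(z) dz`. -/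
def IsBaileyPair (h : ℂ) (D : Set ℂ) (t : ℂ) (nt : ℤ) (α β : ℤ → ℂ → ℂ) : Prop :=
  ∀ m : ℤ, ∀ w ∈ D,
    AbsConvOnCircle (fun n z => baileyKernel h t nt m w n z * α n z) ∧
      β m w = sumCircleIntegral (fun n z => baileyKernel h t nt m w n z * α n z)

/-- `α'_n(w; st) = 𝓑[t u w, n + nu + nt; s², 2 ns] α_n(w; t)`. -/
def baileyAlpha (h s t u : ℂ) (ns nt nu : ℤ) (α : ℤ → ℂ → ℂ) (n : ℤ) (w : ℂ) : ℂ :=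
  pentB h (csqrt t * csqrt u * csqrt w) (n + nu + nt) s (2 * ns) * α n w

/-- The integrand, with respect to `dx`, of `β'_n(w; st)`:
`𝓑[s w x⁻¹, -m + n + ns; u x, nu + m]
  𝓑[s t² u w, n + 2 nt + nu + ns; s w⁻¹ x, -n + m + ns] β_m(x; t) / (2 π i x)`. -/
def baileyBetaIntegrand (h s t u : ℂ) (ns nt nu : ℤ) (β : ℤ → ℂ → ℂ) (n : ℤ) (w : ℂ)
    (m : ℤ) (x : ℂ) : ℂ :=
  pentB h (csqrt s * csqrt w * (csqrt x)⁻¹) (-m + n + ns) (csqrt u * csqrt x) (nu + m) *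
    pentB h (csqrt s * t * csqrt u * csqrt w) (n + 2 * nt + nu + ns)
      (csqrt s * (csqrt w)⁻¹ * csqrt x) (-n + m + ns) *
    β m x * (2 * Real.pi * I * x)⁻¹

/-- `β'_n(w; st)`. -/
def baileyBeta (h s t u : ℂ) (ns nt nu : ℤ) (β : ℤ → ℂ → ℂ) (n : ℤ) (w : ℂ) : ℂ :=
  sumCircleIntegral (baileyBetaIntegrand h s t u ns nt nu β n w)

end

/-! ### The infinite `q`-product -/

/-! Take p with p^4 = q. The kernel is then a quotient G(a) G(b) / G(ab) of a gamma function with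
one complex and one integer argument (`tetG`, `pentB_eq_tetG`). It is even in the integer and obeys
a reflection formula (`tetG_mul_reflect`) and a first-order difference equation (`tetG_shift`).
Inserting the definition of β into β' and exchanging the two sum/integrals leaves, for each index
and point of α, a sum/integral of three kernels. With x = y² it becomes a constant times a
sum/integral of six gammas whose parameters multiply to -p² and whose indices add up to 0. The
star-triangle relation `hyperSum_eq_hyperProd` evaluates it as nine gammas, and reflection regroups
these into the kernel for st times the factor in α' (`kernel_product_eq_hyperTerm`,
`hyperProd_eq_kernel_product`).

The star-triangle relation says that a ratio, sum/integral over product, equals 1. A telescoping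
identity (`hyperTerm_telescope`) shows that the ratio is unchanged when r₀ is multiplied and ρ₀
divided by p while their indices move by one in opposite directions, either way. With r₀ρ₀ fixed,
the ratio is holomorphic in r₀ on an annulus that contains a closed fundamental annulus for
multiplication by p, so the maximum principle makes it independent of r₀ and of how the index is
split (`hyperRatio_eq_of_mul_eq`). Thus r₀ may be sent to the unit circle together with a rescaled
ρ₁. Poles then pinch the contour at y = ±1 in a single summand, a Poisson kernel extracts its value
there, and this agrees with the leading behaviour of the product (`eq_one_of_hyperRatio_pinch`). The
size restrictions needed for this are removed by analytic continuation (`hyperRatio_eq_one`).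

The exchange of sum/integrals rests on geometric bounds in the index. A lower bound for the kernel
in the hypothesis, used at one single pair (m, w), shows that α is integrable against
(|p|²/|t|)^|n|. Upper bounds for the other kernels show that this one weight suffices both for the
new pair and for Fubini. -/

theorem summable_norm_neg_mul_pow {q : ℂ} (hq : ‖q‖ < 1) (z : ℂ) :
    Summable fun k : ℕ => ‖-(z * q ^ k)‖ := by
  simpa using (summable_geometric_of_lt_one (norm_nonneg q) hq).mul_left ‖z‖

theorem qPoch_eq_one_sub_mul {q : ℂ} (hq : ‖q‖ < 1) (z : ℂ) :
    qPoch z q = (1 - z) * qPoch (z * q) q := by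
  have hm : ∀ z : ℂ, Multipliable fun k : ℕ => 1 - z * q ^ k := fun z => by
    simpa [sub_eq_add_neg] using multipliable_one_add_of_summable (summable_norm_neg_mul_pow hq z)
  have hm' : Multipliable fun k : ℕ => 1 - z * q ^ (k + 1) := by
    simpa [pow_succ', mul_assoc] using hm (z * q)
  have e : ∀ k : ℕ, 1 - z * q ^ (k + 1) = 1 - z * q * q ^ k := fun k => by ring
  calc qPoch z q = (1 - z * q ^ 0) * ∏' k : ℕ, (1 - z * q ^ (k + 1)) :=
        tprod_eq_zero_mul' (f := fun k : ℕ => 1 - z * q ^ k) hm'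
    _ = (1 - z) * qPoch (z * q) q := by rw [tprod_congr e, pow_zero, mul_one, qPoch]

theorem qPoch_ne_zero {q z : ℂ} (hq : ‖q‖ < 1) (hz : ‖z‖ < 1) : qPoch z q ≠ 0 := by
  have h := tprod_one_add_ne_zero_of_summable (f := fun k : ℕ => -(z * q ^ k)) (fun k h0 => ?_)
    (summable_norm_neg_mul_pow hq z)
  · simpa [qPoch, sub_eq_add_neg] using h
  · have h1 : z * q ^ k = 1 := by linear_combination -h0
    have h2 : ‖z * q ^ k‖ < 1 := by
      rw [norm_mul, norm_pow]
      calc ‖z‖ * ‖q‖ ^ k ≤ ‖z‖ * 1 := by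
            gcongr
            exact pow_le_one₀ (norm_nonneg _) hq.le
        _ < 1 := by simpa using hz
    rw [h1] at h2
    simp at h2

theorem differentiable_qPoch {q : ℂ} (hq : ‖q‖ < 1) : Differentiable ℂ fun z => qPoch z q := by
  have key : HasProdLocallyUniformlyOn (fun (k : ℕ) (z : ℂ) => 1 + -(z * q ^ k))
      (fun z => ∏' k : ℕ, (1 + -(z * q ^ k))) Set.univ := by
    apply hasProdLocallyUniformlyOn_of_forall_compact isOpen_univ
    intro K _ hcK
    obtain ⟨M, hM⟩ := hcK.isBounded.exists_norm_le
    refine ((summable_geometric_of_lt_one (norm_nonneg q) hq).mul_left M).hasProdUniformlyOn_nat_one_add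
      hcK (.of_forall fun k z hz => ?_) (fun _ => by fun_prop)
    rw [norm_neg, norm_mul, norm_pow]
    gcongr
    exact hM z hz
  have hd := key.differentiableOn
    (.of_forall fun s => by
      simpa [Finset.prod_fn] using DifferentiableOn.finsetProd (fun _ _ => by fun_prop)) isOpen_univ
  rw [differentiableOn_univ] at hd
  simpa [qPoch, sub_eq_add_neg] using hd

theorem exists_norm_qPoch_le {q : ℂ} (hq : ‖q‖ < 1) (R : ℝ) :
    ∃ C > 0, ∀ z, ‖z‖ ≤ R → ‖qPoch z q‖ ≤ C := by
  obtain ⟨C, hC⟩ := (isCompact_closedBall (0 : ℂ) R).exists_bound_of_continuousOn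
    (differentiable_qPoch hq).continuous.continuousOn
  exact ⟨max C 1, by positivity, fun z hz => (hC z (by simpa using hz)).trans (le_max_left _ _)⟩

theorem exists_le_norm_qPoch {q : ℂ} (hq : ‖q‖ < 1) {R : ℝ} (hR : R < 1) :
    ∃ c > 0, ∀ z, ‖z‖ ≤ R → c ≤ ‖qPoch z q‖ := by
  obtain ⟨C, hC⟩ := (isCompact_closedBall (0 : ℂ) R).exists_bound_of_continuousOn
    (f := fun z => (qPoch z q)⁻¹)
    ((differentiable_qPoch hq).continuous.continuousOn.inv₀ fun z hz =>
      qPoch_ne_zero hq (by rw [mem_closedBall_zero_iff] at hz; linarith))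
  refine ⟨(max C 1)⁻¹, by positivity, fun z hz => ?_⟩
  have h0 : 0 < ‖qPoch z q‖ := norm_pos_iff.2 (qPoch_ne_zero hq (hz.trans_lt hR))
  have h1 := (hC z (by simpa using hz)).trans (le_max_left C 1)
  rw [norm_inv] at h1
  exact inv_le_of_inv_le₀ h0 h1

/-! ### The discrete-continuous gamma function -/

/-- The gamma function `G(r, n)` of the pentagon identity, with `r` a square root of the argument
and base `q = p ^ 4`. -/
noncomputable def tetG (p r : ℂ) (n : ℤ) : ℂ :=
  (I * p / r) ^ n.natAbs *
    (qPoch (p ^ 4 * p ^ (2 * n.natAbs) * (r ^ 2)⁻¹) (p ^ 4) /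
      qPoch (p ^ (2 * n.natAbs) * r ^ 2) (p ^ 4))

theorem norm_pow_four_lt_one {p : ℂ} (hp1 : ‖p‖ < 1) : ‖p ^ 4‖ < 1 := by
  rw [norm_pow]
  exact pow_lt_one₀ (norm_nonneg _) hp1 (by norm_num)

@[simp] theorem tetG_neg_index (p r : ℂ) (n : ℤ) : tetG p r (-n) = tetG p r n := by
  simp [tetG]

theorem tetG_neg (p r : ℂ) (n : ℤ) : tetG p (-r) n = (-1) ^ n.natAbs * tetG p r n := by
  have : I * p / -r = (-1) * (I * p / r) := by rw [div_neg]; ring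
  simp only [tetG, neg_sq, this, mul_pow]
  ring

theorem norm_pow_mul_sq_lt_one {p r : ℂ} (hp1 : ‖p‖ < 1) (hr : ‖r‖ < 1) (N : ℕ) :
    ‖p ^ N * r ^ 2‖ < 1 := by
  rw [norm_mul, norm_pow, norm_pow]
  exact mul_lt_one_of_nonneg_of_lt_one_right (pow_le_one₀ (norm_nonneg _) hp1.le) (by positivity)
    (pow_lt_one₀ (norm_nonneg _) hr (by norm_num))

theorem norm_pow_mul_inv_sq_lt_one {p r : ℂ} (hp1 : ‖p‖ < 1) (hr : ‖p‖ ^ 2 < ‖r‖) (N : ℕ) :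
    ‖p ^ 4 * p ^ N * (r ^ 2)⁻¹‖ < 1 := by
  have hr0 : 0 < ‖r‖ := lt_of_le_of_lt (by positivity) hr
  have h1 : ‖p ^ 4 * p ^ N * (r ^ 2)⁻¹‖ = ‖p‖ ^ N * (‖p‖ ^ 2 / ‖r‖) ^ 2 := by
    simp only [norm_mul, norm_pow, norm_inv]
    field_simp
  rw [h1]
  exact mul_lt_one_of_nonneg_of_lt_one_right (pow_le_one₀ (norm_nonneg _) hp1.le) (by positivity)
    (pow_lt_one₀ (by positivity) ((div_lt_one hr0).2 hr) (by norm_num))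

theorem tetG_ne_zero {p r : ℂ} (hp0 : p ≠ 0) (hp1 : ‖p‖ < 1) (hr : ‖p‖ ^ 2 < ‖r‖) (hr1 : ‖r‖ < 1)
    (n : ℤ) : tetG p r n ≠ 0 := by
  have hr0 : r ≠ 0 := norm_pos_iff.1 (lt_of_le_of_lt (by positivity) hr)
  have hq := norm_pow_four_lt_one hp1
  have h1 := qPoch_ne_zero hq (norm_pow_mul_sq_lt_one hp1 hr1 (2 * n.natAbs))
  have h2 := qPoch_ne_zero hq (norm_pow_mul_inv_sq_lt_one hp1 hr (2 * n.natAbs))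
  have h3 : I * p / r ≠ 0 := div_ne_zero (mul_ne_zero I_ne_zero hp0) hr0
  exact mul_ne_zero (pow_ne_zero _ h3) (div_ne_zero h2 h1)

/-- The substitution exchanges the two q-products. They see only r², so the minus sign matters for
the prefactors alone: it offsets I² = -1 and makes them cancel. -/
theorem tetG_mul_reflect {p r : ℂ} (hp0 : p ≠ 0) (hp1 : ‖p‖ < 1) (hr : ‖p‖ ^ 2 < ‖r‖)
    (hr1 : ‖r‖ < 1) (n : ℤ) : tetG p r n * tetG p (-p ^ 2 / r) (-n) = 1 := by
  have hr0 : r ≠ 0 := norm_pos_iff.1 (lt_of_le_of_lt (by positivity) hr)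
  have hq := norm_pow_four_lt_one hp1
  have h1 := qPoch_ne_zero hq (norm_pow_mul_sq_lt_one hp1 hr1 (2 * n.natAbs))
  have h2 := qPoch_ne_zero hq (norm_pow_mul_inv_sq_lt_one hp1 hr (2 * n.natAbs))
  have e1 : p ^ 4 * p ^ (2 * n.natAbs) * ((-p ^ 2 / r) ^ 2)⁻¹ = p ^ (2 * n.natAbs) * r ^ 2 := by
    field_simp
  have e2 : p ^ (2 * n.natAbs) * (-p ^ 2 / r) ^ 2 = p ^ 4 * p ^ (2 * n.natAbs) * (r ^ 2)⁻¹ := by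
    field_simp
  have e3 : (I * p / r) ^ n.natAbs * (I * p / (-p ^ 2 / r)) ^ n.natAbs = 1 := by
    rw [← mul_pow]
    have : I * p / r * (I * p / (-p ^ 2 / r)) = 1 := by
      field_simp
      simp
    rw [this, one_pow]
  rw [tetG_neg_index, tetG, tetG, e1, e2]
  calc _ = ((I * p / r) ^ n.natAbs * (I * p / (-p ^ 2 / r)) ^ n.natAbs) *
        (qPoch (p ^ 4 * p ^ (2 * n.natAbs) * (r ^ 2)⁻¹) (p ^ 4) /
        qPoch (p ^ 4 * p ^ (2 * n.natAbs) * (r ^ 2)⁻¹) (p ^ 4)) *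
        (qPoch (p ^ (2 * n.natAbs) * r ^ 2) (p ^ 4) /
        qPoch (p ^ (2 * n.natAbs) * r ^ 2) (p ^ 4)) := by ring
    _ = 1 := by rw [e3, div_self h1, div_self h2]; simp

/-- Only one q-product moves. For n ≥ 0 the denominator loses its first factor, for n < 0 the
numerator gains one; both cases give the same expression. -/
theorem tetG_shift {p r : ℂ} (hp0 : p ≠ 0) (hp1 : ‖p‖ < 1) (hr0 : r ≠ 0) (hr1 : ‖r‖ < 1) (n : ℤ) :
    tetG p (p * r) (n + 1) = I * ((p ^ n * r)⁻¹ - p ^ n * r) * tetG p r n := by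
  have hq := norm_pow_four_lt_one hp1
  have hI := I_ne_zero
  rcases lt_or_ge n 0 with hn | hn
  · obtain ⟨N, rfl⟩ : ∃ N : ℕ, n = -((N : ℤ) + 1) := ⟨(-n - 1).toNat, by omega⟩
    have a1 : (-((N : ℤ) + 1) + 1).natAbs = N := by omega
    have a2 : (-((N : ℤ) + 1)).natAbs = N + 1 := by omega
    have e1 : p ^ 4 * p ^ (2 * N) * ((p * r) ^ 2)⁻¹ = p ^ (2 * (N + 1)) * (r ^ 2)⁻¹ := by
      field_simp
      try ring
    have e2 : p ^ (2 * N) * (p * r) ^ 2 = p ^ (2 * (N + 1)) * r ^ 2 := by ring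
    have e3 : p ^ (2 * (N + 1)) * (r ^ 2)⁻¹ * p ^ 4 = p ^ 4 * p ^ (2 * (N + 1)) * (r ^ 2)⁻¹ := by
      ring
    have e4 : p ^ (-((N : ℤ) + 1)) = (p ^ (N + 1))⁻¹ := by
      rw [zpow_neg]; norm_cast
    rw [tetG, tetG, a1, a2, e1, e2, qPoch_eq_one_sub_mul hq (p ^ (2 * (N + 1)) * (r ^ 2)⁻¹), e3, e4]
    rw [← mul_assoc, ← mul_div_assoc, ← mul_div_assoc, ← mul_assoc]
    congr 2
    rw [show I * p / (p * r) = I / r by field_simp, div_pow, div_pow, mul_pow]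
    field_simp
    rw [pow_succ I]
    ring_nf
    rw [I_sq]
    ring
  · lift n to ℕ using hn
    have a1 : ((n : ℤ) + 1).natAbs = n + 1 := by omega
    have e1 : p ^ 4 * p ^ (2 * (n + 1)) * ((p * r) ^ 2)⁻¹ = p ^ 4 * p ^ (2 * n) * (r ^ 2)⁻¹ := by
      field_simp
      try ring
    have e2 : p ^ (2 * (n + 1)) * (p * r) ^ 2 = p ^ (2 * n) * r ^ 2 * p ^ 4 := by ring
    have h1 := qPoch_ne_zero hq (norm_pow_mul_sq_lt_one hp1 hr1 (2 * n))
    have h2 := qPoch_eq_one_sub_mul hq (p ^ (2 * n) * r ^ 2)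
    have h3 : 1 - p ^ (2 * n) * r ^ 2 ≠ 0 := fun h => h1 (by rw [h2, h, zero_mul])
    have h4 : qPoch (p ^ (2 * n) * r ^ 2 * p ^ 4) (p ^ 4) ≠ 0 :=
      fun h => h1 (by rw [h2, h, mul_zero])
    rw [tetG, tetG, a1, Int.natAbs_natCast, e1, e2, h2, zpow_natCast]
    rw [show I * p / (p * r) = I / r by field_simp, div_pow, div_pow, mul_pow]
    field_simp
    ring

theorem pentB_eq_tetG {p ra rb : ℂ} (hp0 : p ≠ 0) (hra : ra ≠ 0) (hrb : rb ≠ 0) (n m : ℤ) :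
    pentB (p ^ 2) ra n rb m = tetG p ra n * tetG p rb m / tetG p (ra * rb) (n + m) := by
  have hz : ∀ (x : ℂ) (k : ℤ), x ^ |k| = x ^ k.natAbs := fun x k => by
    rw [Int.abs_eq_natAbs, zpow_natCast]
  have hz' : ∀ (x : ℂ) (k : ℤ), x ^ (-|k|) = (x ^ k.natAbs)⁻¹ := fun x k => by
    rw [zpow_neg, hz]
  have e0 : (-p ^ 2 : ℂ) ^ ((|n| + |m| - |n + m|) / 2) =
      (I * p) ^ n.natAbs * (I * p) ^ m.natAbs / (I * p) ^ (n + m).natAbs := by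
    have hIp : I * p ≠ 0 := mul_ne_zero I_ne_zero hp0
    -- Since I p is a square root of -q^(1/2), the halved exponent splits into one power for each
    -- gamma.
    have h2 : (-p ^ 2 : ℂ) = (I * p) ^ (2 : ℤ) := by
      rw [zpow_ofNat, mul_pow, I_sq]
      ring
    have h3 : 2 * ((|n| + |m| - |n + m|) / 2) = (n.natAbs : ℤ) + m.natAbs - (n + m).natAbs := by
      rcases abs_cases n with h | h <;> rcases abs_cases m with h' | h' <;>
        rcases abs_cases (n + m) with h'' | h'' <;> omega
    rw [h2, ← zpow_mul, h3, zpow_sub₀ hIp, zpow_add₀ hIp]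
    simp only [zpow_natCast]
  have e1 : (p ^ 2) ^ 2 = p ^ 4 := by ring
  simp only [pentB, tetG, hz, hz', e0, e1, ← pow_mul p 2, mul_pow ra rb 2]
  generalize qPoch (p ^ 4 * p ^ (2 * n.natAbs) * (ra ^ 2)⁻¹) (p ^ 4) = x₁
  generalize qPoch (p ^ 4 * p ^ (2 * m.natAbs) * (rb ^ 2)⁻¹) (p ^ 4) = x₂
  generalize qPoch (p ^ 4 * p ^ (2 * (n + m).natAbs) * (ra ^ 2 * rb ^ 2)⁻¹) (p ^ 4) = x₃
  generalize qPoch (p ^ (2 * n.natAbs) * ra ^ 2) (p ^ 4) = x₄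
  generalize qPoch (p ^ (2 * m.natAbs) * rb ^ 2) (p ^ 4) = x₅
  generalize qPoch (p ^ (2 * (n + m).natAbs) * (ra ^ 2 * rb ^ 2)) (p ^ 4) = x₆
  simp only [div_pow, mul_pow]
  field_simp

theorem differentiableAt_tetG {p r : ℂ} (hp1 : ‖p‖ < 1) (hr0 : r ≠ 0) (n : ℤ)
    (hr : ‖p ^ (2 * n.natAbs) * r ^ 2‖ < 1) : DifferentiableAt ℂ (fun r => tetG p r n) r := by
  have hq := norm_pow_four_lt_one hp1
  have hd := differentiable_qPoch hq
  have h1 : qPoch (p ^ (2 * n.natAbs) * r ^ 2) (p ^ 4) ≠ 0 := qPoch_ne_zero hq hr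
  have h2 : r ^ 2 ≠ 0 := pow_ne_zero _ hr0
  refine DifferentiableAt.mul (DifferentiableAt.pow ?_ _) (DifferentiableAt.div ?_ ?_ h1)
  · exact (differentiableAt_const _).div differentiableAt_id hr0
  · exact (hd _).comp r (((differentiableAt_id.pow 2).inv h2).const_mul _)
  · exact (hd _).comp r ((differentiableAt_id.pow 2).const_mul _)

/-- The growth sits in the prefactor; the q-products are bounded uniformly in n. The upper condition
is put on the argument of the denominator instead of on r, so that |r| may approach 1 when n ≠ 0. -/
theorem exists_norm_tetG_le {p : ℂ} (hp1 : ‖p‖ < 1) {r₀ R : ℝ} (hr₀ : 0 < r₀) (hR : R < 1) :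
    ∃ C > 0, ∀ (r : ℂ) (n : ℤ), r₀ ≤ ‖r‖ → ‖p ^ (2 * n.natAbs) * r ^ 2‖ ≤ R →
      ‖tetG p r n‖ ≤ C * (‖p‖ / ‖r‖) ^ n.natAbs := by
  have hq := norm_pow_four_lt_one hp1
  obtain ⟨C, hC0, hC⟩ := exists_norm_qPoch_le hq ((r₀ ^ 2)⁻¹)
  obtain ⟨c, hc0, hc⟩ := exists_le_norm_qPoch hq hR
  refine ⟨C / c, by positivity, fun r n h1 h2 => ?_⟩
  have hnum : ‖p ^ 4 * p ^ (2 * n.natAbs) * (r ^ 2)⁻¹‖ ≤ (r₀ ^ 2)⁻¹ := by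
    rw [← pow_add, norm_mul, norm_inv, norm_pow, norm_pow]
    calc ‖p‖ ^ (4 + 2 * n.natAbs) * (‖r‖ ^ 2)⁻¹ ≤ 1 * (r₀ ^ 2)⁻¹ := by
          gcongr
          exact pow_le_one₀ (norm_nonneg _) hp1.le
      _ = _ := one_mul _
  rw [tetG, norm_mul, norm_pow, norm_div, norm_div, norm_mul, norm_I, one_mul, mul_comm]
  gcongr
  · exact hC _ hnum
  · exact hc _ h2

theorem exists_le_norm_tetG {p : ℂ} (hp1 : ‖p‖ < 1) {r₀ R : ℝ} (hr₀ : ‖p‖ ^ 2 < r₀)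
    (hR : R < 1) :
    ∃ c > 0, ∀ (r : ℂ) (n : ℤ), r₀ ≤ ‖r‖ → ‖r‖ ≤ R →
      c * (‖p‖ / ‖r‖) ^ n.natAbs ≤ ‖tetG p r n‖ := by
  have hq := norm_pow_four_lt_one hp1
  have hr0 : 0 < r₀ := lt_of_le_of_lt (by positivity) hr₀
  obtain ⟨C, hC0, hC⟩ := exists_norm_qPoch_le hq 1
  obtain ⟨c, hc0, hc⟩ := exists_le_norm_qPoch hq (R := (‖p‖ ^ 2 / r₀) ^ 2)
    (pow_lt_one₀ (by positivity) ((div_lt_one hr0).2 hr₀) (by norm_num))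
  refine ⟨c / C, by positivity, fun r n h1 h2 => ?_⟩
  have hr1 : ‖r‖ < 1 := h2.trans_lt hR
  have hnum : ‖p ^ 4 * p ^ (2 * n.natAbs) * (r ^ 2)⁻¹‖ ≤ (‖p‖ ^ 2 / r₀) ^ 2 := by
    have : ‖p ^ 4 * p ^ (2 * n.natAbs) * (r ^ 2)⁻¹‖ =
        ‖p‖ ^ (2 * n.natAbs) * (‖p‖ ^ 2 / ‖r‖) ^ 2 := by
      simp only [norm_mul, norm_pow, norm_inv]
      rw [div_pow]
      ring
    rw [this]
    calc _ ≤ 1 * (‖p‖ ^ 2 / r₀) ^ 2 := by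
          gcongr
          exact pow_le_one₀ (norm_nonneg _) hp1.le
      _ = _ := one_mul _
  have hden := (norm_pow_mul_sq_lt_one hp1 hr1 (2 * n.natAbs))
  have hden0 : 0 < ‖qPoch (p ^ (2 * n.natAbs) * r ^ 2) (p ^ 4)‖ :=
    norm_pos_iff.2 (qPoch_ne_zero hq hden)
  rw [tetG, norm_mul, norm_pow, norm_div, norm_div, norm_mul, norm_I, one_mul, mul_comm]
  gcongr
  · exact hc _ hnum
  · exact hC _ hden.le

/-! ### The summand of the hypergeometric sum/integral -/

/-- Fixed offsets of the index can be absorbed into constants, whether x lies above or below 1. -/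
theorem pow_natAbs_add_le {x M : ℝ} (hx : 0 < x) (hM : x ≤ M) (hM' : x⁻¹ ≤ M) (n k : ℤ) :
    x ^ (n + k).natAbs ≤ M ^ n.natAbs * x ^ k.natAbs := by
  rcases le_total 1 x with h | h
  · calc x ^ (n + k).natAbs ≤ x ^ (n.natAbs + k.natAbs) :=
          pow_le_pow_right₀ h (Int.natAbs_add_le n k)
      _ = x ^ n.natAbs * x ^ k.natAbs := pow_add _ _ _
      _ ≤ _ := by gcongr
  · have h1 : k.natAbs ≤ (n + k).natAbs + n.natAbs := by omega
    have h2 : x ^ (n + k).natAbs * x ^ n.natAbs ≤ x ^ k.natAbs := by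
      rw [← pow_add]
      exact pow_le_pow_of_le_one hx.le h h1
    calc x ^ (n + k).natAbs ≤ (x ^ n.natAbs)⁻¹ * x ^ k.natAbs := by
          rw [inv_mul_eq_div, le_div_iff₀ (by positivity)]
          exact h2
      _ = (x⁻¹) ^ n.natAbs * x ^ k.natAbs := by rw [inv_pow]
      _ ≤ _ := by gcongr

theorem pow_natAbs_le_add {x M : ℝ} (hx : 0 < x) (hM : x ≤ M) (hM' : x⁻¹ ≤ M) (n k : ℤ) :
    x ^ k.natAbs ≤ M ^ n.natAbs * x ^ (n + k).natAbs := by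
  simpa using pow_natAbs_add_le hx hM hM' (-n) (n + k)

theorem exists_norm_tetG_add_le {p : ℂ} (hp0 : p ≠ 0) (hp1 : ‖p‖ < 1) {r₀ R : ℝ} (hr₀ : 0 < r₀)
    (hR : R < 1) (n : ℤ) :
    ∃ C > 0, ∀ (r : ℂ) (k : ℤ), r₀ ≤ ‖r‖ → ‖r‖ ≤ 1 → ‖p ^ (2 * (n + k).natAbs) * r ^ 2‖ ≤ R →
      ‖tetG p r (n + k)‖ ≤ C * (‖p‖ / ‖r‖) ^ k.natAbs := by
  obtain ⟨C, hC0, hC⟩ := exists_norm_tetG_le hp1 hr₀ hR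
  have hp : 0 < ‖p‖ := norm_pos_iff.2 hp0
  have hM : 0 < r₀⁻¹ + ‖p‖⁻¹ := by positivity
  refine ⟨C * (r₀⁻¹ + ‖p‖⁻¹) ^ n.natAbs, by positivity, fun r k h1 h2 h3 => ?_⟩
  have hr : 0 < ‖r‖ := hr₀.trans_le h1
  calc ‖tetG p r (n + k)‖ ≤ C * (‖p‖ / ‖r‖) ^ (n + k).natAbs := hC r _ h1 h3
    _ ≤ C * ((r₀⁻¹ + ‖p‖⁻¹) ^ n.natAbs * (‖p‖ / ‖r‖) ^ k.natAbs) := by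
        gcongr
        refine pow_natAbs_add_le (by positivity) ?_ ?_ n k
        · calc ‖p‖ / ‖r‖ ≤ 1 / r₀ := by gcongr
            _ ≤ _ := by
              rw [one_div]
              exact le_add_of_nonneg_right (by positivity)
        · calc (‖p‖ / ‖r‖)⁻¹ = ‖r‖ / ‖p‖ := inv_div _ _
            _ ≤ 1 / ‖p‖ := by gcongr
            _ ≤ _ := by
              rw [one_div]
              exact le_add_of_nonneg_left (by positivity)
    _ = _ := by ring

theorem tetG_sub (p r : ℂ) (m k : ℤ) : tetG p r (m - k) = tetG p r (-m + k) := by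
  rw [← tetG_neg_index]
  congr 1
  ring

/-- The summand `∏ᵢ G(rᵢ y, nᵢ + k) G(ρᵢ / y, mᵢ - k)`. -/
noncomputable def hyperTerm (p : ℂ) (r ρ : Fin 3 → ℂ) (n m : Fin 3 → ℤ) (k : ℤ) (y : ℂ) : ℂ :=
  ∏ i, (tetG p (r i * y) (n i + k) * tetG p (ρ i / y) (m i - k))

/-- The sum over `k` of the mean of `hyperTerm` over the unit circle. -/
noncomputable def hyperSum (p : ℂ) (r ρ : Fin 3 → ℂ) (n m : Fin 3 → ℤ) : ℂ :=
  ∑' k : ℤ, Real.circleAverage (hyperTerm p r ρ n m k) 0 1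

/-- The product `∏ᵢⱼ G(rᵢ ρⱼ, nᵢ + mⱼ)`. -/
noncomputable def hyperProd (p : ℂ) (r ρ : Fin 3 → ℂ) (n m : Fin 3 → ℤ) : ℂ :=
  ∏ i, ∏ j, tetG p (r i * ρ j) (n i + m j)

theorem norm_pow_mul_sq_le {p r : ℂ} (hp1 : ‖p‖ < 1) {R : ℝ} (hr : ‖r‖ ≤ R) (N : ℕ) :
    ‖p ^ N * r ^ 2‖ ≤ R ^ 2 := by
  rw [norm_mul, norm_pow, norm_pow]
  calc ‖p‖ ^ N * ‖r‖ ^ 2 ≤ 1 * R ^ 2 := by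
        gcongr
        exact pow_le_one₀ (norm_nonneg _) hp1.le
    _ = _ := one_mul _

/-- Each of the six gammas contributes |p| over the modulus of its parameter. The hypotheses depend
on the index so that the bound survives the pinching limit, where two parameters tend to modulus 1.
-/
theorem exists_norm_hyperTerm_le_of_index {p : ℂ} (hp0 : p ≠ 0) (hp1 : ‖p‖ < 1) {r₀ R : ℝ}
    (hr₀ : 0 < r₀) (hR : R < 1) (n m : Fin 3 → ℤ) :
    ∃ C > 0, ∀ (r ρ : Fin 3 → ℂ) (k : ℤ),
      (∀ i, r₀ ≤ ‖r i‖ ∧ ‖r i‖ ≤ 1 ∧ ‖p ^ (2 * (n i + k).natAbs) * r i ^ 2‖ ≤ R) →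
      (∀ i, r₀ ≤ ‖ρ i‖ ∧ ‖ρ i‖ ≤ 1 ∧ ‖p ^ (2 * (-m i + k).natAbs) * ρ i ^ 2‖ ≤ R) →
      ∀ y : ℂ, ‖y‖ = 1 →
        ‖hyperTerm p r ρ n m k y‖ ≤ C * (‖p‖ ^ 6 / ‖∏ i, r i * ρ i‖) ^ k.natAbs := by
  choose A hA0 hA using fun i => exists_norm_tetG_add_le hp0 hp1 hr₀ hR (n i)
  choose B hB0 hB using fun i => exists_norm_tetG_add_le hp0 hp1 hr₀ hR (-m i)
  refine ⟨∏ i, A i * B i, Finset.prod_pos fun i _ => mul_pos (hA0 i) (hB0 i),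
    fun r ρ k h h' y hy => ?_⟩
  have e : (∏ i, A i * B i) * (‖p‖ ^ 6 / ‖∏ i, r i * ρ i‖) ^ k.natAbs =
      ∏ i, ((A i * (‖p‖ / ‖r i‖) ^ k.natAbs) * (B i * (‖p‖ / ‖ρ i‖) ^ k.natAbs)) := by
    simp only [Fin.prod_univ_three, norm_mul]
    have : ‖p‖ ^ 6 / (‖r 0‖ * ‖ρ 0‖ * (‖r 1‖ * ‖ρ 1‖) * (‖r 2‖ * ‖ρ 2‖)) =
      (‖p‖ / ‖r 0‖) * (‖p‖ / ‖ρ 0‖) * ((‖p‖ / ‖r 1‖) * (‖p‖ / ‖ρ 1‖)) *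
        ((‖p‖ / ‖r 2‖) * (‖p‖ / ‖ρ 2‖)) := by ring
    rw [this]
    simp only [mul_pow]
    ring
  rw [hyperTerm, norm_prod, e]
  refine Finset.prod_le_prod (fun i _ => norm_nonneg _) fun i _ => ?_
  have h1 : ‖r i * y‖ = ‖r i‖ := by rw [norm_mul, hy, mul_one]
  have h2 : ‖ρ i / y‖ = ‖ρ i‖ := by rw [norm_div, hy, div_one]
  have h3 := hA i (r i * y) k (h1.symm ▸ (h i).1) (h1.symm ▸ (h i).2.1)
    (by simpa [norm_mul, norm_pow, hy] using (h i).2.2)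
  have h4 := hB i (ρ i / y) k (h2.symm ▸ (h' i).1) (h2.symm ▸ (h' i).2.1)
    (by simpa [norm_mul, norm_pow, hy] using (h' i).2.2)
  rw [h1] at h3
  rw [h2] at h4
  rw [norm_mul, tetG_sub]
  exact mul_le_mul h3 h4 (norm_nonneg _) (mul_nonneg (hA0 i).le (by positivity))

theorem exists_norm_hyperTerm_le {p : ℂ} (hp0 : p ≠ 0) (hp1 : ‖p‖ < 1) {r₀ R : ℝ} (hr₀ : 0 < r₀)
    (hR : R < 1) (n m : Fin 3 → ℤ) :
    ∃ C > 0, ∀ r ρ : Fin 3 → ℂ, (∀ i, r₀ ≤ ‖r i‖ ∧ ‖r i‖ ≤ R) → (∀ i, r₀ ≤ ‖ρ i‖ ∧ ‖ρ i‖ ≤ R) →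
      ∀ (k : ℤ) (y : ℂ), ‖y‖ = 1 →
        ‖hyperTerm p r ρ n m k y‖ ≤ C * (‖p‖ ^ 6 / ‖∏ i, r i * ρ i‖) ^ k.natAbs := by
  rcases lt_or_ge R 0 with hR0 | hR0
  · exact ⟨1, one_pos, fun r ρ h => absurd ((norm_nonneg _).trans (h 0).2) (not_le.2 hR0)⟩
  obtain ⟨C, hC0, hC⟩ := exists_norm_hyperTerm_le_of_index hp0 hp1 hr₀
    (pow_lt_one₀ hR0 hR two_ne_zero) n m
  exact ⟨C, hC0, fun r ρ h h' k y hy => hC r ρ k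
    (fun i => ⟨(h i).1, (h i).2.trans hR.le, norm_pow_mul_sq_le hp1 (h i).2 _⟩)
    (fun i => ⟨(h' i).1, (h' i).2.trans hR.le, norm_pow_mul_sq_le hp1 (h' i).2 _⟩) y hy⟩

theorem exists_between_all {ι : Type*} [Finite ι] {f : ι → ℝ} (h : ∀ i, 0 < f i ∧ f i < 1) :
    ∃ a > 0, ∃ b < 1, ∀ i, a < f i ∧ f i < b := by
  have h1 : ∀ᶠ a in nhdsWithin (0 : ℝ) (Set.Ioi 0), ∀ i, a < f i :=
    Filter.eventually_all.2 fun i => Filter.Eventually.filter_mono nhdsWithin_le_nhds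
      (eventually_lt_nhds (h i).1)
  have h2 : ∀ᶠ b in nhdsWithin (1 : ℝ) (Set.Iio 1), ∀ i, f i < b :=
    Filter.eventually_all.2 fun i => Filter.Eventually.filter_mono nhdsWithin_le_nhds
      (eventually_gt_nhds (h i).2)
  obtain ⟨a, ha, ha0⟩ := (h1.and self_mem_nhdsWithin).exists
  obtain ⟨b, hb, hb1⟩ := (h2.and self_mem_nhdsWithin).exists
  exact ⟨a, ha0, b, hb1, fun i => ⟨ha i, hb i⟩⟩

theorem exists_between_all₂ {r ρ : Fin 3 → ℂ} (hr : ∀ i, r i ≠ 0 ∧ ‖r i‖ < 1)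
    (hρ : ∀ i, ρ i ≠ 0 ∧ ‖ρ i‖ < 1) :
    ∃ a > 0, ∃ b < 1, (∀ i, a < ‖r i‖ ∧ ‖r i‖ < b) ∧ ∀ i, a < ‖ρ i‖ ∧ ‖ρ i‖ < b := by
  obtain ⟨a, ha, b, hb, h⟩ := exists_between_all (f := Sum.elim (fun i => ‖r i‖) fun i => ‖ρ i‖)
    (by
      rintro (i | i)
      · exact ⟨norm_pos_iff.2 (hr i).1, (hr i).2⟩
      · exact ⟨norm_pos_iff.2 (hρ i).1, (hρ i).2⟩)
  exact ⟨a, ha, b, hb, fun i => h (Sum.inl i), fun i => h (Sum.inr i)⟩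

theorem summable_pow_natAbs_int {x : ℝ} (h0 : 0 ≤ x) (h1 : x < 1) :
    Summable fun k : ℤ => x ^ k.natAbs := by
  rw [summable_int_iff_summable_nat_and_neg]
  simp [summable_geometric_of_lt_one h0 h1]

theorem norm_circleAverage_le {f : ℂ → ℂ} {C : ℝ} (h : ∀ y, ‖y‖ = 1 → ‖f y‖ ≤ C) :
    ‖Real.circleAverage f 0 1‖ ≤ C := by
  rw [Real.circleAverage_def, norm_smul]
  have h1 : ‖∫ θ in (0 : ℝ)..2 * Real.pi, f (circleMap 0 1 θ)‖ ≤ C * |2 * Real.pi - 0| :=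
    intervalIntegral.norm_integral_le_of_norm_le_const fun θ _ => h _ (by simp)
  have hpi := Real.pi_pos
  rw [sub_zero, abs_of_pos (by positivity)] at h1
  rw [Real.norm_of_nonneg (by positivity), inv_mul_le_iff₀ (by positivity)]
  linarith

theorem differentiableAt_hyperTerm {p : ℂ} (hp1 : ‖p‖ < 1) {r ρ : ℂ → Fin 3 → ℂ} {y : ℂ → ℂ}
    {z : ℂ} (n m : Fin 3 → ℤ) (k : ℤ) (hr : ∀ i, DifferentiableAt ℂ (fun z => r z i) z)
    (hρ : ∀ i, DifferentiableAt ℂ (fun z => ρ z i) z) (hy : DifferentiableAt ℂ y z)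
    (hr0 : ∀ i, r z i ≠ 0) (hρ0 : ∀ i, ρ z i ≠ 0) (hy0 : y z ≠ 0)
    (hr1 : ∀ i, ‖r z i * y z‖ < 1) (hρ1 : ∀ i, ‖ρ z i / y z‖ < 1) :
    DifferentiableAt ℂ (fun z => hyperTerm p (r z) (ρ z) n m k (y z)) z := by
  unfold hyperTerm
  refine DifferentiableAt.fun_finsetProd fun i _ => DifferentiableAt.mul ?_ ?_
  · exact (differentiableAt_tetG (r := r z i * y z) hp1 (mul_ne_zero (hr0 i) hy0) (n i + k)
      (norm_pow_mul_sq_lt_one hp1 (hr1 i) _)).comp z ((hr i).mul hy)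
  · exact (differentiableAt_tetG (r := ρ z i / y z) hp1 (div_ne_zero (hρ0 i) hy0) (m i - k)
      (norm_pow_mul_sq_lt_one hp1 (hρ1 i) _)).comp z ((hρ i).div hy hy0)

theorem continuousOn_hyperTerm {p : ℂ} (hp1 : ‖p‖ < 1) {r ρ : Fin 3 → ℂ} (n m : Fin 3 → ℤ) (k : ℤ)
    (hr : ∀ i, r i ≠ 0 ∧ ‖r i‖ < 1) (hρ : ∀ i, ρ i ≠ 0 ∧ ‖ρ i‖ < 1) :
    ContinuousOn (hyperTerm p r ρ n m k) (Metric.sphere 0 1) := by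
  intro y hy
  have hy1 : ‖y‖ = 1 := by simpa using hy
  have hy0 : y ≠ 0 := by
    rintro rfl
    simp at hy1
  refine (DifferentiableAt.continuousAt (𝕜 := ℂ) ?_).continuousWithinAt
  exact differentiableAt_hyperTerm (r := fun _ => r) (ρ := fun _ => ρ) (y := fun y => y) hp1 n m k
    (fun i => differentiableAt_const _) (fun i => differentiableAt_const _) differentiableAt_id
    (fun i => (hr i).1) (fun i => (hρ i).1) hy0
    (fun i => by rw [norm_mul, hy1, mul_one]; exact (hr i).2)
    (fun i => by rw [norm_div, hy1, div_one]; exact (hρ i).2)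

theorem circleIntegrable_hyperTerm {p : ℂ} (hp1 : ‖p‖ < 1) {r ρ : Fin 3 → ℂ} (n m : Fin 3 → ℤ)
    (k : ℤ) (hr : ∀ i, r i ≠ 0 ∧ ‖r i‖ < 1) (hρ : ∀ i, ρ i ≠ 0 ∧ ‖ρ i‖ < 1) :
    CircleIntegrable (hyperTerm p r ρ n m k) 0 1 :=
  (continuousOn_hyperTerm hp1 n m k hr hρ).circleIntegrable zero_le_one

theorem summable_hyperTerm {p : ℂ} (hp0 : p ≠ 0) (hp1 : ‖p‖ < 1) {r ρ : Fin 3 → ℂ}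
    (n m : Fin 3 → ℤ) (hr : ∀ i, r i ≠ 0 ∧ ‖r i‖ < 1) (hρ : ∀ i, ρ i ≠ 0 ∧ ‖ρ i‖ < 1)
    (hprod : ‖p‖ ^ 6 < ‖∏ i, r i * ρ i‖) :
    Summable fun k : ℤ => Real.circleAverage (hyperTerm p r ρ n m k) 0 1 := by
  obtain ⟨a, ha, b, hb, h1, h2⟩ := exists_between_all₂ hr hρ
  obtain ⟨C, hC0, hC⟩ := exists_norm_hyperTerm_le hp0 hp1 ha hb n m
  have h0 : 0 < ‖∏ i, r i * ρ i‖ := lt_of_le_of_lt (by positivity) hprod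
  refine Summable.of_norm_bounded ((summable_pow_natAbs_int (by positivity)
    ((div_lt_one h0).2 hprod)).mul_left C) fun k => norm_circleAverage_le fun y hy => ?_
  exact hC r ρ (fun i => ⟨(h1 i).1.le, (h1 i).2.le⟩) (fun i => ⟨(h2 i).1.le, (h2 i).2.le⟩) k y hy

/-! ### Holomorphic dependence on the parameters -/

/-- For holomorphic integrands a bound on the function is enough: Cauchy's estimate turns it into a
bound on the derivative on a smaller ball. -/
theorem differentiableAt_integral_of_bounded {X : Type*} [MeasurableSpace X] {μ : Measure X}
    {F : ℂ → X → ℂ} {z₀ : ℂ} {ε : ℝ} (hε : 0 < ε) {g : X → ℝ}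
    (hmeas : ∀ z ∈ Metric.ball z₀ ε, AEStronglyMeasurable (F z) μ)
    (hdiff : ∀ x, DifferentiableOn ℂ (fun z => F z x) (Metric.ball z₀ ε))
    (hbd : ∀ z ∈ Metric.ball z₀ ε, ∀ x, ‖F z x‖ ≤ g x) (hg : Integrable g μ) :
    DifferentiableAt ℂ (fun z => ∫ x, F z x ∂μ) z₀ := by
  have hz₀ : z₀ ∈ Metric.ball z₀ ε := Metric.mem_ball_self hε
  have hder : ∀ x, ∀ z ∈ Metric.ball z₀ ε, HasDerivAt (fun z => F z x) (deriv (fun z => F z x) z) z :=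
    fun x z hz => ((hdiff x).differentiableAt (Metric.isOpen_ball.mem_nhds hz)).hasDerivAt
  have hsub : ∀ z ∈ Metric.ball z₀ (ε / 2), Metric.closedBall z (ε / 4) ⊆ Metric.ball z₀ ε := by
    intro z hz w hw
    rw [Metric.mem_ball] at hz ⊢
    rw [Metric.mem_closedBall] at hw
    linarith [dist_triangle w z z₀]
  refine (hasDerivAt_integral_of_dominated_loc_of_deriv_le (𝕜 := ℂ)
    (F' := fun z x => deriv (fun z => F z x) z)
    (bound := fun x => g x / (ε / 4)) (Metric.ball_mem_nhds z₀ (half_pos hε)) ?_ ?_ ?_ ?_ ?_ ?_).2.differentiableAt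
  · filter_upwards [Metric.ball_mem_nhds z₀ hε] with z hz using hmeas z hz
  · exact hg.mono' (hmeas z₀ hz₀) (.of_forall fun x => hbd z₀ hz₀ x)
  -- The derivative is measurable as a limit of difference quotients. The 2 in the denominator keeps
  -- every point inside the ball.
  · let u : ℕ → ℂ := fun N => z₀ + (ε / (N + 2) : ℝ)
    have hlim : Filter.Tendsto (fun N : ℕ => ε / ((N : ℝ) + 2)) Filter.atTop (nhds 0) :=
      tendsto_const_nhds.div_atTop
        (Filter.tendsto_atTop_add_const_right _ _ tendsto_natCast_atTop_atTop)
    have hpos : ∀ N : ℕ, 0 < ε / ((N : ℝ) + 2) := fun N => by positivity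
    have hu : Filter.Tendsto u Filter.atTop (nhdsWithin z₀ {z₀}ᶜ) := by
      refine tendsto_nhdsWithin_iff.2 ⟨?_, .of_forall fun N => ?_⟩
      · have := ((Complex.continuous_ofReal.tendsto 0).comp hlim).const_add z₀
        simpa [u] using this
      · have := (hpos N).ne'
        simp only [u, Set.mem_compl_iff, Set.mem_singleton_iff, add_eq_left, ofReal_eq_zero]
        exact this
    have hub : ∀ N, u N ∈ Metric.ball z₀ ε := fun N => by
      rw [mem_ball_iff_norm, add_sub_cancel_left, Complex.norm_real, Real.norm_of_nonneg (hpos N).le,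
        div_lt_iff₀ (by positivity)]
      nlinarith [hε, (Nat.cast_nonneg N : (0 : ℝ) ≤ N)]
    refine aestronglyMeasurable_of_tendsto_ae (u := Filter.atTop)
      (f := fun N x => slope (fun z => F z x) z₀ (u N)) (fun N => ?_) (.of_forall fun x => ?_)
    · simp only [slope, vsub_eq_sub]
      exact ((hmeas _ (hub N)).sub (hmeas _ hz₀)).const_smul (u N - z₀)⁻¹
    · exact (hasDerivAt_iff_tendsto_slope.1 (hder x z₀ hz₀)).comp hu
  · refine .of_forall fun x z hz => ?_
    refine Complex.norm_deriv_le_of_forall_mem_sphere_norm_le (by positivity) ?_ fun w hw => ?_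
    · refine ((hdiff x).mono ?_).diffContOnCl
      rw [closure_ball _ (by positivity)]
      exact hsub z hz
    · exact hbd w (hsub z hz (Metric.sphere_subset_closedBall hw)) x
  · exact hg.div_const _
  · exact .of_forall fun x z hz => hder x z (Metric.ball_subset_ball (by linarith) hz)

/-- On the balanced locus the geometric ratio is the constant |p|^6 / |p|² = |p|^4, so the series
converges locally uniformly in the parameters. -/
theorem differentiableAt_hyperSum {p : ℂ} (hp0 : p ≠ 0) (hp1 : ‖p‖ < 1) {r ρ : ℂ → Fin 3 → ℂ}
    {z₀ : ℂ} (n m : Fin 3 → ℤ)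
    (hr : ∀ᶠ z in nhds z₀, ∀ i, DifferentiableAt ℂ (fun z => r z i) z)
    (hρ : ∀ᶠ z in nhds z₀, ∀ i, DifferentiableAt ℂ (fun z => ρ z i) z)
    (hr1 : ∀ i, r z₀ i ≠ 0 ∧ ‖r z₀ i‖ < 1) (hρ1 : ∀ i, ρ z₀ i ≠ 0 ∧ ‖ρ z₀ i‖ < 1)
    (hprod : ∀ᶠ z in nhds z₀, ∏ i, r z i * ρ z i = -p ^ 2) :
    DifferentiableAt ℂ (fun z => hyperSum p (r z) (ρ z) n m) z₀ := by
  obtain ⟨a, ha, b, hb, h1, h2⟩ := exists_between_all₂ hr1 hρ1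
  obtain ⟨C, hC0, hC⟩ := exists_norm_hyperTerm_le hp0 hp1 ha hb n m
  have hnear : ∀ f : ℂ → Fin 3 → ℂ, (∀ᶠ z in nhds z₀, ∀ i, DifferentiableAt ℂ (fun z => f z i) z) →
      (∀ i, a < ‖f z₀ i‖ ∧ ‖f z₀ i‖ < b) →
        ∀ᶠ z in nhds z₀, ∀ i, a < ‖f z i‖ ∧ ‖f z i‖ < b := fun f hf hfi => by
    refine Filter.eventually_all.2 fun i => ?_
    have hc : Filter.Tendsto (fun z => ‖f z i‖) (nhds z₀) (nhds ‖f z₀ i‖) :=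
      (hf.self_of_nhds i).continuousAt.norm
    exact (hc.eventually_const_lt (hfi i).1).and (hc.eventually_lt_const (hfi i).2)
  obtain ⟨ε, hε, hball⟩ := Metric.eventually_nhds_iff_ball.1
    ((hr.and hρ).and ((hnear r hr h1).and ((hnear ρ hρ h2).and hprod)))
  have hp : 0 < ‖p‖ := norm_pos_iff.2 hp0
  have hbound : ∀ z ∈ Metric.ball z₀ ε, ∀ (k : ℤ) (y : ℂ), ‖y‖ = 1 →
      ‖hyperTerm p (r z) (ρ z) n m k y‖ ≤ C * (‖p‖ ^ 4) ^ k.natAbs := by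
    intro z hz k y hy
    obtain ⟨-, g1, g2, g3⟩ := hball z hz
    have := hC (r z) (ρ z) (fun i => ⟨(g1 i).1.le, (g1 i).2.le⟩)
      (fun i => ⟨(g2 i).1.le, (g2 i).2.le⟩) k y hy
    rwa [g3, norm_neg, norm_pow, show ‖p‖ ^ 6 / ‖p‖ ^ 2 = ‖p‖ ^ 4 by field_simp] at this
  have hne : ∀ z ∈ Metric.ball z₀ ε, (∀ i, r z i ≠ 0 ∧ ‖r z i‖ < 1) ∧ ∀ i, ρ z i ≠ 0 ∧ ‖ρ z i‖ < 1 := by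
    intro z hz
    obtain ⟨-, g1, g2, -⟩ := hball z hz
    exact ⟨fun i => ⟨norm_pos_iff.1 (ha.trans (g1 i).1), (g1 i).2.trans hb⟩,
      fun i => ⟨norm_pos_iff.1 (ha.trans (g2 i).1), (g2 i).2.trans hb⟩⟩
  have hsum : Summable fun k : ℤ => C * (‖p‖ ^ 4) ^ k.natAbs :=
    (summable_pow_natAbs_int (by positivity)
      (pow_lt_one₀ hp.le hp1 (by norm_num))).mul_left C
  have hd := Complex.differentiableOn_tsum_of_summable_norm hsum
    (F := fun k z => Real.circleAverage (hyperTerm p (r z) (ρ z) n m k) 0 1)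
    (fun k z hz => ?_) Metric.isOpen_ball
    (fun k z hz => norm_circleAverage_le fun y hy => hbound z hz k y hy)
  · exact hd.differentiableAt (Metric.ball_mem_nhds z₀ hε)
  · obtain ⟨δ, hδ, hsub⟩ := Metric.isOpen_iff.1 Metric.isOpen_ball z hz
    simp only [Real.circleAverage_def, intervalIntegral.integral_of_le Real.two_pi_pos.le]
    refine (DifferentiableAt.const_smul ?_ _).differentiableWithinAt
    refine differentiableAt_integral_of_bounded hδ
      (F := fun z θ => hyperTerm p (r z) (ρ z) n m k (circleMap 0 1 θ))
      (g := fun _ => C * (‖p‖ ^ 4) ^ k.natAbs) (fun w hw => ?_) (fun θ w hw => ?_)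
      (fun w hw θ => hbound w (hsub hw) k _ (by simp)) (integrable_const _)
    · have := hne w (hsub hw)
      exact (circleIntegrable_hyperTerm hp1 n m k this.1 this.2).1.aestronglyMeasurable
    · have g := hne w (hsub hw)
      have g' := (hball w (hsub hw)).1
      exact (differentiableAt_hyperTerm (y := fun _ => circleMap 0 1 θ) hp1 n m k g'.1 g'.2
        (differentiableAt_const _) (fun i => (g.1 i).1) (fun i => (g.2 i).1)
        (by simp)
        (fun i => by simpa using (g.1 i).2)
        (fun i => by simpa using (g.2 i).2)).differentiableWithinAt

/-! ### Change of the radius of integration -/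

theorem circleAverage_comp_mul (f : ℂ → ℂ) (c : ℂ) :
    Real.circleAverage (fun y => f (c * y)) 0 1 = Real.circleAverage f 0 ‖c‖ := by
  rw [Real.circleAverage_eq_integral_add (f := f) (arg c), Real.circleAverage_def]
  congr 2
  ext θ
  congr 1
  have : c = ‖c‖ * exp (arg c * I) := (norm_mul_exp_arg_mul_I c).symm
  simp only [circleMap, zero_add, ofReal_one, one_mul, ofReal_add, add_mul, exp_add]
  conv_lhs => rw [this]
  ring

theorem circleAverage_eq_of_differentiableAt {f : ℂ → ℂ} {a b : ℝ} (ha : 0 < a) (hab : a ≤ b)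
    (hf : ∀ z, a ≤ ‖z‖ → ‖z‖ ≤ b → DifferentiableAt ℂ f z) :
    Real.circleAverage f 0 b = Real.circleAverage f 0 a := by
  rw [Real.circleAverage_eq_circleIntegral (ha.trans_le hab).ne',
    Real.circleAverage_eq_circleIntegral ha.ne']
  congr 1
  refine circleIntegral_sub_center_inv_smul_eq_of_differentiable_on_annulus_off_countable ha hab
    Set.countable_empty (fun z hz => ?_) fun z hz => ?_
  · simp only [Set.mem_sdiff, mem_closedBall_zero_iff, mem_ball_zero_iff, not_lt] at hz
    exact (hf z hz.2 hz.1).continuousAt.continuousWithinAt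
  · simp only [Set.mem_sdiff, mem_closedBall_zero_iff, mem_ball_zero_iff, not_le] at hz
    exact hf z hz.1.2.le hz.1.1.le

theorem circleAverage_comp_mul_eq {f : ℂ → ℂ} {c : ℂ} (hc : c ≠ 0)
    (hf : ∀ z, min 1 ‖c‖ ≤ ‖z‖ → ‖z‖ ≤ max 1 ‖c‖ → DifferentiableAt ℂ f z) :
    Real.circleAverage (fun y => f (c * y)) 0 1 = Real.circleAverage f 0 1 := by
  have hc0 : 0 < ‖c‖ := norm_pos_iff.2 hc
  rw [circleAverage_comp_mul f c]
  rcases le_total 1 ‖c‖ with h | h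
  · rw [min_eq_left h, max_eq_right h] at hf
    exact circleAverage_eq_of_differentiableAt one_pos h hf
  · rw [min_eq_right h, max_eq_left h] at hf
    exact (circleAverage_eq_of_differentiableAt hc0 h hf).symm

/-- The contour moves from radius 1 to radius |c|. The conditions |rᵢ y| < 1 and |ρᵢ / y| < 1 hold
at both radii, hence between them, and no pole is crossed. -/
theorem circleAverage_hyperTerm_mul {p : ℂ} (hp1 : ‖p‖ < 1) {r ρ : Fin 3 → ℂ} {c : ℂ} (hc : c ≠ 0)
    (n m : Fin 3 → ℤ) (k : ℤ)
    (hr : ∀ i, r i ≠ 0 ∧ ‖r i‖ < 1) (hρ : ∀ i, ρ i ≠ 0 ∧ ‖ρ i‖ < 1)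
    (hr' : ∀ i, ‖c * r i‖ < 1) (hρ' : ∀ i, ‖ρ i / c‖ < 1) :
    Real.circleAverage (fun y => hyperTerm p r ρ n m k (c * y)) 0 1 =
      Real.circleAverage (hyperTerm p r ρ n m k) 0 1 := by
  have hc0 : 0 < ‖c‖ := norm_pos_iff.2 hc
  refine circleAverage_comp_mul_eq hc fun z hz1 hz2 => ?_
  have hz0 : 0 < ‖z‖ := lt_of_lt_of_le (by positivity) hz1
  refine differentiableAt_hyperTerm (r := fun _ => r) (ρ := fun _ => ρ) (y := fun y => y) hp1 n m k
    (fun i => differentiableAt_const _) (fun i => differentiableAt_const _) differentiableAt_id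
    (fun i => (hr i).1) (fun i => (hρ i).1) (norm_pos_iff.1 hz0) (fun i => ?_) (fun i => ?_)
  · rw [norm_mul]
    have h1 := hr' i
    rw [norm_mul, mul_comm] at h1
    refine (mul_le_mul_of_nonneg_left hz2 (norm_nonneg _)).trans_lt ?_
    rcases max_cases 1 ‖c‖ with h | h <;> rw [h.1]
    · simpa using (hr i).2
    · exact h1
  · have h1 := hρ' i
    rw [norm_div] at h1 ⊢
    rw [div_lt_one hc0] at h1
    rw [div_lt_one hz0]
    exact (lt_min (hρ i).2 h1).trans_le hz1

theorem hyperTerm_mul (p c : ℂ) (r ρ : Fin 3 → ℂ) (n m : Fin 3 → ℤ) (k : ℤ) (y : ℂ) :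
    hyperTerm p (fun i => c * r i) (fun i => ρ i / c) n m k y = hyperTerm p r ρ n m k (c * y) := by
  unfold hyperTerm
  refine Finset.prod_congr rfl fun i _ => ?_
  rw [div_div, mul_left_comm, mul_assoc]

theorem hyperSum_mul {p : ℂ} (hp1 : ‖p‖ < 1) {r ρ : Fin 3 → ℂ} {c : ℂ} (hc : c ≠ 0)
    (n m : Fin 3 → ℤ)
    (hr : ∀ i, r i ≠ 0 ∧ ‖r i‖ < 1) (hρ : ∀ i, ρ i ≠ 0 ∧ ‖ρ i‖ < 1)
    (hr' : ∀ i, ‖c * r i‖ < 1) (hρ' : ∀ i, ‖ρ i / c‖ < 1) :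
    hyperSum p (fun i => c * r i) (fun i => ρ i / c) n m = hyperSum p r ρ n m := by
  unfold hyperSum
  refine tsum_congr fun k => ?_
  rw [← circleAverage_hyperTerm_mul hp1 hc n m k hr hρ hr' hρ']
  congr 1
  ext y
  exact hyperTerm_mul p c r ρ n m k y

theorem hyperProd_mul (p : ℂ) (r ρ : Fin 3 → ℂ) {c : ℂ} (hc : c ≠ 0) (n m : Fin 3 → ℤ) :
    hyperProd p (fun i => c * r i) (fun i => ρ i / c) n m = hyperProd p r ρ n m := by
  unfold hyperProd
  refine Finset.prod_congr rfl fun i _ => Finset.prod_congr rfl fun j _ => ?_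
  congr 1
  field_simp

/-! ### Symmetries and nonvanishing -/

theorem hyperSum_neg (p : ℂ) (r ρ : Fin 3 → ℂ) (n m : Fin 3 → ℤ) :
    hyperSum p r ρ (-n) (-m) = hyperSum p r ρ n m := by
  unfold hyperSum
  rw [← (Equiv.neg ℤ).tsum_eq]
  refine tsum_congr fun k => ?_
  congr 1
  ext y
  unfold hyperTerm
  refine Finset.prod_congr rfl fun i _ => ?_
  rw [← tetG_neg_index p (r i * y), ← tetG_neg_index p (ρ i / y)]
  simp only [Pi.neg_apply, Equiv.neg_apply]
  congr 2 <;> ring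

theorem hyperProd_neg (p : ℂ) (r ρ : Fin 3 → ℂ) (n m : Fin 3 → ℤ) :
    hyperProd p r ρ (-n) (-m) = hyperProd p r ρ n m := by
  unfold hyperProd
  refine Finset.prod_congr rfl fun i _ => Finset.prod_congr rfl fun j _ => ?_
  rw [← tetG_neg_index p (r i * ρ j)]
  simp only [Pi.neg_apply]
  congr 1
  ring

theorem prod_three_lt {f : Fin 3 → ℝ} (hf : ∀ i, 0 < f i ∧ f i < 1) (i : Fin 3) :
    ∏ j, f j < f i := by
  have key : ∀ a b c : ℝ, 0 < a → 0 < b → b < 1 → c < 1 → 0 < c → a * b * c < a :=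
    fun a b c ha hb hb1 hc1 hc => by
      rw [mul_assoc]
      exact mul_lt_of_lt_one_right ha (mul_lt_one_of_nonneg_of_lt_one_left hb.le hb1 hc1.le)
  have h0 := hf 0
  have h1 := hf 1
  have h2 := hf 2
  rw [Fin.prod_univ_three]
  fin_cases i
  · exact key _ _ _ h0.1 h1.1 h1.2 h2.2 h2.1
  · rw [mul_comm (f 0)]
    exact key _ _ _ h1.1 h0.1 h0.2 h2.2 h2.1
  · rw [mul_comm, ← mul_assoc]
    exact key _ _ _ h2.1 h0.1 h0.2 h1.2 h1.1

/-- Here |p|² is the product of six moduli below 1, so dropping four of them increases it. This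
places every factor of the product side where `tetG` has neither zero nor pole. -/
theorem norm_sq_lt_norm_mul {p : ℂ} {r ρ : Fin 3 → ℂ}
    (hr : ∀ i, r i ≠ 0 ∧ ‖r i‖ < 1) (hρ : ∀ i, ρ i ≠ 0 ∧ ‖ρ i‖ < 1)
    (hprod : ∏ i, r i * ρ i = -p ^ 2) (i j : Fin 3) : ‖p‖ ^ 2 < ‖r i * ρ j‖ := by
  have h : ‖p‖ ^ 2 = (∏ i, ‖r i‖) * ∏ j, ‖ρ j‖ := by
    rw [← norm_prod, ← norm_prod, ← norm_mul, ← Finset.prod_mul_distrib, hprod, norm_neg, norm_pow]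
  have h1 := prod_three_lt (fun i => ⟨norm_pos_iff.2 (hr i).1, (hr i).2⟩) i
  have h2 := prod_three_lt (fun i => ⟨norm_pos_iff.2 (hρ i).1, (hρ i).2⟩) j
  rw [h, norm_mul]
  exact mul_lt_mul'' h1 h2 (Finset.prod_nonneg fun _ _ => norm_nonneg _)
    (Finset.prod_nonneg fun _ _ => norm_nonneg _)

theorem norm_mul_lt_one {a b : ℂ} (ha : ‖a‖ < 1) (hb : ‖b‖ < 1) : ‖a * b‖ < 1 := by
  rw [norm_mul]
  exact mul_lt_one_of_nonneg_of_lt_one_left (norm_nonneg _) ha hb.le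

theorem hyperProd_ne_zero {p : ℂ} (hp0 : p ≠ 0) (hp1 : ‖p‖ < 1) {r ρ : Fin 3 → ℂ}
    (n m : Fin 3 → ℤ) (hr : ∀ i, r i ≠ 0 ∧ ‖r i‖ < 1) (hρ : ∀ i, ρ i ≠ 0 ∧ ‖ρ i‖ < 1)
    (hprod : ∏ i, r i * ρ i = -p ^ 2) : hyperProd p r ρ n m ≠ 0 :=
  Finset.prod_ne_zero_iff.2 fun i _ => Finset.prod_ne_zero_iff.2 fun j _ =>
    tetG_ne_zero hp0 hp1 (norm_sq_lt_norm_mul hr hρ hprod i j)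
      (norm_mul_lt_one (hr i).2 (hρ j).2) _

/-! ### The difference equation -/

/-- The factor `I (x⁻¹ - x)` by which `tetG` changes under a shift. -/
noncomputable def shiftFactor (x : ℂ) : ℂ := I * (x⁻¹ - x)

/-- Both sides are Laurent polynomials in e. The product condition is exactly what kills the e³ and
e⁻³ terms on the right; the rest is checked after eliminating b₀. -/
theorem shiftFactor_identity {a₀ a₁ a₂ b₀ b₁ b₂ e : ℂ} (ha₀ : a₀ ≠ 0) (ha₁ : a₁ ≠ 0) (ha₂ : a₂ ≠ 0)
    (hb₁ : b₁ ≠ 0) (hb₂ : b₂ ≠ 0) (he : e ≠ 0)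
    (h : a₀ * a₁ * a₂ * b₀ * b₁ * b₂ = -1) :
    shiftFactor (a₁ * b₀) * shiftFactor (a₂ * b₀) * shiftFactor (a₀ * e) -
        shiftFactor (a₀ * b₁) * shiftFactor (a₀ * b₂) * shiftFactor (b₀ / e) =
      shiftFactor (a₀ * e) * shiftFactor (a₁ * e) * shiftFactor (a₂ * e) -
        shiftFactor (b₀ / e) * shiftFactor (b₁ / e) * shiftFactor (b₂ / e) := by
  have hb₀ : b₀ = -(a₀ * a₁ * a₂ * b₁ * b₂)⁻¹ := by
    field_simp
    linear_combination h
  subst hb₀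
  unfold shiftFactor
  field_simp
  ring

theorem tetG_shift_factor {p r : ℂ} (hp0 : p ≠ 0) (hp1 : ‖p‖ < 1) (hr0 : r ≠ 0) (hr1 : ‖r‖ < 1)
    (n : ℤ) : tetG p (p * r) (n + 1) = shiftFactor (p ^ n * r) * tetG p r n :=
  tetG_shift hp0 hp1 hr0 hr1 n

theorem tetG_eq_shift_factor_mul {p r : ℂ} (hp0 : p ≠ 0) (hp1 : ‖p‖ < 1) (hr0 : r ≠ 0)
    (hr1 : ‖r‖ < ‖p‖) (n : ℤ) :
    tetG p r n = shiftFactor (p ^ n * r / p ^ 2) * tetG p (r / p) (n - 1) := by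
  have hp := norm_pos_iff.2 hp0
  have h := tetG_shift_factor (r := r / p) hp0 hp1 (div_ne_zero hr0 hp0)
    (by rwa [norm_div, div_lt_one hp]) (n - 1)
  rw [mul_div_cancel₀ _ hp0, sub_add_cancel] at h
  rw [h, zpow_sub_one₀ hp0]
  congr 2
  field_simp

theorem forall_vec_three {P : ℂ → Prop} {a b c : ℂ} :
    (∀ i, P (![a, b, c] i)) ↔ P a ∧ P b ∧ P c := by
  simp [Fin.forall_fin_succ]

theorem mul_circleAverage_sub {f g : ℂ → ℂ} (a b : ℂ) (hf : CircleIntegrable f 0 1)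
    (hg : CircleIntegrable g 0 1) :
    a * Real.circleAverage f 0 1 - b * Real.circleAverage g 0 1 =
      Real.circleAverage (fun y => a * f y - b * g y) 0 1 := by
  have h := Real.circleAverage_sub (hf.const_smul (a := a)) (hg.const_smul (a := b))
  rw [Real.circleAverage_smul, Real.circleAverage_smul] at h
  exact h.symm

theorem tsum_shift_sub_eq_zero {g : ℤ → ℂ} (hg : Summable g) : ∑' k, (g (k + 1) - g k) = 0 := by
  have hg' : Summable fun k => g (k + 1) := (Equiv.addRight (1 : ℤ)).summable_iff.2 hg
  rw [hg'.tsum_sub hg]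
  exact sub_eq_zero.2 ((Equiv.addRight (1 : ℤ)).tsum_eq g)

/-- All four terms share six gamma factors. Once these are divided out, the claim is
`shiftFactor_identity` at e = p^k y. The right side is the increment of one auxiliary summand under
(k, y) ↦ (k + 1, p y), so it vanishes after summation and a shift of contour. -/
theorem hyperTerm_telescope {p r₀ r₁ r₂ ρ₀ ρ₁ ρ₂ : ℂ} {n₀ n₁ n₂ m₀ m₁ m₂ : ℤ} (hp0 : p ≠ 0)
    (hp1 : ‖p‖ < 1) (hr : ∀ i, ![r₀, r₁, r₂] i ≠ 0 ∧ ‖![r₀, r₁, r₂] i‖ < 1)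
    (hρ : ∀ i, ![ρ₀, ρ₁, ρ₂] i ≠ 0 ∧ ‖![ρ₀, ρ₁, ρ₂] i‖ < 1) (hρ₀ : ‖ρ₀‖ < ‖p‖)
    (hprod : r₀ * ρ₀ * (r₁ * ρ₁) * (r₂ * ρ₂) = -p ^ 2) (hsum : n₀ + n₁ + n₂ + m₀ + m₁ + m₂ = 0)
    (k : ℤ) {y : ℂ} (hy : ‖y‖ = 1) :
    shiftFactor (p ^ (n₁ + m₀) * (r₁ * ρ₀) / p ^ 2) * shiftFactor (p ^ (n₂ + m₀) * (r₂ * ρ₀) / p ^ 2) *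
        hyperTerm p ![p * r₀, r₁, r₂] ![ρ₀ / p, ρ₁, ρ₂] ![n₀ + 1, n₁, n₂] ![m₀ - 1, m₁, m₂] k y -
      shiftFactor (p ^ (n₀ + m₁) * (r₀ * ρ₁)) * shiftFactor (p ^ (n₀ + m₂) * (r₀ * ρ₂)) *
        hyperTerm p ![r₀, r₁, r₂] ![ρ₀, ρ₁, ρ₂] ![n₀, n₁, n₂] ![m₀, m₁, m₂] k y =
    hyperTerm p ![r₀, r₁, r₂] ![ρ₀, p * ρ₁, p * ρ₂] ![n₀, n₁, n₂] ![m₀, m₁ + 1, m₂ + 1] (k + 1) (p * y) -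
      hyperTerm p ![r₀, r₁, r₂] ![ρ₀, p * ρ₁, p * ρ₂] ![n₀, n₁, n₂] ![m₀, m₁ + 1, m₂ + 1] k y := by
  have hy0 : y ≠ 0 := by
    rintro rfl
    simp at hy
  have hr0 := hr 0
  have hr1 := hr 1
  have hr2 := hr 2
  have hρ0 := hρ 0
  have hρ1 := hρ 1
  have hρ2 := hρ 2
  simp only [Matrix.cons_val] at hr0 hr1 hr2 hρ0 hρ1 hρ2
  have up : ∀ {a : ℂ} (n : ℤ), a ≠ 0 ∧ ‖a‖ < 1 →
      tetG p (p * (a * y)) (n + k + 1) = shiftFactor (p ^ n * a * (p ^ k * y)) * tetG p (a * y) (n + k) :=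
    fun {a} n ha => by
      rw [tetG_shift_factor hp0 hp1 (mul_ne_zero ha.1 hy0) (by rw [norm_mul, hy, mul_one]; exact ha.2),
        zpow_add₀ hp0]
      congr 2
      ring
  have down : ∀ {a : ℂ} (m : ℤ), a ≠ 0 ∧ ‖a‖ < 1 →
      tetG p (p * (a / y)) (m - k + 1) = shiftFactor (p ^ m * a / (p ^ k * y)) * tetG p (a / y) (m - k) :=
    fun {a} m ha => by
      rw [tetG_shift_factor hp0 hp1 (div_ne_zero ha.1 hy0) (by rw [norm_div, hy, div_one]; exact ha.2),
        zpow_sub₀ hp0]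
      congr 2
      field_simp
  have down' : tetG p (ρ₀ / y) (m₀ - k) =
      shiftFactor (p ^ m₀ * ρ₀ / p ^ 2 / (p ^ k * y)) * tetG p (ρ₀ / p / y) (m₀ - 1 - k) := by
    rw [tetG_eq_shift_factor_mul hp0 hp1 (div_ne_zero hρ0.1 hy0)
      (by rw [norm_div, hy, div_one]; exact hρ₀), zpow_sub₀ hp0]
    congr 2
    · field_simp
    · field_simp
    · ring
  -- Dividing b₀ by p² turns the balancing value -p² into the required -1; the powers of p from the
  -- indices cancel because the indices add up to 0.
  have key := shiftFactor_identity (a₀ := p ^ n₀ * r₀) (a₁ := p ^ n₁ * r₁) (a₂ := p ^ n₂ * r₂)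
    (b₀ := p ^ m₀ * ρ₀ / p ^ 2) (b₁ := p ^ m₁ * ρ₁) (b₂ := p ^ m₂ * ρ₂) (e := p ^ k * y)
    (mul_ne_zero (zpow_ne_zero _ hp0) hr0.1) (mul_ne_zero (zpow_ne_zero _ hp0) hr1.1)
    (mul_ne_zero (zpow_ne_zero _ hp0) hr2.1) (mul_ne_zero (zpow_ne_zero _ hp0) hρ1.1)
    (mul_ne_zero (zpow_ne_zero _ hp0) hρ2.1) (mul_ne_zero (zpow_ne_zero _ hp0) hy0) (by
      have hz : p ^ n₀ * p ^ n₁ * p ^ n₂ * p ^ m₀ * p ^ m₁ * p ^ m₂ = 1 := by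
        rw [← zpow_add₀ hp0, ← zpow_add₀ hp0, ← zpow_add₀ hp0, ← zpow_add₀ hp0, ← zpow_add₀ hp0, hsum,
          zpow_zero]
      calc _ = (p ^ n₀ * p ^ n₁ * p ^ n₂ * p ^ m₀ * p ^ m₁ * p ^ m₂) *
            (r₀ * ρ₀ * (r₁ * ρ₁) * (r₂ * ρ₂)) / p ^ 2 := by ring
        _ = -1 := by
          rw [hz, hprod]
          field_simp)
  have c1 : p ^ (n₁ + m₀) * (r₁ * ρ₀) / p ^ 2 = p ^ n₁ * r₁ * (p ^ m₀ * ρ₀ / p ^ 2) := by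
    rw [zpow_add₀ hp0]; ring
  have c2 : p ^ (n₂ + m₀) * (r₂ * ρ₀) / p ^ 2 = p ^ n₂ * r₂ * (p ^ m₀ * ρ₀ / p ^ 2) := by
    rw [zpow_add₀ hp0]; ring
  have c3 : p ^ (n₀ + m₁) * (r₀ * ρ₁) = p ^ n₀ * r₀ * (p ^ m₁ * ρ₁) := by
    rw [zpow_add₀ hp0]; ring
  have c4 : p ^ (n₀ + m₂) * (r₀ * ρ₂) = p ^ n₀ * r₀ * (p ^ m₂ * ρ₂) := by
    rw [zpow_add₀ hp0]; ring
  rw [c1, c2, c3, c4]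
  simp only [hyperTerm, Fin.prod_univ_three, Matrix.cons_val]
  have d0 : tetG p (p * r₀ * y) (n₀ + 1 + k) =
      shiftFactor (p ^ n₀ * r₀ * (p ^ k * y)) * tetG p (r₀ * y) (n₀ + k) := by
    rw [← up n₀ hr0]; congr 1 <;> ring
  have u : ∀ {a : ℂ} (n : ℤ), a ≠ 0 ∧ ‖a‖ < 1 → tetG p (a * (p * y)) (n + (k + 1)) =
      shiftFactor (p ^ n * a * (p ^ k * y)) * tetG p (a * y) (n + k) := fun n ha => by
    rw [← up n ha]; congr 1 <;> ring
  have d1 : ∀ {a : ℂ} (m : ℤ), a ≠ 0 ∧ ‖a‖ < 1 → tetG p (p * a / y) (m + 1 - k) =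
      shiftFactor (p ^ m * a / (p ^ k * y)) * tetG p (a / y) (m - k) := fun m ha => by
    rw [← down m ha]; congr 1 <;> ring
  have d2 : ∀ (a : ℂ) (m : ℤ), tetG p (p * a / (p * y)) (m + 1 - (k + 1)) = tetG p (a / y) (m - k) :=
    fun a m => by
      congr 1
      · field_simp
      · ring
  have d3 : tetG p (ρ₀ / (p * y)) (m₀ - (k + 1)) = tetG p (ρ₀ / p / y) (m₀ - 1 - k) := by
    congr 1
    · field_simp
    · ring
  rw [d0, u n₀ hr0, u n₁ hr1, u n₂ hr2, d1 m₁ hρ1, d1 m₂ hρ2, d2, d2, d3, down']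
  linear_combination (tetG p (r₀ * y) (n₀ + k) * tetG p (ρ₀ / p / y) (m₀ - 1 - k) *
    (tetG p (r₁ * y) (n₁ + k) * tetG p (ρ₁ / y) (m₁ - k)) *
    (tetG p (r₂ * y) (n₂ + k) * tetG p (ρ₂ / y) (m₂ - k))) * key

/-- The quotient of the sum/integral by the product. -/
noncomputable def hyperRatio (p : ℂ) (r ρ : Fin 3 → ℂ) (n m : Fin 3 → ℤ) : ℂ :=
  hyperSum p r ρ n m / hyperProd p r ρ n m

/-- Only four of the nine gammas change, since r₀ρ₀ and its index are preserved. The coefficients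
are those of `hyperTerm_telescope`, so sum and product satisfy the same recursion. -/
theorem hyperProd_shift {p r₀ r₁ r₂ ρ₀ ρ₁ ρ₂ : ℂ} (n₀ n₁ n₂ m₀ m₁ m₂ : ℤ) (hp0 : p ≠ 0)
    (hp1 : ‖p‖ < 1) (hr : ∀ i, ![r₀, r₁, r₂] i ≠ 0 ∧ ‖![r₀, r₁, r₂] i‖ < 1)
    (hρ : ∀ i, ![ρ₀, ρ₁, ρ₂] i ≠ 0 ∧ ‖![ρ₀, ρ₁, ρ₂] i‖ < 1) (hρ₀ : ‖ρ₀‖ < ‖p‖) :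
    shiftFactor (p ^ (n₁ + m₀) * (r₁ * ρ₀) / p ^ 2) * shiftFactor (p ^ (n₂ + m₀) * (r₂ * ρ₀) / p ^ 2) *
        hyperProd p ![p * r₀, r₁, r₂] ![ρ₀ / p, ρ₁, ρ₂] ![n₀ + 1, n₁, n₂] ![m₀ - 1, m₁, m₂] =
      shiftFactor (p ^ (n₀ + m₁) * (r₀ * ρ₁)) * shiftFactor (p ^ (n₀ + m₂) * (r₀ * ρ₂)) *
        hyperProd p ![r₀, r₁, r₂] ![ρ₀, ρ₁, ρ₂] ![n₀, n₁, n₂] ![m₀, m₁, m₂] := by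
  have hr0 := hr 0
  have hr1 := hr 1
  have hr2 := hr 2
  have hρ0 := hρ 0
  have hρ1 := hρ 1
  have hρ2 := hρ 2
  simp only [Matrix.cons_val] at hr0 hr1 hr2 hρ0 hρ1 hρ2
  have up : ∀ {b : ℂ} (m : ℤ), b ≠ 0 ∧ ‖b‖ < 1 →
      tetG p (p * r₀ * b) (n₀ + 1 + m) = shiftFactor (p ^ (n₀ + m) * (r₀ * b)) * tetG p (r₀ * b) (n₀ + m) :=
    fun {b} m hb => by
      rw [← tetG_shift_factor hp0 hp1 (mul_ne_zero hr0.1 hb.1) (norm_mul_lt_one hr0.2 hb.2)]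
      congr 1 <;> ring
  have down : ∀ {a : ℂ} (n : ℤ), a ≠ 0 ∧ ‖a‖ < 1 → tetG p (a * ρ₀) (n + m₀) =
      shiftFactor (p ^ (n + m₀) * (a * ρ₀) / p ^ 2) * tetG p (a * (ρ₀ / p)) (n + (m₀ - 1)) :=
    fun {a} n ha => by
      rw [tetG_eq_shift_factor_mul hp0 hp1 (mul_ne_zero ha.1 hρ0.1)]
      · congr 2 <;> ring
      · rw [norm_mul]
        exact (mul_le_of_le_one_left (norm_nonneg _) ha.2.le).trans_lt hρ₀
  have same : tetG p (p * r₀ * (ρ₀ / p)) (n₀ + 1 + (m₀ - 1)) = tetG p (r₀ * ρ₀) (n₀ + m₀) := by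
    congr 1
    · field_simp
    · ring
  simp only [hyperProd, Fin.prod_univ_three, Matrix.cons_val]
  rw [same, up m₁ hρ1, up m₂ hρ2, down n₁ hr1, down n₂ hr2]
  ring

theorem hyperRatio_shift_up {p r₀ r₁ r₂ ρ₀ ρ₁ ρ₂ : ℂ} {n₀ n₁ n₂ m₀ m₁ m₂ : ℤ} (hp0 : p ≠ 0)
    (hp1 : ‖p‖ < 1) (hr : ∀ i, ![r₀, r₁, r₂] i ≠ 0 ∧ ‖![r₀, r₁, r₂] i‖ < 1)
    (hρ : ∀ i, ![ρ₀, ρ₁, ρ₂] i ≠ 0 ∧ ‖![ρ₀, ρ₁, ρ₂] i‖ < 1) (hρ₀ : ‖ρ₀‖ < ‖p‖)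
    (hprod : r₀ * ρ₀ * (r₁ * ρ₁) * (r₂ * ρ₂) = -p ^ 2) (hsum : n₀ + n₁ + n₂ + m₀ + m₁ + m₂ = 0) :
    hyperRatio p ![p * r₀, r₁, r₂] ![ρ₀ / p, ρ₁, ρ₂] ![n₀ + 1, n₁, n₂] ![m₀ - 1, m₁, m₂] =
      hyperRatio p ![r₀, r₁, r₂] ![ρ₀, ρ₁, ρ₂] ![n₀, n₁, n₂] ![m₀, m₁, m₂] := by
  have hp := norm_pos_iff.2 hp0
  have hr' : ∀ i, ![p * r₀, r₁, r₂] i ≠ 0 ∧ ‖![p * r₀, r₁, r₂] i‖ < 1 := by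
    rw [forall_vec_three (P := fun x => x ≠ 0 ∧ ‖x‖ < 1)] at hr ⊢
    exact ⟨⟨mul_ne_zero hp0 hr.1.1, norm_mul_lt_one hp1 hr.1.2⟩, hr.2⟩
  have hρ' : ∀ i, ![ρ₀ / p, ρ₁, ρ₂] i ≠ 0 ∧ ‖![ρ₀ / p, ρ₁, ρ₂] i‖ < 1 := by
    rw [forall_vec_three (P := fun x => x ≠ 0 ∧ ‖x‖ < 1)] at hρ ⊢
    exact ⟨⟨div_ne_zero hρ.1.1 hp0, by rwa [norm_div, div_lt_one hp]⟩, hρ.2⟩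
  have hσ : ∀ i, ![ρ₀, p * ρ₁, p * ρ₂] i ≠ 0 ∧ ‖![ρ₀, p * ρ₁, p * ρ₂] i‖ < 1 := by
    rw [forall_vec_three (P := fun x => x ≠ 0 ∧ ‖x‖ < 1)] at hρ ⊢
    exact ⟨hρ.1, ⟨mul_ne_zero hp0 hρ.2.1.1, norm_mul_lt_one hp1 hρ.2.1.2⟩,
      mul_ne_zero hp0 hρ.2.2.1, norm_mul_lt_one hp1 hρ.2.2.2⟩
  have hp3 : ∏ i, ![r₀, r₁, r₂] i * ![ρ₀, ρ₁, ρ₂] i = -p ^ 2 := by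
    simpa [Fin.prod_univ_three] using hprod
  have hp3' : ∏ i, ![p * r₀, r₁, r₂] i * ![ρ₀ / p, ρ₁, ρ₂] i = -p ^ 2 := by
    simp only [Fin.prod_univ_three, Matrix.cons_val]
    rw [← hprod]
    field_simp
  -- The auxiliary summand is not balanced, but |p|^4 still exceeds the threshold |p|^6 for
  -- summability.
  have hp3σ : ∏ i, ![r₀, r₁, r₂] i * ![ρ₀, p * ρ₁, p * ρ₂] i = -p ^ 4 := by
    simp only [Fin.prod_univ_three, Matrix.cons_val]
    linear_combination p ^ 2 * hprod
  have h6 : ∀ N < 6, ‖p‖ ^ 6 < ‖-p ^ N‖ := fun N hN => by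
    rw [norm_neg, norm_pow]
    exact pow_lt_pow_right_of_lt_one₀ hp hp1 hN
  set A := shiftFactor (p ^ (n₁ + m₀) * (r₁ * ρ₀) / p ^ 2) *
    shiftFactor (p ^ (n₂ + m₀) * (r₂ * ρ₀) / p ^ 2) with hA
  set B := shiftFactor (p ^ (n₀ + m₁) * (r₀ * ρ₁)) * shiftFactor (p ^ (n₀ + m₂) * (r₀ * ρ₂)) with hB
  have hQ := hyperProd_shift n₀ n₁ n₂ m₀ m₁ m₂ hp0 hp1 hr hρ hρ₀
  rw [← hA, ← hB] at hQ
  have hQ0 := hyperProd_ne_zero hp0 hp1 ![n₀, n₁, n₂] ![m₀, m₁, m₂] hr hρ hp3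
  have hQ0' := hyperProd_ne_zero hp0 hp1 ![n₀ + 1, n₁, n₂] ![m₀ - 1, m₁, m₂] hr' hρ' hp3'
  -- Each factor of A divides a value of `tetG` that is known to be nonzero.
  have hA0 : A ≠ 0 := by
    have ha : ∀ (a : ℂ) (n : ℤ), a ≠ 0 ∧ ‖a‖ < 1 → ‖p‖ ^ 2 < ‖a * ρ₀‖ →
        shiftFactor (p ^ (n + m₀) * (a * ρ₀) / p ^ 2) ≠ 0 := fun a n ha h h0 => by
      have h1 := tetG_eq_shift_factor_mul hp0 hp1 (r := a * ρ₀) (mul_ne_zero ha.1 (hρ 0).1)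
        (by
          rw [norm_mul]
          exact (mul_le_of_le_one_left (norm_nonneg _) ha.2.le).trans_lt hρ₀) (n + m₀)
      rw [h0, zero_mul] at h1
      exact tetG_ne_zero hp0 hp1 h (norm_mul_lt_one ha.2 (hρ 0).2) _ h1
    exact mul_ne_zero (ha _ _ (hr 1) (norm_sq_lt_norm_mul hr hρ hp3 1 0))
      (ha _ _ (hr 2) (norm_sq_lt_norm_mul hr hρ hp3 2 0))
  have hS : A * hyperSum p ![p * r₀, r₁, r₂] ![ρ₀ / p, ρ₁, ρ₂] ![n₀ + 1, n₁, n₂] ![m₀ - 1, m₁, m₂] =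
      B * hyperSum p ![r₀, r₁, r₂] ![ρ₀, ρ₁, ρ₂] ![n₀, n₁, n₂] ![m₀, m₁, m₂] := by
    have s1 := summable_hyperTerm hp0 hp1 ![n₀, n₁, n₂] ![m₀, m₁, m₂] hr hρ (hp3 ▸ h6 2 (by norm_num))
    have s2 := summable_hyperTerm hp0 hp1 ![n₀ + 1, n₁, n₂] ![m₀ - 1, m₁, m₂] hr' hρ'
      (hp3' ▸ h6 2 (by norm_num))
    have s3 := summable_hyperTerm hp0 hp1 ![n₀, n₁, n₂] ![m₀, m₁ + 1, m₂ + 1] hr hσ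
      (hp3σ ▸ h6 4 (by norm_num))
    have hterm : ∀ k : ℤ,
        A * Real.circleAverage (hyperTerm p ![p * r₀, r₁, r₂] ![ρ₀ / p, ρ₁, ρ₂] ![n₀ + 1, n₁, n₂]
          ![m₀ - 1, m₁, m₂] k) 0 1 -
        B * Real.circleAverage (hyperTerm p ![r₀, r₁, r₂] ![ρ₀, ρ₁, ρ₂] ![n₀, n₁, n₂]
          ![m₀, m₁, m₂] k) 0 1 =
        Real.circleAverage (hyperTerm p ![r₀, r₁, r₂] ![ρ₀, p * ρ₁, p * ρ₂] ![n₀, n₁, n₂]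
          ![m₀, m₁ + 1, m₂ + 1] (k + 1)) 0 1 -
        Real.circleAverage (hyperTerm p ![r₀, r₁, r₂] ![ρ₀, p * ρ₁, p * ρ₂] ![n₀, n₁, n₂]
          ![m₀, m₁ + 1, m₂ + 1] k) 0 1 := fun k => by
      have i1 := circleIntegrable_hyperTerm hp1 ![n₀, n₁, n₂] ![m₀, m₁, m₂] k hr hρ
      have i2 := circleIntegrable_hyperTerm hp1 ![n₀ + 1, n₁, n₂] ![m₀ - 1, m₁, m₂] k hr' hρ'
      have i3 := circleIntegrable_hyperTerm hp1 ![n₀, n₁, n₂] ![m₀, m₁ + 1, m₂ + 1] k hr hσ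
      have cr : ∀ i, ‖p * ![r₀, r₁, r₂] i‖ < 1 := fun i => norm_mul_lt_one hp1 (hr i).2
      have cρ : ∀ i, ‖![ρ₀, p * ρ₁, p * ρ₂] i / p‖ < 1 := by
        rw [forall_vec_three (P := fun x => x ≠ 0 ∧ ‖x‖ < 1)] at hρ
        rw [forall_vec_three (P := fun x => ‖x / p‖ < 1)]
        exact ⟨by rwa [norm_div, div_lt_one hp], by rw [mul_div_cancel_left₀ _ hp0]; exact hρ.2.1.2,
          by rw [mul_div_cancel_left₀ _ hp0]; exact hρ.2.2.2⟩
      have i4 : CircleIntegrable (fun y => hyperTerm p ![r₀, r₁, r₂] ![ρ₀, p * ρ₁, p * ρ₂]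
          ![n₀, n₁, n₂] ![m₀, m₁ + 1, m₂ + 1] (k + 1) (p * y)) 0 1 := by
        have := circleIntegrable_hyperTerm hp1 (r := fun i => p * ![r₀, r₁, r₂] i)
          (ρ := fun i => ![ρ₀, p * ρ₁, p * ρ₂] i / p) ![n₀, n₁, n₂] ![m₀, m₁ + 1, m₂ + 1] (k + 1)
          (fun i => ⟨mul_ne_zero hp0 (hr i).1, cr i⟩) (fun i => ⟨div_ne_zero (hσ i).1 hp0, cρ i⟩)
        rwa [show hyperTerm p (fun i => p * ![r₀, r₁, r₂] i) (fun i => ![ρ₀, p * ρ₁, p * ρ₂] i / p)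
          ![n₀, n₁, n₂] ![m₀, m₁ + 1, m₂ + 1] (k + 1) = fun y => _ from
          funext fun y => hyperTerm_mul p p _ _ _ _ _ y] at this
      -- The contour of the shifted auxiliary term is moved to |p|, to match p y in the telescoping
      -- identity; the condition |ρ₀| < |p| is needed here.
      rw [← circleAverage_hyperTerm_mul hp1 hp0 ![n₀, n₁, n₂] ![m₀, m₁ + 1, m₂ + 1] (k + 1) hr hσ cr cρ]
      rw [← Real.circleAverage_sub i4 i3, mul_circleAverage_sub A B i2 i1]
      refine Real.circleAverage_congr_sphere fun y hy => ?_
      exact hyperTerm_telescope hp0 hp1 hr hρ hρ₀ hprod hsum k (by simpa using hy)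
    have hsub := tsum_congr (L := .unconditional ℤ) hterm
    rw [(s2.mul_left A).tsum_sub (s1.mul_left B), tsum_mul_left, tsum_mul_left] at hsub
    exact sub_eq_zero.1 (hsub.trans (tsum_shift_sub_eq_zero s3))
  unfold hyperRatio
  rw [div_eq_div_iff hQ0' hQ0]
  refine mul_left_cancel₀ hA0 ?_
  linear_combination (hyperProd p ![r₀, r₁, r₂] ![ρ₀, ρ₁, ρ₂] ![n₀, n₁, n₂] ![m₀, m₁, m₂]) * hS -
    (hyperSum p ![r₀, r₁, r₂] ![ρ₀, ρ₁, ρ₂] ![n₀, n₁, n₂] ![m₀, m₁, m₂]) * hQ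

theorem hyperRatio_neg (p : ℂ) (r ρ : Fin 3 → ℂ) (n m : Fin 3 → ℤ) :
    hyperRatio p r ρ (-n) (-m) = hyperRatio p r ρ n m := by
  rw [hyperRatio, hyperRatio, hyperSum_neg, hyperProd_neg]

/-- Reversing all indices leaves the ratio unchanged and converts the upward shift into the downward
one. -/
theorem hyperRatio_shift_down {p r₀ r₁ r₂ ρ₀ ρ₁ ρ₂ : ℂ} {n₀ n₁ n₂ m₀ m₁ m₂ : ℤ} (hp0 : p ≠ 0)
    (hp1 : ‖p‖ < 1) (hr : ∀ i, ![r₀, r₁, r₂] i ≠ 0 ∧ ‖![r₀, r₁, r₂] i‖ < 1)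
    (hρ : ∀ i, ![ρ₀, ρ₁, ρ₂] i ≠ 0 ∧ ‖![ρ₀, ρ₁, ρ₂] i‖ < 1) (hρ₀ : ‖ρ₀‖ < ‖p‖)
    (hprod : r₀ * ρ₀ * (r₁ * ρ₁) * (r₂ * ρ₂) = -p ^ 2) (hsum : n₀ + n₁ + n₂ + m₀ + m₁ + m₂ = 0) :
    hyperRatio p ![p * r₀, r₁, r₂] ![ρ₀ / p, ρ₁, ρ₂] ![n₀ - 1, n₁, n₂] ![m₀ + 1, m₁, m₂] =
      hyperRatio p ![r₀, r₁, r₂] ![ρ₀, ρ₁, ρ₂] ![n₀, n₁, n₂] ![m₀, m₁, m₂] := by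
  have h := hyperRatio_shift_up (n₀ := -n₀) (n₁ := -n₁) (n₂ := -n₂) (m₀ := -m₀) (m₁ := -m₁)
    (m₂ := -m₂) hp0 hp1 hr hρ hρ₀ hprod (by linarith)
  rw [← hyperRatio_neg, ← hyperRatio_neg p _ _ ![-n₀, -n₁, -n₂]] at h
  have e : ∀ a b c : ℤ, -![a, b, c] = ![-a, -b, -c] := fun a b c => by simp
  simp only [e, neg_neg] at h
  rwa [show -(-n₀ + 1) = n₀ - 1 by ring, show -(-m₀ - 1) = m₀ + 1 by ring] at h

/-! ### Independence of one parameter -/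

/-- The annulus is the image of a vertical strip under the exponential. -/
theorem isPreconnected_annulus {a b : ℝ} (ha : 0 < a) :
    IsPreconnected {z : ℂ | a < ‖z‖ ∧ ‖z‖ < b} := by
  rcases le_or_gt b a with hb | hb
  · convert isPreconnected_empty
    ext z
    simp only [Set.mem_ofPred_eq, Set.mem_empty_iff_false, iff_false]
    rintro ⟨h1, h2⟩
    linarith
  have hconv : Convex ℝ (reLm ⁻¹' Set.Ioo (Real.log a) (Real.log b)) :=
    (convex_Ioo _ _).linear_preimage reLm
  have himg := hconv.isPreconnected.image exp continuous_exp.continuousOn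
  convert himg
  ext z
  constructor
  · rintro ⟨h1, h2⟩
    have hz : z ≠ 0 := norm_pos_iff.1 (ha.trans h1)
    refine ⟨log z, ?_, exp_log hz⟩
    simp only [Set.mem_preimage, reLm_coe, log_re, Set.mem_Ioo]
    exact ⟨Real.log_lt_log ha h1, Real.log_lt_log (ha.trans h1) h2⟩
  · rintro ⟨w, hw, rfl⟩
    simp only [Set.mem_preimage, reLm_coe, Set.mem_Ioo] at hw
    rw [Set.mem_ofPred_eq, norm_exp]
    exact ⟨(Real.log_lt_iff_lt_exp ha).1 hw.1, (Real.lt_log_iff_exp_lt (ha.trans hb)).1 hw.2⟩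

theorem isOpen_annulus (a b : ℝ) : IsOpen {z : ℂ | a < ‖z‖ ∧ ‖z‖ < b} :=
  (isOpen_lt continuous_const continuous_norm).inter (isOpen_lt continuous_norm continuous_const)

/-- The modulus attains its maximum on a compact fundamental annulus, and by invariance this is the
maximum over the whole open annulus; the maximum principle then gives constancy. Invariance of the
modulus alone is assumed so that functions changing sign under the shift are covered. -/
theorem eq_of_norm_shift_invariant {p : ℂ} {l : ℝ} (hp0 : p ≠ 0) (hp1 : ‖p‖ < 1)
    (hl : ‖p‖ ^ 2 ≤ l) (hl' : l < ‖p‖) {g : ℂ → ℂ}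
    (hg : DifferentiableOn ℂ g {z | l < ‖z‖ ∧ ‖z‖ < 1})
    (hs : ∀ z, l < ‖p * z‖ → ‖z‖ < 1 → ‖g (p * z)‖ = ‖g z‖) {z w : ℂ}
    (hz : l < ‖z‖ ∧ ‖z‖ < 1) (hw : l < ‖w‖ ∧ ‖w‖ < 1) : g z = g w := by
  have hp : 0 < ‖p‖ := norm_pos_iff.2 hp0
  have hl0 : 0 < l := lt_of_lt_of_le (by positivity) hl
  -- With l/|p| < R < 1, the closed annulus |p|R ≤ |z| ≤ R lies in the domain, and since |p|² ≤ l a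
  -- single multiplication or division by p brings any other point into it.
  obtain ⟨R, hR1, hR2⟩ := exists_between ((div_lt_one hp).2 hl')
  have hpR : ‖p‖ < R := lt_of_le_of_lt (by rw [le_div_iff₀ hp]; nlinarith) hR1
  have hlR : l < ‖p‖ * R := by rwa [div_lt_iff₀' hp] at hR1
  have hR0 : 0 < R := hp.trans hpR
  have hKsub : Metric.closedBall (0 : ℂ) R \ Metric.ball 0 (‖p‖ * R) ⊆ {z | l < ‖z‖ ∧ ‖z‖ < 1} := by
    intro z hz
    simp only [Set.mem_sdiff, mem_closedBall_zero_iff, mem_ball_zero_iff, not_lt] at hz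
    exact ⟨hlR.trans_le hz.2, hz.1.trans_lt hR2⟩
  have hK : IsCompact (Metric.closedBall (0 : ℂ) R \ Metric.ball 0 (‖p‖ * R)) :=
    (isCompact_closedBall _ _).diff Metric.isOpen_ball
  obtain ⟨c, hcK, hc⟩ := hK.exists_isMaxOn (f := norm ∘ g) ⟨(R : ℂ), by
    simp only [Set.mem_sdiff, mem_closedBall_zero_iff, mem_ball_zero_iff, not_lt, norm_real,
      Real.norm_of_nonneg hR0.le, le_refl, true_and]
    nlinarith⟩ (hg.continuousOn.mono hKsub).norm
  have hmax : IsMaxOn (norm ∘ g) {z | l < ‖z‖ ∧ ‖z‖ < 1} c := by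
    rintro z ⟨hz1, hz2⟩
    simp only [Set.mem_ofPred_eq, Function.comp]
    rcases lt_or_ge R ‖z‖ with h | h
    · have hpz : ‖p * z‖ = ‖p‖ * ‖z‖ := norm_mul _ _
      rw [← hs z (by rw [hpz]; nlinarith) hz2]
      refine hc ?_
      simp only [Set.mem_sdiff, mem_closedBall_zero_iff, mem_ball_zero_iff, not_lt, hpz]
      constructor <;> nlinarith
    · rcases lt_or_ge ‖z‖ (‖p‖ * R) with h' | h'
      · have hzp : ‖z / p‖ = ‖z‖ / ‖p‖ := norm_div _ _
        have h1 : ‖z / p‖ < R := by rw [hzp, div_lt_iff₀' hp]; exact h'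
        have h2 := hs (z / p) (by rwa [mul_div_cancel₀ _ hp0]) (h1.trans hR2)
        rw [mul_div_cancel₀ _ hp0] at h2
        rw [h2]
        refine hc ?_
        simp only [Set.mem_sdiff, mem_closedBall_zero_iff, mem_ball_zero_iff, not_lt]
        refine ⟨h1.le, ?_⟩
        rw [hzp, le_div_iff₀ hp]
        nlinarith
      · refine hc ?_
        simp only [Set.mem_sdiff, mem_closedBall_zero_iff, mem_ball_zero_iff, not_lt]
        exact ⟨h, h'⟩
  have h := Complex.eqOn_of_isPreconnected_of_isMaxOn_norm (isPreconnected_annulus hl0)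
    (isOpen_annulus _ _) hg (hKsub hcK) hmax
  exact (h hz).trans (h hw).symm

/-- Multiplication of the argument by p exchanges f n and f (n + 1). Their sum is therefore
invariant and their difference changes sign; both have invariant modulus, so both are constant. -/
theorem eq_of_shift_invariant {p : ℂ} {l : ℝ} (hp0 : p ≠ 0) (hp1 : ‖p‖ < 1)
    (hl : ‖p‖ ^ 2 ≤ l) (hl' : l < ‖p‖) {f : ℤ → ℂ → ℂ}
    (hf : ∀ n, DifferentiableOn ℂ (f n) {z | l < ‖z‖ ∧ ‖z‖ < 1})
    (hup : ∀ n z, l < ‖p * z‖ → ‖z‖ < 1 → f (n + 1) (p * z) = f n z)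
    (hdown : ∀ n z, l < ‖p * z‖ → ‖z‖ < 1 → f (n - 1) (p * z) = f n z) (n n' : ℤ) {z w : ℂ}
    (hz : l < ‖z‖ ∧ ‖z‖ < 1) (hw : l < ‖w‖ ∧ ‖w‖ < 1) : f n z = f n' w := by
  have hp : 0 < ‖p‖ := norm_pos_iff.2 hp0
  have hl0 : 0 < l := lt_of_lt_of_le (by positivity) hl
  have hadd : ∀ n z, l < ‖p * z‖ → ‖z‖ < 1 → f n (p * z) = f (n + 1) z := fun n z h1 h2 => by
    simpa using hdown (n + 1) z h1 h2
  have hsum : ∀ n z w, (l < ‖z‖ ∧ ‖z‖ < 1) → (l < ‖w‖ ∧ ‖w‖ < 1) →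
      f n z + f (n + 1) z = f n w + f (n + 1) w := fun n z w hz hw =>
    eq_of_norm_shift_invariant hp0 hp1 hl hl' ((hf n).add (hf (n + 1)))
      (fun z h1 h2 => by
        simp only [Pi.add_apply]
        rw [hup n z h1 h2, hadd n z h1 h2, add_comm]) hz hw
  have hdiff : ∀ n z w, (l < ‖z‖ ∧ ‖z‖ < 1) → (l < ‖w‖ ∧ ‖w‖ < 1) →
      f n z - f (n + 1) z = f n w - f (n + 1) w := fun n z w hz hw =>
    eq_of_norm_shift_invariant hp0 hp1 hl hl' ((hf n).sub (hf (n + 1)))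
      (fun z h1 h2 => by
        simp only [Pi.sub_apply]
        rw [hup n z h1 h2, hadd n z h1 h2, norm_sub_rev]) hz hw
  have hconst : ∀ n z w, (l < ‖z‖ ∧ ‖z‖ < 1) → (l < ‖w‖ ∧ ‖w‖ < 1) → f n z = f n w :=
    fun n z w hz hw => by
      linear_combination (hsum n z w hz hw + hdiff n z w hz hw) / 2
  have hsucc : ∀ n, f (n + 1) w = f n w := fun n => by
    obtain ⟨R, hR1, hR2⟩ := exists_between ((div_lt_one hp).2 hl')
    have hR0 : 0 < R := lt_of_le_of_lt (by positivity) hR1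
    have hRn : ‖(R : ℂ)‖ = R := by rw [norm_real, Real.norm_of_nonneg hR0.le]
    have h1 : l < ‖p * R‖ := by rw [norm_mul, hRn]; rwa [div_lt_iff₀' hp] at hR1
    have h2 : ‖(R : ℂ)‖ < 1 := by rwa [hRn]
    have h3 : l < ‖(R : ℂ)‖ := by
      refine h1.trans_le ?_
      rw [norm_mul]
      exact mul_le_of_le_one_left (norm_nonneg _) hp1.le
    have h4 : ‖p * R‖ < 1 := norm_mul_lt_one hp1 h2
    rw [hconst (n + 1) w (p * R) hw ⟨h1, h4⟩, hup n R h1 h2, hconst n R w ⟨h3, h2⟩ hw]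
  have hall : ∀ n, f n w = f 0 w := fun n => by
    induction n using Int.induction_on with
    | zero => rfl
    | succ k ih => rw [hsucc, ih]
    | pred k ih => rw [← ih, ← hsucc (-k - 1), sub_add_cancel]
  rw [hconst n z w hz hw, hall n, hall n']

theorem differentiableAt_hyperRatio {p : ℂ} (hp0 : p ≠ 0) (hp1 : ‖p‖ < 1) {r ρ : ℂ → Fin 3 → ℂ}
    {z₀ : ℂ} (n m : Fin 3 → ℤ)
    (hr : ∀ᶠ z in nhds z₀, ∀ i, DifferentiableAt ℂ (fun z => r z i) z)
    (hρ : ∀ᶠ z in nhds z₀, ∀ i, DifferentiableAt ℂ (fun z => ρ z i) z)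
    (hr1 : ∀ i, r z₀ i ≠ 0 ∧ ‖r z₀ i‖ < 1) (hρ1 : ∀ i, ρ z₀ i ≠ 0 ∧ ‖ρ z₀ i‖ < 1)
    (hprod : ∀ᶠ z in nhds z₀, ∏ i, r z i * ρ z i = -p ^ 2) :
    DifferentiableAt ℂ (fun z => hyperRatio p (r z) (ρ z) n m) z₀ := by
  refine (differentiableAt_hyperSum hp0 hp1 n m hr hρ hr1 hρ1 hprod).div ?_
    (hyperProd_ne_zero hp0 hp1 n m hr1 hρ1 hprod.self_of_nhds)
  unfold hyperProd
  refine DifferentiableAt.fun_finsetProd fun i _ => DifferentiableAt.fun_finsetProd fun j _ => ?_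
  exact (differentiableAt_tetG (r := r z₀ i * ρ z₀ j) hp1 (mul_ne_zero (hr1 i).1 (hρ1 j).1) (n i + m j)
    (norm_pow_mul_sq_lt_one hp1 (norm_mul_lt_one (hr1 i).2 (hρ1 j).2) _)).comp z₀
    ((hr.self_of_nhds i).mul (hρ.self_of_nhds j))

/-- The ratio is regarded as a function of r₀ = z with ρ₀ = c / z, where c is the fixed product, on
the annulus |c| < |z| < 1. The condition |c| < |p| makes this annulus wide enough for the maximum
principle argument. -/
theorem hyperRatio_eq_of_mul_eq {p r₀ r₁ r₂ ρ₀ ρ₁ ρ₂ r₀' ρ₀' : ℂ} {n₀ n₁ n₂ m₀ m₁ m₂ n₀' m₀' : ℤ}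
    (hp0 : p ≠ 0) (hp1 : ‖p‖ < 1) (hr : ∀ i, ![r₀, r₁, r₂] i ≠ 0 ∧ ‖![r₀, r₁, r₂] i‖ < 1)
    (hρ : ∀ i, ![ρ₀, ρ₁, ρ₂] i ≠ 0 ∧ ‖![ρ₀, ρ₁, ρ₂] i‖ < 1)
    (hprod : r₀ * ρ₀ * (r₁ * ρ₁) * (r₂ * ρ₂) = -p ^ 2) (hsum : n₀ + n₁ + n₂ + m₀ + m₁ + m₂ = 0)
    (hsmall : ‖r₀ * ρ₀‖ < ‖p‖) (hr₀' : ‖r₀'‖ < 1) (hρ₀' : ‖ρ₀'‖ < 1) (hmul : r₀' * ρ₀' = r₀ * ρ₀)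
    (hadd : n₀' + m₀' = n₀ + m₀) :
    hyperRatio p ![r₀', r₁, r₂] ![ρ₀', ρ₁, ρ₂] ![n₀', n₁, n₂] ![m₀', m₁, m₂] =
      hyperRatio p ![r₀, r₁, r₂] ![ρ₀, ρ₁, ρ₂] ![n₀, n₁, n₂] ![m₀, m₁, m₂] := by
  have hp3 : ∏ i, ![r₀, r₁, r₂] i * ![ρ₀, ρ₁, ρ₂] i = -p ^ 2 := by
    simpa [Fin.prod_univ_three] using hprod
  have hlow : ‖p‖ ^ 2 < ‖r₀ * ρ₀‖ := norm_sq_lt_norm_mul hr hρ hp3 0 0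
  rw [forall_vec_three (P := fun x => x ≠ 0 ∧ ‖x‖ < 1)] at hr hρ
  have hc0 : r₀ * ρ₀ ≠ 0 := mul_ne_zero hr.1.1 hρ.1.1
  have hm : ∀ z : ℂ, ‖r₀ * ρ₀‖ < ‖z‖ → ‖z‖ < 1 → z ≠ 0 ∧
      (∀ i, ![z, r₁, r₂] i ≠ 0 ∧ ‖![z, r₁, r₂] i‖ < 1) ∧
      (∀ i, ![r₀ * ρ₀ / z, ρ₁, ρ₂] i ≠ 0 ∧ ‖![r₀ * ρ₀ / z, ρ₁, ρ₂] i‖ < 1) ∧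
      z * (r₀ * ρ₀ / z) * (r₁ * ρ₁) * (r₂ * ρ₂) = -p ^ 2 := fun z h1 h2 => by
    have hz : 0 < ‖z‖ := (norm_nonneg _).trans_lt h1
    have hz0 : z ≠ 0 := norm_pos_iff.1 hz
    rw [forall_vec_three (P := fun x => x ≠ 0 ∧ ‖x‖ < 1),
      forall_vec_three (P := fun x => x ≠ 0 ∧ ‖x‖ < 1)]
    exact ⟨hz0, ⟨⟨hz0, h2⟩, hr.2⟩, ⟨⟨div_ne_zero hc0 hz0, by rwa [norm_div, div_lt_one hz]⟩, hρ.2⟩,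
      by rw [mul_div_cancel₀ _ hz0, hprod]⟩
  have key := eq_of_shift_invariant hp0 hp1 hlow.le hsmall
    (f := fun n z => hyperRatio p ![z, r₁, r₂] ![r₀ * ρ₀ / z, ρ₁, ρ₂] ![n, n₁, n₂]
      ![n₀ + m₀ - n, m₁, m₂]) ?_ ?_ ?_ n₀' n₀ (z := r₀') (w := r₀) ?_ ?_
  · have h0 : r₀' ≠ 0 := by
      rintro rfl
      exact hc0 (by rw [← hmul, zero_mul])
    rw [← hmul, mul_div_cancel_left₀ _ h0, hmul, mul_div_cancel_left₀ _ hr.1.1, ← hadd,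
      add_sub_cancel_left, hadd, add_sub_cancel_left] at key
    exact key
  · intro n z hz
    refine DifferentiableAt.differentiableWithinAt ?_
    have hev : ∀ᶠ w in nhds z, ‖r₀ * ρ₀‖ < ‖w‖ ∧ ‖w‖ < 1 := (isOpen_annulus _ _).mem_nhds hz
    obtain ⟨h0, h1, h2, h3⟩ := hm z hz.1 hz.2
    refine differentiableAt_hyperRatio (r := fun z => ![z, r₁, r₂])
      (ρ := fun z => ![r₀ * ρ₀ / z, ρ₁, ρ₂]) hp0 hp1 _ _ ?_ ?_ h1 h2 ?_
    · refine .of_forall fun w i => ?_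
      fin_cases i
      · exact differentiableAt_id
      · exact differentiableAt_const _
      · exact differentiableAt_const _
    · filter_upwards [hev] with w hw i
      fin_cases i
      · exact (differentiableAt_const _).div differentiableAt_id (hm w hw.1 hw.2).1
      · exact differentiableAt_const _
      · exact differentiableAt_const _
    · filter_upwards [hev] with w hw
      simpa [Fin.prod_univ_three] using (hm w hw.1 hw.2).2.2.2
  · intro n z h1 h2
    have h1' : ‖r₀ * ρ₀‖ < ‖z‖ := by
      refine h1.trans_le ?_
      rw [norm_mul]
      exact mul_le_of_le_one_left (norm_nonneg _) hp1.le
    obtain ⟨g0, g1, g2, g3⟩ := hm z h1' h2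
    have := hyperRatio_shift_up (n₀ := n) (n₁ := n₁) (n₂ := n₂) (m₀ := n₀ + m₀ - n) (m₁ := m₁)
      (m₂ := m₂) hp0 hp1 g1 g2 (by
        rw [norm_div, div_lt_iff₀ (norm_pos_iff.2 g0), ← norm_mul]
        exact h1) g3 (by linarith)
    rw [← this, div_div, mul_comm z p, sub_sub]
  · intro n z h1 h2
    have h1' : ‖r₀ * ρ₀‖ < ‖z‖ := by
      refine h1.trans_le ?_
      rw [norm_mul]
      exact mul_le_of_le_one_left (norm_nonneg _) hp1.le
    obtain ⟨g0, g1, g2, g3⟩ := hm z h1' h2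
    have := hyperRatio_shift_down (n₀ := n) (n₁ := n₁) (n₂ := n₂) (m₀ := n₀ + m₀ - n) (m₁ := m₁)
      (m₂ := m₂) hp0 hp1 g1 g2 (by
        rw [norm_div, div_lt_iff₀ (norm_pos_iff.2 g0), ← norm_mul]
        exact h1) g3 (by linarith)
    rw [← this, div_div, mul_comm z p, ← sub_add]
  · refine ⟨?_, hr₀'⟩
    rw [← hmul, norm_mul]
    refine mul_lt_of_lt_one_right (norm_pos_iff.2 ?_) hρ₀'
    rintro rfl
    exact hc0 (by rw [← hmul, zero_mul])
  · refine ⟨?_, hr.1.2⟩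
    rw [norm_mul]
    exact mul_lt_of_lt_one_right (norm_pos_iff.2 hr.1.1) hρ.1.2

theorem hyperRatio_mul {p : ℂ} (hp1 : ‖p‖ < 1) {r ρ : Fin 3 → ℂ} {c : ℂ} (hc : c ≠ 0)
    (n m : Fin 3 → ℤ)
    (hr : ∀ i, r i ≠ 0 ∧ ‖r i‖ < 1) (hρ : ∀ i, ρ i ≠ 0 ∧ ‖ρ i‖ < 1)
    (hr' : ∀ i, ‖c * r i‖ < 1) (hρ' : ∀ i, ‖ρ i / c‖ < 1) :
    hyperRatio p (fun i => c * r i) (fun i => ρ i / c) n m = hyperRatio p r ρ n m := by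
  rw [hyperRatio, hyperRatio, hyperSum_mul hp1 hc n m hr hρ hr' hρ', hyperProd_mul p r ρ hc]

/-! ### A Poisson kernel -/

/-- The Poisson kernel at the square of a point of the unit circle. -/
noncomputable def sqPoisson (δ : ℝ) (y : ℂ) : ℝ := (1 - δ ^ 4) / ‖1 - δ ^ 2 * y ^ 2‖ ^ 2

theorem one_sub_mul_sq_ne_zero {δ : ℝ} (h0 : 0 ≤ δ) (h1 : δ < 1) {y : ℂ} (hy : ‖y‖ ≤ 1) :
    1 - (δ : ℂ) ^ 2 * y ^ 2 ≠ 0 := by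
  intro h
  have h2 : (δ : ℂ) ^ 2 * y ^ 2 = 1 := by linear_combination -h
  have h3 := congrArg norm h2
  rw [norm_mul, norm_pow, norm_pow, norm_real, Real.norm_of_nonneg h0, norm_one] at h3
  have h4 : δ ^ 2 < 1 := pow_lt_one₀ h0 h1 two_ne_zero
  have h5 : ‖y‖ ^ 2 ≤ 1 := pow_le_one₀ (norm_nonneg _) hy
  nlinarith [sq_nonneg δ]

theorem sqPoisson_nonneg {δ : ℝ} (h0 : 0 ≤ δ) (h1 : δ < 1) (y : ℂ) : 0 ≤ sqPoisson δ y :=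
  div_nonneg (sub_nonneg.2 (pow_le_one₀ h0 h1.le)) (by positivity)

theorem ofReal_sqPoisson {δ : ℝ} {y : ℂ} (hy : ‖y‖ = 1) :
    (sqPoisson δ y : ℂ) = (1 - δ ^ 4) / ((1 - δ ^ 2 * y ^ 2) * (1 - δ ^ 2 / y ^ 2)) := by
  have hc : (1 - (δ : ℂ) ^ 2 / y ^ 2) = (starRingEnd ℂ) (1 - δ ^ 2 * y ^ 2) := by
    rw [map_sub, map_mul, map_pow, map_pow, map_one, conj_ofReal, ← inv_eq_conj hy]
    ring
  rw [hc, mul_conj, normSq_eq_norm_sq, sqPoisson]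
  push_cast
  ring

theorem ofReal_sqPoisson_eq_add {δ : ℝ} (h0 : 0 ≤ δ) (h1 : δ < 1) {y : ℂ} (hy : ‖y‖ = 1) :
    (sqPoisson δ y : ℂ) = (1 - (δ : ℂ) ^ 2 * y ^ 2)⁻¹ +
      δ ^ 2 * y⁻¹ ^ 2 * (1 - (δ : ℂ) ^ 2 * y⁻¹ ^ 2)⁻¹ := by
  have hy0 : y ≠ 0 := norm_pos_iff.1 (by rw [hy]; exact one_pos)
  have e1 := one_sub_mul_sq_ne_zero h0 h1 hy.le
  have e2 := one_sub_mul_sq_ne_zero h0 h1 (y := y⁻¹) (by rw [norm_inv, hy, inv_one])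
  have e3 : (1 - (δ : ℂ) ^ 2 / y ^ 2) = 1 - (δ : ℂ) ^ 2 * y⁻¹ ^ 2 := by
    rw [inv_pow]
    rfl
  have e4 : y ^ 2 * y⁻¹ ^ 2 = 1 := by rw [← mul_pow, mul_inv_cancel₀ hy0, one_pow]
  rw [ofReal_sqPoisson hy, e3]
  generalize y⁻¹ = w at *
  field_simp
  linear_combination ((δ : ℂ) ^ 4) * e4

theorem continuousOn_ofReal_sqPoisson {δ : ℝ} (h0 : 0 ≤ δ) (h1 : δ < 1) :
    ContinuousOn (sqPoisson δ) (Metric.sphere 0 1) := by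
  intro y hy
  refine ContinuousAt.continuousWithinAt ?_
  have := norm_ne_zero_iff.2 (one_sub_mul_sq_ne_zero h0 h1 (y := y) (by simpa using hy.le))
  unfold sqPoisson
  fun_prop (disch := positivity)

/-- The kernel is a function holomorphic in y plus one holomorphic in y⁻¹; their means are the
values at the centre, 1 and 0. -/
theorem circleAverage_sqPoisson {δ : ℝ} (h0 : 0 ≤ δ) (h1 : δ < 1) :
    Real.circleAverage (sqPoisson δ) 0 1 = 1 := by
  have hcont : ContinuousOn (fun y : ℂ => (1 - (δ : ℂ) ^ 2 * y ^ 2)⁻¹) (Metric.closedBall 0 1) :=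
    fun y hy => ContinuousAt.continuousWithinAt (by
      have := one_sub_mul_sq_ne_zero h0 h1 (y := y) (by simpa using hy)
      fun_prop (disch := assumption))
  have hd : DiffContOnCl ℂ (fun y : ℂ => (1 - (δ : ℂ) ^ 2 * y ^ 2)⁻¹) (Metric.ball 0 |1|) := by
    rw [abs_one]
    refine ⟨fun y hy => DifferentiableAt.differentiableWithinAt ?_, ?_⟩
    · have := one_sub_mul_sq_ne_zero h0 h1 (y := y) (by simpa using (mem_ball_zero_iff.1 hy).le)
      fun_prop (disch := assumption)
    · rwa [closure_ball _ one_ne_zero]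
  have hd2 : DiffContOnCl ℂ (fun y : ℂ => (δ : ℂ) ^ 2 * y ^ 2 * (1 - (δ : ℂ) ^ 2 * y ^ 2)⁻¹)
      (Metric.ball 0 |1|) := by
    have : DiffContOnCl ℂ (fun y : ℂ => (δ : ℂ) ^ 2 * y ^ 2) (Metric.ball 0 |1|) :=
      Differentiable.diffContOnCl (by fun_prop)
    exact this.smul hd
  have m1 := hd.circleAverage
  have m2 := hd2.circleAverage
  rw [← Real.circleAverage_zero_one_congr_inv] at m2
  have hsub : Metric.sphere (0 : ℂ) 1 ⊆ Metric.closedBall 0 1 := Metric.sphere_subset_closedBall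
  have i1 : CircleIntegrable (fun y : ℂ => (1 - (δ : ℂ) ^ 2 * y ^ 2)⁻¹) 0 1 :=
    (hcont.mono hsub).circleIntegrable zero_le_one
  have i2 : CircleIntegrable (fun y : ℂ => (δ : ℂ) ^ 2 * y⁻¹ ^ 2 * (1 - (δ : ℂ) ^ 2 * y⁻¹ ^ 2)⁻¹) 0 1 := by
    refine ContinuousOn.circleIntegrable zero_le_one fun y hy => ContinuousAt.continuousWithinAt ?_
    have hy1 : ‖y‖ = 1 := by simpa using hy
    have hy0 : y ≠ 0 := norm_pos_iff.1 (by rw [hy1]; exact one_pos)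
    have := one_sub_mul_sq_ne_zero h0 h1 (y := y⁻¹) (by rw [norm_inv, hy1, inv_one])
    fun_prop (disch := assumption)
  have hsum := Real.circleAverage_add i1 i2
  have hc : Real.circleAverage (fun y => (sqPoisson δ y : ℂ)) 0 1 = 1 := by
    rw [Real.circleAverage_congr_sphere (f₂ := (fun y : ℂ => (1 - (δ : ℂ) ^ 2 * y ^ 2)⁻¹) +
      fun y : ℂ => (δ : ℂ) ^ 2 * y⁻¹ ^ 2 * (1 - (δ : ℂ) ^ 2 * y⁻¹ ^ 2)⁻¹) fun y hy =>
        ofReal_sqPoisson_eq_add h0 h1 (by simpa using hy), hsum, m1]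
    refine (congrArg (_ + ·) m2).trans ?_
    simp
  rw [Real.circleAverage_def, intervalIntegral.integral_ofReal] at hc
  rw [Real.circleAverage_def, smul_eq_mul]
  rw [real_smul] at hc
  exact_mod_cast hc

theorem norm_circleAverage_le_circleAverage {f : ℂ → ℂ} {g : ℂ → ℝ} (hf : ContinuousOn f (Metric.sphere 0 1))
    (hg : ContinuousOn g (Metric.sphere 0 1)) (h : ∀ y, ‖y‖ = 1 → ‖f y‖ ≤ g y) :
    ‖Real.circleAverage f 0 1‖ ≤ Real.circleAverage g 0 1 := by
  have hpi := Real.two_pi_pos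
  rw [Real.circleAverage_def, Real.circleAverage_def, norm_smul, Real.norm_of_nonneg (by positivity),
    smul_eq_mul]
  gcongr
  refine (intervalIntegral.norm_integral_le_integral_norm hpi.le).trans ?_
  refine intervalIntegral.integral_mono_on hpi.le (hf.circleIntegrable zero_le_one).norm
    (hg.circleIntegrable zero_le_one) fun θ _ => h _ (by simp)

/-- As δ → 1 the kernel concentrates at the two points y = ±1, where H takes the common value L. -/
theorem tendsto_circleAverage_sqPoisson {H : ℝ → ℂ → ℂ} {L : ℂ}
    (hH : ∀ y, ‖y‖ = 1 → ContinuousAt (fun x : ℝ × ℂ => H x.1 x.2) (1, y))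
    (h1 : H 1 1 = L) (h2 : H 1 (-1) = L)
    (hc : ∀ᶠ δ in nhdsWithin (1 : ℝ) (Set.Iio 1), ContinuousOn (H δ) (Metric.sphere 0 1)) :
    Filter.Tendsto (fun δ => Real.circleAverage (fun y => (sqPoisson δ y : ℂ) * H δ y) 0 1)
      (nhdsWithin (1 : ℝ) (Set.Iio 1)) (nhds L) := by
  rw [Metric.tendsto_nhds]
  intro ε hε
  have hloc : ∀ y ∈ Metric.sphere (0 : ℂ) 1, ∀ᶠ x : ℝ × ℂ in nhds (1, y),
      ‖(sqPoisson x.1 x.2 : ℂ) * (H x.1 x.2 - L)‖ ≤ ε / 3 * |sqPoisson x.1 x.2| + ε / 3 := by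
    intro y hy
    have hy1 : ‖y‖ = 1 := by simpa using hy
    have hcy := hH y hy1
    -- Near ±1 the factor H - L is small; elsewhere the kernel itself tends to 0. The common bound,
    -- kernel times ε/3 plus ε/3, has mean 2ε/3.
    by_cases hy2 : y ^ 2 = 1
    · have hL : H 1 y = L := by
        rcases sq_eq_sq_iff_eq_or_eq_neg.1 (hy2.trans (one_pow 2).symm) with rfl | rfl
        · exact h1
        · exact h2
      have hlim : Filter.Tendsto (fun x : ℝ × ℂ => ‖H x.1 x.2 - L‖) (nhds (1, y)) (nhds 0) := by
        have := (hcy.sub_const L).norm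
        simpa [ContinuousAt, hL] using this
      filter_upwards [hlim.eventually_lt_const (show (0 : ℝ) < ε / 3 by positivity)] with x hx
      rw [norm_mul, norm_real, Real.norm_eq_abs, mul_comm]
      have := mul_le_mul_of_nonneg_right hx.le (abs_nonneg (sqPoisson x.1 x.2))
      linarith
    · have hne : ‖1 - ((1 : ℝ) : ℂ) ^ 2 * y ^ 2‖ ^ 2 ≠ 0 := by
        rw [ofReal_one, one_pow, one_mul]
        exact pow_ne_zero _ (norm_ne_zero_iff.2 (sub_ne_zero.2 (Ne.symm hy2)))
      have hk : ContinuousAt (fun x : ℝ × ℂ => (sqPoisson x.1 x.2 : ℂ)) (1, y) := by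
        unfold sqPoisson
        refine Complex.continuous_ofReal.continuousAt.comp (ContinuousAt.div ?_ ?_ hne)
        · fun_prop
        · fun_prop
      have hlim : Filter.Tendsto (fun x : ℝ × ℂ => ‖(sqPoisson x.1 x.2 : ℂ) * (H x.1 x.2 - L)‖)
          (nhds (1, y)) (nhds 0) := by
        have := (hk.mul (hcy.sub_const L)).norm
        simpa [ContinuousAt, sqPoisson] using this
      filter_upwards [hlim.eventually_lt_const (show (0 : ℝ) < ε / 3 by positivity)] with x hx
      have : 0 ≤ ε / 3 * |sqPoisson x.1 x.2| := by positivity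
      linarith
  have hunif := (isCompact_sphere (0 : ℂ) 1).eventually_forall_of_forall_eventually
    (P := fun (δ : ℝ) y => ‖(sqPoisson δ y : ℂ) * (H δ y - L)‖ ≤ ε / 3 * |sqPoisson δ y| + ε / 3) hloc
  have hpos : ∀ᶠ δ in nhdsWithin (1 : ℝ) (Set.Iio 1), 0 < δ :=
    nhdsWithin_le_nhds (eventually_gt_nhds one_pos)
  filter_upwards [nhdsWithin_le_nhds hunif, hc, hpos, self_mem_nhdsWithin] with δ hδ hcδ h0 hlt
  have hk := continuousOn_ofReal_sqPoisson h0.le hlt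
  have hk' : ContinuousOn (fun y => (sqPoisson δ y : ℂ)) (Metric.sphere 0 1) :=
    Complex.continuous_ofReal.comp_continuousOn hk
  have hav := circleAverage_sqPoisson h0.le hlt
  have havc : Real.circleAverage (fun y => (sqPoisson δ y : ℂ) * L) 0 1 = L := by
    have : Real.circleAverage (fun y => (sqPoisson δ y : ℂ)) 0 1 = 1 := by
      rw [Real.circleAverage_def, smul_eq_mul] at hav
      rw [Real.circleAverage_def, intervalIntegral.integral_ofReal, real_smul]
      exact_mod_cast hav
    have h := Real.circleAverage_fun_smul (a := L) (f := fun y => (sqPoisson δ y : ℂ)) (c := 0) (R := 1)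
    rw [this, smul_eq_mul, mul_one] at h
    simpa [mul_comm] using h
  have hb := norm_circleAverage_le_circleAverage (f := fun y => (sqPoisson δ y : ℂ) * (H δ y - L))
    (g := fun y => ε / 3 * sqPoisson δ y + ε / 3) (hk'.mul (hcδ.sub continuousOn_const))
    ((hk.const_smul (ε / 3)).add continuousOn_const) fun y hy => by
      have := hδ y (by simpa using hy)
      rwa [abs_of_nonneg (sqPoisson_nonneg h0.le hlt y)] at this
  have hg : Real.circleAverage (fun y => ε / 3 * sqPoisson δ y + ε / 3) 0 1 = ε / 3 + ε / 3 := by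
    have h := Real.circleAverage_add (f₁ := fun y => (ε / 3) • sqPoisson δ y) (f₂ := fun _ => ε / 3)
      (c := 0) (R := 1) ((hk.const_smul (ε / 3)).circleIntegrable zero_le_one)
      (continuousOn_const.circleIntegrable zero_le_one)
    rw [Real.circleAverage_fun_smul, hav, Real.circleAverage_const, smul_eq_mul, mul_one] at h
    exact h
  have hsub := Real.circleAverage_sub (f₁ := fun y => (sqPoisson δ y : ℂ) * H δ y)
    (f₂ := fun y => (sqPoisson δ y : ℂ) * L) ((hk'.mul hcδ).circleIntegrable zero_le_one)
    ((hk'.mul continuousOn_const).circleIntegrable zero_le_one)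
  rw [havc] at hsub
  rw [dist_eq_norm, ← hsub]
  refine lt_of_eq_of_lt (congrArg (fun f => ‖Real.circleAverage f 0 1‖) ?_) (hb.trans_lt ?_)
  · ext y
    simp only [Pi.sub_apply]
    ring
  · rw [hg]
    linarith

/-! ### Evaluation at a pinched contour -/

/-- The function `(1 - r ^ 2) G(r, 0)`, regular at `r ^ 2 = 1`. -/
noncomputable def tetReg (p r : ℂ) : ℂ :=
  qPoch (p ^ 4 * (r ^ 2)⁻¹) (p ^ 4) / qPoch (r ^ 2 * p ^ 4) (p ^ 4)

theorem tetG_zero_eq {p : ℂ} (hp1 : ‖p‖ < 1) (r : ℂ) :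
    tetG p r 0 = tetReg p r / (1 - r ^ 2) := by
  have h := qPoch_eq_one_sub_mul (norm_pow_four_lt_one hp1) (r ^ 2)
  simp only [tetG, tetReg, Int.natAbs_zero, pow_zero, one_mul, mul_zero, mul_one]
  rw [h, mul_comm (1 - r ^ 2), div_div]

theorem norm_sq_mul_pow_four_lt_one {p r : ℂ} (hp1 : ‖p‖ < 1) (hr : ‖r‖ ≤ 1) : ‖r ^ 2 * p ^ 4‖ < 1 := by
  rw [norm_mul, norm_pow r]
  exact mul_lt_one_of_nonneg_of_lt_one_right (pow_le_one₀ (norm_nonneg _) hr) (norm_nonneg _)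
    (norm_pow_four_lt_one hp1)

theorem continuousAt_tetReg {p r : ℂ} (hp1 : ‖p‖ < 1) (hr0 : r ≠ 0) (hr : ‖r‖ ≤ 1) :
    ContinuousAt (tetReg p) r := by
  have hq := norm_pow_four_lt_one hp1
  have hc := (differentiable_qPoch hq).continuous
  have h1 := qPoch_ne_zero hq (norm_sq_mul_pow_four_lt_one hp1 hr)
  have h2 : r ^ 2 ≠ 0 := pow_ne_zero _ hr0
  unfold tetReg
  exact ContinuousAt.div (hc.continuousAt.comp (by fun_prop (disch := assumption)))
    (hc.continuousAt.comp (by fun_prop)) h1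

theorem tetReg_of_sq_eq_one {p r : ℂ} (hp1 : ‖p‖ < 1) (hr : r ^ 2 = 1) : tetReg p r = 1 := by
  have hq := norm_pow_four_lt_one hp1
  rw [tetReg, hr, inv_one, mul_one, one_mul]
  exact div_self (qPoch_ne_zero hq hq)

theorem continuousAt_tetG {p r : ℂ} (hp1 : ‖p‖ < 1) (hr0 : r ≠ 0) (hr : ‖r‖ < 1) (n : ℤ) :
    ContinuousAt (fun r => tetG p r n) r :=
  (differentiableAt_tetG hp1 hr0 n (norm_pow_mul_sq_lt_one hp1 hr _)).continuousAt

/-- The regular part of the pinched summand. -/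
noncomputable def pinchReg (p a b c e : ℂ) (n₁ n₂ m₀ m₁ m₂ : ℤ) (δ : ℝ) (y : ℂ) : ℂ :=
  tetReg p (δ * y) * tetReg p (δ / y) * tetG p (c / δ / y) (m₀ - m₁) * tetG p (a / δ * y) (n₁ + m₁) *
    tetG p (b / δ * y) (n₂ + m₁) * tetG p (e * δ / y) (m₂ - m₁)

theorem continuousAt_pinchReg {p a b c e : ℂ} (hp1 : ‖p‖ < 1) (n₁ n₂ m₀ m₁ m₂ : ℤ) {δ : ℝ} {y : ℂ}
    (hδ1 : δ ≤ 1) (hδ0 : 0 < δ) (hy : ‖y‖ = 1) (ha0 : a ≠ 0) (hb0 : b ≠ 0) (hc0 : c ≠ 0) (he0 : e ≠ 0)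
    (ha : ‖a‖ < δ) (hb : ‖b‖ < δ) (hc : ‖c‖ < δ) (he : ‖e‖ < 1) :
    ContinuousAt (fun x : ℝ × ℂ => pinchReg p a b c e n₁ n₂ m₀ m₁ m₂ x.1 x.2) (δ, y) := by
  have hy0 : y ≠ 0 := norm_pos_iff.1 (by rw [hy]; exact one_pos)
  have hδ : (δ : ℂ) ≠ 0 := ofReal_ne_zero.2 hδ0.ne'
  have hn : ‖(δ : ℂ)‖ = δ := by rw [norm_real, Real.norm_of_nonneg hδ0.le]
  have hcd : ContinuousAt (fun x : ℝ × ℂ => (x.1 : ℂ)) (δ, y) :=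
    (Complex.continuous_ofReal.comp continuous_fst).continuousAt
  have hcy : ContinuousAt (fun x : ℝ × ℂ => x.2) (δ, y) := continuousAt_snd
  unfold pinchReg
  refine ((((ContinuousAt.mul ?_ ?_).mul ?_).mul ?_).mul ?_).mul ?_
  · refine ContinuousAt.comp (x := (δ, y)) (g := tetReg p) (f := fun x : ℝ × ℂ => (x.1 : ℂ) * x.2)
      (continuousAt_tetReg hp1 (mul_ne_zero hδ hy0) ?_) (hcd.mul hcy)
    rw [norm_mul, hy, mul_one, hn]
    exact hδ1
  · refine ContinuousAt.comp (x := (δ, y)) (g := tetReg p) (f := fun x : ℝ × ℂ => (x.1 : ℂ) / x.2)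
      (continuousAt_tetReg hp1 (div_ne_zero hδ hy0) ?_) (hcd.div hcy hy0)
    rw [norm_div, hy, div_one, hn]
    exact hδ1
  · refine ContinuousAt.comp (x := (δ, y)) (g := fun r => tetG p r (m₀ - m₁))
      (f := fun x : ℝ × ℂ => c / x.1 / x.2)
      (continuousAt_tetG hp1 (div_ne_zero (div_ne_zero hc0 hδ) hy0) ?_ _)
      ((continuousAt_const.div hcd hδ).div hcy hy0)
    rwa [norm_div, hy, div_one, norm_div, hn, div_lt_one hδ0]
  · refine ContinuousAt.comp (x := (δ, y)) (g := fun r => tetG p r (n₁ + m₁))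
      (f := fun x : ℝ × ℂ => a / x.1 * x.2)
      (continuousAt_tetG hp1 (mul_ne_zero (div_ne_zero ha0 hδ) hy0) ?_ _)
      ((continuousAt_const.div hcd hδ).mul hcy)
    rwa [norm_mul, hy, mul_one, norm_div, hn, div_lt_one hδ0]
  · refine ContinuousAt.comp (x := (δ, y)) (g := fun r => tetG p r (n₂ + m₁))
      (f := fun x : ℝ × ℂ => b / x.1 * x.2)
      (continuousAt_tetG hp1 (mul_ne_zero (div_ne_zero hb0 hδ) hy0) ?_ _)
      ((continuousAt_const.div hcd hδ).mul hcy)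
    rwa [norm_mul, hy, mul_one, norm_div, hn, div_lt_one hδ0]
  · refine ContinuousAt.comp (x := (δ, y)) (g := fun r => tetG p r (m₂ - m₁))
      (f := fun x : ℝ × ℂ => e * x.1 / x.2)
      (continuousAt_tetG hp1 (div_ne_zero (mul_ne_zero he0 hδ) hy0) ?_ _)
      ((continuousAt_const.mul hcd).div hcy hy0)
    rw [norm_div, hy, div_one, norm_mul, hn]
    exact mul_lt_one_of_nonneg_of_lt_one_left (norm_nonneg _) he hδ1

/-- At k = m₁ the gammas of δ y and δ / y both have index 0, hence poles that meet the circle as δ →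
1. Together with 1 - δ^4 their singular parts form the Poisson kernel. -/
theorem hyperTerm_pinch {p a b c e : ℂ} (hp1 : ‖p‖ < 1) (n₁ n₂ m₀ m₁ m₂ : ℤ) (δ : ℝ) {y : ℂ}
    (hy : ‖y‖ = 1) :
    (1 - (δ : ℂ) ^ 4) * hyperTerm p ![(δ : ℂ), a / δ, b / δ] ![c / δ, δ, e * δ] ![-m₁, n₁, n₂]
        ![m₀, m₁, m₂] m₁ y =
      (sqPoisson δ y : ℂ) * pinchReg p a b c e n₁ n₂ m₀ m₁ m₂ δ y := by
  rw [ofReal_sqPoisson hy]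
  simp only [hyperTerm, Fin.prod_univ_three, Matrix.cons_val, neg_add_cancel, sub_self]
  rw [tetG_zero_eq hp1, tetG_zero_eq hp1, pinchReg, mul_pow, div_pow]
  generalize 1 - (δ : ℂ) ^ 2 * y ^ 2 = u
  generalize 1 - (δ : ℂ) ^ 2 / y ^ 2 = v
  ring

/-- The common value of the rescaled sum/integral and product at the pinched contour. -/
noncomputable def pinchValue (p a b c e : ℂ) (n₁ n₂ m₀ m₁ m₂ : ℤ) : ℂ :=
  tetG p c (m₀ - m₁) * tetG p a (n₁ + m₁) * tetG p b (n₂ + m₁) * tetG p e (m₂ - m₁)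

theorem pinchReg_one {p a b c e : ℂ} (hp1 : ‖p‖ < 1) (n₁ n₂ m₀ m₁ m₂ : ℤ) :
    pinchReg p a b c e n₁ n₂ m₀ m₁ m₂ 1 1 = pinchValue p a b c e n₁ n₂ m₀ m₁ m₂ := by
  have h : tetReg p 1 = 1 := tetReg_of_sq_eq_one hp1 (by norm_num)
  simp [pinchReg, pinchValue, h]

/-- Passing to y = -1 produces only a sign, whose exponent has the parity of a sum of indices that
vanishes. -/
theorem pinchReg_neg_one {p a b c e : ℂ} (hp1 : ‖p‖ < 1) {n₁ n₂ m₀ m₁ m₂ : ℤ}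
    (hsum : n₁ + n₂ + m₀ + m₂ = 0) :
    pinchReg p a b c e n₁ n₂ m₀ m₁ m₂ 1 (-1) = pinchValue p a b c e n₁ n₂ m₀ m₁ m₂ := by
  have h : tetReg p (-1) = 1 := tetReg_of_sq_eq_one hp1 (by norm_num)
  have hs : ((-1 : ℂ)) ^ (m₀ - m₁).natAbs * (-1) ^ (n₁ + m₁).natAbs * (-1) ^ (n₂ + m₁).natAbs *
      (-1) ^ (m₂ - m₁).natAbs = 1 := by
    rw [← pow_add, ← pow_add, ← pow_add]
    refine Even.neg_one_pow ?_
    have : Even (m₀ - m₁ + (n₁ + m₁) + (n₂ + m₁) + (m₂ - m₁)) := ⟨0, by linarith⟩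
    simp only [Nat.even_add, Int.natAbs_even]
    simpa only [Int.even_add] using this
  simp only [pinchReg, pinchValue, ofReal_one, one_mul, mul_neg, mul_one, div_neg, div_one, tetG_neg, h]
  linear_combination (tetG p c (m₀ - m₁) * tetG p a (n₁ + m₁) * tetG p b (n₂ + m₁) *
    tetG p e (m₂ - m₁)) * hs

/-- Only the gamma of δ² with index 0 is singular, and 1 - δ^4 removes its pole. In the limit four
of the others cancel by reflection, in the pairs ac, be and ae, bc. -/
theorem tendsto_hyperProd_pinch {p a b c e : ℂ} {n₁ n₂ m₀ m₁ m₂ : ℤ} (hp0 : p ≠ 0) (hp1 : ‖p‖ < 1)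
    (ha : a ≠ 0 ∧ ‖a‖ < 1) (hb : b ≠ 0 ∧ ‖b‖ < 1) (hc : c ≠ 0 ∧ ‖c‖ < 1) (he : e ≠ 0 ∧ ‖e‖ < 1)
    (hprod : a * b * c * e = -p ^ 2) (hsum : n₁ + n₂ + m₀ + m₂ = 0) :
    Filter.Tendsto (fun δ : ℝ => (1 - (δ : ℂ) ^ 4) * hyperProd p ![(δ : ℂ), a / δ, b / δ]
        ![c / δ, δ, e * δ] ![-m₁, n₁, n₂] ![m₀, m₁, m₂])
      (nhdsWithin (1 : ℝ) (Set.Iio 1)) (nhds (pinchValue p a b c e n₁ n₂ m₀ m₁ m₂)) := by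
  have hpn : ‖p‖ ^ 2 = ‖a‖ * ‖b‖ * ‖c‖ * ‖e‖ := by
    rw [← norm_pow, ← norm_neg, ← hprod]
    simp only [norm_mul]
  have refl : ∀ {u v : ℂ} (k l : ℤ), u ≠ 0 → ‖u‖ < 1 → ‖v‖ < 1 → u * v = -p ^ 2 → l = -k →
      tetG p u k * tetG p v l = 1 := fun {u v} k l hu hu1 hv huv hl => by
    have hv' : v = -p ^ 2 / u := by rw [← huv, mul_div_cancel_left₀ _ hu]
    rw [hl, hv']
    refine tetG_mul_reflect hp0 hp1 ?_ hu1 k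
    rw [← norm_pow, ← norm_neg, ← huv, norm_mul]
    exact mul_lt_of_lt_one_right (norm_pos_iff.2 hu) hv
  have r1 := refl (u := a * c) (v := b * e) (n₁ + m₀) (n₂ + m₂) (mul_ne_zero ha.1 hc.1)
    (norm_mul_lt_one ha.2 hc.2) (norm_mul_lt_one hb.2 he.2) (by rw [← hprod]; ring) (by linarith)
  have r2 := refl (u := a * e) (v := b * c) (n₁ + m₂) (n₂ + m₀) (mul_ne_zero ha.1 he.1)
    (norm_mul_lt_one ha.2 he.2) (norm_mul_lt_one hb.2 hc.2) (by rw [← hprod]; ring) (by linarith)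
  let Q : ℝ → ℂ := fun δ => tetG p c (m₀ - m₁) * tetReg p (δ * δ) * tetG p (δ * (e * δ)) (m₂ - m₁) *
    (tetG p (a / δ * (c / δ)) (n₁ + m₀) * tetG p a (n₁ + m₁) * tetG p (a * e) (n₁ + m₂)) *
    (tetG p (b / δ * (c / δ)) (n₂ + m₀) * tetG p b (n₂ + m₁) * tetG p (b * e) (n₂ + m₂))
  have hQ1 : Q 1 = pinchValue p a b c e n₁ n₂ m₀ m₁ m₂ := by
    have h : tetReg p 1 = 1 := tetReg_of_sq_eq_one hp1 (by norm_num)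
    simp only [Q, pinchValue, ofReal_one, one_mul, mul_one, div_one, h]
    linear_combination (tetG p c (m₀ - m₁) * tetG p e (m₂ - m₁) * tetG p a (n₁ + m₁) *
      tetG p b (n₂ + m₁)) * (tetG p (a * e) (n₁ + m₂) * tetG p (b * c) (n₂ + m₀) * r1 + r2)
  have hQc : ContinuousAt Q 1 := by
    have hcd : ContinuousAt (fun δ : ℝ => (δ : ℂ)) 1 := Complex.continuous_ofReal.continuousAt
    have h10 : ((1 : ℝ) : ℂ) ≠ 0 := by simp
    have hG : ∀ (g : ℝ → ℂ) (k : ℤ), ContinuousAt g 1 → g 1 ≠ 0 → ‖g 1‖ < 1 →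
        ContinuousAt (fun δ => tetG p (g δ) k) 1 := fun g k h1 h2 h3 =>
      ContinuousAt.comp (g := fun r => tetG p r k) (continuousAt_tetG hp1 h2 h3 k) h1
    have hV : ContinuousAt (fun δ : ℝ => tetReg p (δ * δ)) 1 :=
      ContinuousAt.comp (g := tetReg p) (f := fun δ : ℝ => (δ : ℂ) * δ)
        (continuousAt_tetReg hp1 (by simp) (by simp)) (hcd.mul hcd)
    refine (((continuousAt_const.mul hV).mul (hG _ _ (hcd.mul (continuousAt_const.mul hcd)) ?_ ?_)).mul
      (((hG _ _ ((continuousAt_const.div hcd h10).mul (continuousAt_const.div hcd h10)) ?_ ?_).mul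
        continuousAt_const).mul continuousAt_const)).mul
      (((hG _ _ ((continuousAt_const.div hcd h10).mul (continuousAt_const.div hcd h10)) ?_ ?_).mul
        continuousAt_const).mul continuousAt_const)
    · simpa using he.1
    · simpa using he.2
    · simpa using ⟨ha.1, hc.1⟩
    · simpa using norm_mul_lt_one ha.2 hc.2
    · simpa using ⟨hb.1, hc.1⟩
    · simpa using norm_mul_lt_one hb.2 hc.2
  rw [← hQ1]
  refine (hQc.tendsto.mono_left nhdsWithin_le_nhds).congr' ?_
  filter_upwards [self_mem_nhdsWithin, nhdsWithin_le_nhds (eventually_gt_nhds (one_pos (α := ℝ)))]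
    with δ hlt h0
  have hδ : (δ : ℂ) ≠ 0 := ofReal_ne_zero.2 h0.ne'
  have h1 : 1 - ((δ : ℂ) * δ) ^ 2 ≠ 0 := by
    have := one_sub_mul_sq_ne_zero h0.le hlt (y := (δ : ℂ))
      (by rw [norm_real, Real.norm_of_nonneg h0.le]; exact le_of_lt hlt)
    rwa [← mul_pow] at this
  simp only [hyperProd, Fin.prod_univ_three, Matrix.cons_val, neg_add_cancel, neg_add_eq_sub]
  rw [tetG_zero_eq hp1, mul_div_cancel₀ c hδ, div_mul_cancel₀ a hδ, div_mul_cancel₀ b hδ,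
    show a / δ * (e * δ) = a * e by field_simp, show b / δ * (e * δ) = b * e by field_simp]
  simp only [Q]
  have h2 : (1 - (δ : ℂ) ^ 4) = 1 - ((δ : ℂ) * δ) ^ 2 := by ring
  rw [h2]
  generalize 1 - ((δ : ℂ) * δ) ^ 2 = u at h1
  field_simp

/-- For k ≠ m₁ the two dangerous gammas have nonzero index, and the resulting power of p keeps their
poles away from the circle uniformly in δ. -/
theorem exists_pinch_remainder_le {p a b c e : ℂ} {n₁ n₂ m₀ m₁ m₂ : ℤ} (hp0 : p ≠ 0) (hp1 : ‖p‖ < 1)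
    (ha : a ≠ 0 ∧ ‖a‖ < 1) (hb : b ≠ 0 ∧ ‖b‖ < 1) (hc : c ≠ 0 ∧ ‖c‖ < 1) (he : e ≠ 0 ∧ ‖e‖ < 1)
    (hprod : a * b * c * e = -p ^ 2) :
    ∃ B : ℝ, ∀ᶠ δ : ℝ in nhdsWithin (1 : ℝ) (Set.Iio 1),
      ‖hyperSum p ![(δ : ℂ), a / δ, b / δ] ![c / δ, δ, e * δ] ![-m₁, n₁, n₂] ![m₀, m₁, m₂] -
        Real.circleAverage (hyperTerm p ![(δ : ℂ), a / δ, b / δ] ![c / δ, δ, e * δ] ![-m₁, n₁, n₂]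
          ![m₀, m₁, m₂] m₁) 0 1‖ ≤ B := by
  have hp : 0 < ‖p‖ := norm_pos_iff.2 hp0
  obtain ⟨l, hl0, R, hR1, hlR⟩ := exists_between_all (ι := Fin 5)
    (f := ![‖a‖, ‖b‖, ‖c‖, ‖e‖, ‖p‖]) (by
      simp only [Fin.forall_fin_succ, Fin.forall_fin_zero, Matrix.cons_val_zero, Matrix.cons_val_succ,
        norm_pos_iff, and_true]
      exact ⟨ha, hb, hc, he, hp0, hp1⟩)
  have la := hlR 0
  have lb := hlR 1
  have lc := hlR 2
  have lE := hlR 3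
  have lp := hlR 4
  simp only [Matrix.cons_val] at la lb lc lE lp
  have hR0 : 0 < R := hp.trans lp.2
  obtain ⟨C, hC0, hC⟩ := exists_norm_hyperTerm_le_of_index hp0 hp1 (r₀ := l / 2) (R := R) (by positivity)
    hR1 ![-m₁, n₁, n₂] ![m₀, m₁, m₂]
  refine ⟨∑' k : ℤ, C * (‖p‖ ^ 4) ^ k.natAbs, ?_⟩
  have ev : ∀ x : ℝ, x < R → ∀ᶠ δ in nhdsWithin (1 : ℝ) (Set.Iio 1), x / R < δ := fun x hx =>
    nhdsWithin_le_nhds (eventually_gt_nhds ((div_lt_one hR0).2 hx))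
  filter_upwards [ev _ la.2, ev _ lb.2, ev _ lc.2, self_mem_nhdsWithin,
    nhdsWithin_le_nhds (eventually_gt_nhds (show (1 / 2 : ℝ) < 1 by norm_num))] with δ ea eb ec hlt hhalf
  replace hlt : δ < 1 := hlt
  have h0 : 0 < δ := by linarith
  have hδ : (δ : ℂ) ≠ 0 := ofReal_ne_zero.2 h0.ne'
  have hn : ‖(δ : ℂ)‖ = δ := by rw [norm_real, Real.norm_of_nonneg h0.le]
  have ub : ∀ x : ℂ, ‖x‖ / R < δ → ‖x / δ‖ ≤ R := fun x hx => by
    rw [norm_div, hn, div_le_iff₀ h0]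
    rw [div_lt_iff₀ hR0] at hx
    linarith
  have lowb : ∀ x : ℂ, l < ‖x‖ → l / 2 ≤ ‖x / δ‖ := fun x hx => by
    rw [norm_div, hn, le_div_iff₀ h0]
    nlinarith
  have small : ∀ x : ℂ, ‖x‖ ≤ R → ∀ N : ℕ, ‖p ^ N * x ^ 2‖ ≤ R := fun x hx N => by
    refine (norm_pow_mul_sq_le hp1 hx N).trans ?_
    nlinarith
  have eb1 : ‖e * δ‖ ≤ R := by
    rw [norm_mul, hn]
    nlinarith [norm_nonneg e]
  have eb2 : l / 2 ≤ ‖e * δ‖ := by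
    rw [norm_mul, hn]
    nlinarith [norm_nonneg e]
  have hl1 : l / 2 ≤ δ := by linarith [lp.1]
  have pole : ∀ N : ℕ, N ≠ 0 → ‖p ^ (2 * N) * (δ : ℂ) ^ 2‖ ≤ R := fun N hN => by
    rw [norm_mul, norm_pow, norm_pow, hn]
    calc ‖p‖ ^ (2 * N) * δ ^ 2 ≤ ‖p‖ ^ 1 * 1 :=
          mul_le_mul (pow_le_pow_of_le_one hp.le hp1.le (by omega)) (pow_le_one₀ h0.le hlt.le)
            (by positivity) (by positivity)
      _ ≤ R := by
        rw [pow_one, mul_one]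
        exact lp.2.le
  have hP : ∏ i, ![(δ : ℂ), a / δ, b / δ] i * ![c / δ, δ, e * δ] i = -p ^ 2 := by
    simp only [Fin.prod_univ_three, Matrix.cons_val]
    rw [← hprod]
    field_simp
  have hr : ∀ i, ![(δ : ℂ), a / δ, b / δ] i ≠ 0 ∧ ‖![(δ : ℂ), a / δ, b / δ] i‖ < 1 := by
    rw [forall_vec_three (P := fun x => x ≠ 0 ∧ ‖x‖ < 1)]
    exact ⟨⟨hδ, hn.trans_lt hlt⟩, ⟨div_ne_zero ha.1 hδ, (ub a ea).trans_lt hR1⟩,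
      div_ne_zero hb.1 hδ, (ub b eb).trans_lt hR1⟩
  have hρ : ∀ i, ![c / δ, (δ : ℂ), e * δ] i ≠ 0 ∧ ‖![c / δ, (δ : ℂ), e * δ] i‖ < 1 := by
    rw [forall_vec_three (P := fun x => x ≠ 0 ∧ ‖x‖ < 1)]
    exact ⟨⟨div_ne_zero hc.1 hδ, (ub c ec).trans_lt hR1⟩, ⟨hδ, hn.trans_lt hlt⟩,
      mul_ne_zero he.1 hδ, eb1.trans_lt hR1⟩
  have hsum := summable_hyperTerm hp0 hp1 ![-m₁, n₁, n₂] ![m₀, m₁, m₂] hr hρ (by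
    rw [hP, norm_neg, norm_pow]
    exact pow_lt_pow_right_of_lt_one₀ hp hp1 (by norm_num))
  rw [hyperSum, hsum.tsum_eq_add_tsum_ite m₁, add_sub_cancel_left]
  refine tsum_of_norm_bounded ((summable_pow_natAbs_int (by positivity)
    (pow_lt_one₀ hp.le hp1 (by norm_num))).mul_left C).hasSum fun k => ?_
  split_ifs with hk
  · rw [norm_zero]
    positivity
  · refine norm_circleAverage_le fun y hy => ?_
    have h := hC ![(δ : ℂ), a / δ, b / δ] ![c / δ, δ, e * δ] k ?_ ?_ y hy
    · rwa [hP, norm_neg, norm_pow, show ‖p‖ ^ 6 / ‖p‖ ^ 2 = ‖p‖ ^ 4 by field_simp] at h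
    · intro i
      fin_cases i
      · exact ⟨hl1.trans_eq hn.symm, hn.trans_le hlt.le, pole _ (by simp; omega)⟩
      · exact ⟨lowb a la.1, (ub a ea).trans hR1.le, small _ (ub a ea) _⟩
      · exact ⟨lowb b lb.1, (ub b eb).trans hR1.le, small _ (ub b eb) _⟩
    · intro i
      fin_cases i
      · exact ⟨lowb c lc.1, (ub c ec).trans hR1.le, small _ (ub c ec) _⟩
      · exact ⟨hl1.trans_eq hn.symm, hn.trans_le hlt.le, pole _ (by simp; omega)⟩
      · exact ⟨eb2, eb1.trans hR1.le, small _ eb1 _⟩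

/-- The summand k = m₁ is a Poisson integral; the others stay bounded and disappear after
multiplication by 1 - δ^4. -/
theorem tendsto_hyperSum_pinch {p a b c e : ℂ} {n₁ n₂ m₀ m₁ m₂ : ℤ} (hp0 : p ≠ 0) (hp1 : ‖p‖ < 1)
    (ha : a ≠ 0 ∧ ‖a‖ < 1) (hb : b ≠ 0 ∧ ‖b‖ < 1) (hc : c ≠ 0 ∧ ‖c‖ < 1) (he : e ≠ 0 ∧ ‖e‖ < 1)
    (hprod : a * b * c * e = -p ^ 2) (hsum : n₁ + n₂ + m₀ + m₂ = 0) :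
    Filter.Tendsto (fun δ : ℝ => (1 - (δ : ℂ) ^ 4) * hyperSum p ![(δ : ℂ), a / δ, b / δ]
        ![c / δ, δ, e * δ] ![-m₁, n₁, n₂] ![m₀, m₁, m₂])
      (nhdsWithin (1 : ℝ) (Set.Iio 1)) (nhds (pinchValue p a b c e n₁ n₂ m₀ m₁ m₂)) := by
  obtain ⟨B, hB⟩ := exists_pinch_remainder_le (n₁ := n₁) (n₂ := n₂) (m₀ := m₀) (m₁ := m₁) (m₂ := m₂)
    hp0 hp1 ha hb hc he hprod
  have hzero : Filter.Tendsto (fun δ : ℝ => 1 - (δ : ℂ) ^ 4) (nhdsWithin (1 : ℝ) (Set.Iio 1)) (nhds 0) := by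
    have : ContinuousAt (fun δ : ℝ => 1 - (δ : ℂ) ^ 4) 1 := by fun_prop
    have h := this.tendsto.mono_left (nhdsWithin_le_nhds (s := Set.Iio 1))
    simpa using h
  have hrest : Filter.Tendsto (fun δ : ℝ => (1 - (δ : ℂ) ^ 4) *
      (hyperSum p ![(δ : ℂ), a / δ, b / δ] ![c / δ, δ, e * δ] ![-m₁, n₁, n₂] ![m₀, m₁, m₂] -
        Real.circleAverage (hyperTerm p ![(δ : ℂ), a / δ, b / δ] ![c / δ, δ, e * δ] ![-m₁, n₁, n₂]
          ![m₀, m₁, m₂] m₁) 0 1)) (nhdsWithin (1 : ℝ) (Set.Iio 1)) (nhds 0) := by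
    refine squeeze_zero_norm' (a := fun δ : ℝ => ‖1 - (δ : ℂ) ^ 4‖ * B) ?_ ?_
    · filter_upwards [hB] with δ hδ
      rw [norm_mul]
      gcongr
    · simpa using hzero.norm.mul_const B
  have hcond : ∀ᶠ δ : ℝ in nhdsWithin (1 : ℝ) (Set.Iio 1), 0 < δ ∧ δ < 1 ∧ ‖a‖ < δ ∧ ‖b‖ < δ ∧ ‖c‖ < δ := by
    filter_upwards [self_mem_nhdsWithin, nhdsWithin_le_nhds (eventually_gt_nhds (one_pos (α := ℝ))),
      nhdsWithin_le_nhds (eventually_gt_nhds ha.2), nhdsWithin_le_nhds (eventually_gt_nhds hb.2),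
      nhdsWithin_le_nhds (eventually_gt_nhds hc.2)] with δ h1 h2 h3 h4 h5
    exact ⟨h2, h1, h3, h4, h5⟩
  have hpois := tendsto_circleAverage_sqPoisson (H := pinchReg p a b c e n₁ n₂ m₀ m₁ m₂)
    (fun y hy => continuousAt_pinchReg hp1 n₁ n₂ m₀ m₁ m₂ le_rfl one_pos hy ha.1 hb.1 hc.1 he.1
      ha.2 hb.2 hc.2 he.2)
    (pinchReg_one hp1 n₁ n₂ m₀ m₁ m₂) (pinchReg_neg_one hp1 hsum) (by
      filter_upwards [hcond] with δ hδ y hy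
      have h := continuousAt_pinchReg hp1 n₁ n₂ m₀ m₁ m₂ hδ.2.1.le hδ.1 (y := y) (by simpa using hy)
        ha.1 hb.1 hc.1 he.1 hδ.2.2.1 hδ.2.2.2.1 hδ.2.2.2.2 he.2
      exact (ContinuousAt.comp (f := fun y : ℂ => (δ, y)) h (by fun_prop)).continuousWithinAt)
  have hadd := hpois.add hrest
  rw [add_zero] at hadd
  refine hadd.congr fun δ => ?_
  have e1 : Real.circleAverage (fun y => (sqPoisson δ y : ℂ) * pinchReg p a b c e n₁ n₂ m₀ m₁ m₂ δ y) 0 1 =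
      (1 - (δ : ℂ) ^ 4) * Real.circleAverage (hyperTerm p ![(δ : ℂ), a / δ, b / δ] ![c / δ, δ, e * δ]
        ![-m₁, n₁, n₂] ![m₀, m₁, m₂] m₁) 0 1 := by
    rw [← smul_eq_mul, ← Real.circleAverage_smul]
    refine Real.circleAverage_congr_sphere fun y hy => ?_
    exact (hyperTerm_pinch hp1 n₁ n₂ m₀ m₁ m₂ δ (by simpa using hy)).symm
  rw [e1]
  ring

theorem eq_one_of_hyperRatio_pinch {p a b c e F : ℂ} {n₁ n₂ m₀ m₁ m₂ : ℤ} (hp0 : p ≠ 0)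
    (hp1 : ‖p‖ < 1) (ha : a ≠ 0 ∧ ‖a‖ < 1) (hb : b ≠ 0 ∧ ‖b‖ < 1) (hc : c ≠ 0 ∧ ‖c‖ < 1)
    (he : e ≠ 0 ∧ ‖e‖ < 1) (hprod : a * b * c * e = -p ^ 2) (hsum : n₁ + n₂ + m₀ + m₂ = 0)
    (hF : ∀ᶠ δ : ℝ in nhdsWithin (1 : ℝ) (Set.Iio 1), hyperSum p ![(δ : ℂ), a / δ, b / δ]
        ![c / δ, δ, e * δ] ![-m₁, n₁, n₂] ![m₀, m₁, m₂] =
      F * hyperProd p ![(δ : ℂ), a / δ, b / δ] ![c / δ, δ, e * δ] ![-m₁, n₁, n₂] ![m₀, m₁, m₂]) :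
    F = 1 := by
  have h1 := tendsto_hyperSum_pinch (m₁ := m₁) hp0 hp1 ha hb hc he hprod hsum
  have h2 := (tendsto_hyperProd_pinch (m₁ := m₁) hp0 hp1 ha hb hc he hprod hsum).const_mul F
  have h3 := tendsto_nhds_unique h1 (h2.congr' (by
    filter_upwards [hF] with δ hδ
    rw [hδ]
    ring))
  have hpn : ‖p‖ ^ 2 = ‖a‖ * ‖b‖ * ‖c‖ * ‖e‖ := by
    rw [← norm_pow, ← norm_neg, ← hprod]
    simp only [norm_mul]
  have key : ∀ x y z w : ℂ, x ≠ 0 → ‖x‖ < 1 → ‖y‖ < 1 → ‖z‖ < 1 → ‖w‖ < 1 →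
      ‖p‖ ^ 2 = ‖x‖ * ‖y * (z * w)‖ → ∀ k, tetG p x k ≠ 0 := fun x y z w hx hx1 hy hz hw h k => by
    refine tetG_ne_zero hp0 hp1 ?_ hx1 k
    rw [h]
    exact mul_lt_of_lt_one_right (norm_pos_iff.2 hx) (norm_mul_lt_one hy (norm_mul_lt_one hz hw))
  have hL : pinchValue p a b c e n₁ n₂ m₀ m₁ m₂ ≠ 0 := by
    refine mul_ne_zero (mul_ne_zero (mul_ne_zero (key c a b e hc.1 hc.2 ha.2 hb.2 he.2 ?_ _)
      (key a b c e ha.1 ha.2 hb.2 hc.2 he.2 ?_ _)) (key b a c e hb.1 hb.2 ha.2 hc.2 he.2 ?_ _))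
      (key e a b c he.1 he.2 ha.2 hb.2 hc.2 ?_ _) <;>
    · rw [hpn]
      simp only [norm_mul]
      ring
  exact (mul_right_cancel₀ hL ((one_mul _).trans h3)).symm

/-! ### The evaluation of the sum/integral -/

theorem vec_three_eta {X : Type*} (f : Fin 3 → X) : ![f 0, f 1, f 2] = f := by
  ext i
  fin_cases i <;> rfl

theorem hyperRatio_eq_one_of_small {p : ℂ} {r ρ : Fin 3 → ℂ} {n m : Fin 3 → ℤ} (hp0 : p ≠ 0)
    (hp1 : ‖p‖ < 1) (hr : ∀ i, r i ≠ 0 ∧ ‖r i‖ < 1) (hρ : ∀ i, ρ i ≠ 0 ∧ ‖ρ i‖ < 1)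
    (hprod : ∏ i, r i * ρ i = -p ^ 2) (hsum : ∑ i, (n i + m i) = 0)
    (hsmall : ‖r 0 * ρ 0‖ < ‖p‖) (h0 : ‖ρ 0‖ < ‖ρ 1‖) (h2 : ‖ρ 2‖ < ‖ρ 1‖) :
    hyperRatio p r ρ n m = 1 := by
  have h1 : 0 < ‖ρ 1‖ := norm_pos_iff.2 (hρ 1).1
  have hρ1 := (hρ 1).1
  simp only [Fin.prod_univ_three] at hprod
  simp only [Fin.sum_univ_three] at hsum
  -- Rescaling by ρ₁/δ turns ρ₁ into δ. Then r₀ is moved to δ with index -m₁, at fixed r₀ρ₀ and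
  -- fixed sum of indices. The values of a, b, c, e and m₀ record the result.
  refine eq_one_of_hyperRatio_pinch (a := ρ 1 * r 1) (b := ρ 1 * r 2) (c := r 0 * ρ 0)
    (e := ρ 2 / ρ 1) (n₁ := n 1) (n₂ := n 2) (m₀ := n 0 + m 0 + m 1) (m₁ := m 1) (m₂ := m 2)
    hp0 hp1 ⟨mul_ne_zero hρ1 (hr 1).1, norm_mul_lt_one (hρ 1).2 (hr 1).2⟩
    ⟨mul_ne_zero hρ1 (hr 2).1, norm_mul_lt_one (hρ 1).2 (hr 2).2⟩
    ⟨mul_ne_zero (hr 0).1 (hρ 0).1, norm_mul_lt_one (hr 0).2 (hρ 0).2⟩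
    ⟨div_ne_zero (hρ 2).1 hρ1, by rwa [norm_div, div_lt_one h1]⟩ ?_ (by linarith) ?_
  · rw [← hprod]
    field_simp
  filter_upwards [self_mem_nhdsWithin, nhdsWithin_le_nhds (eventually_gt_nhds (hρ 1).2),
    nhdsWithin_le_nhds (eventually_gt_nhds (norm_mul_lt_one (hr 0).2 (hρ 0).2))] with δ hlt hδ1 hδc
  replace hlt : δ < 1 := hlt
  have hδ0 : 0 < δ := h1.trans hδ1
  have hδ : (δ : ℂ) ≠ 0 := ofReal_ne_zero.2 hδ0.ne'
  have hn : ‖(δ : ℂ)‖ = δ := by rw [norm_real, Real.norm_of_nonneg hδ0.le]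
  have hc0 : ρ 1 / δ ≠ 0 := div_ne_zero hρ1 hδ
  have hc1 : ‖ρ 1 / δ‖ < 1 := by rwa [norm_div, hn, div_lt_one hδ0]
  have hdiv : ∀ x : ℂ, ‖x‖ ≤ ‖ρ 1‖ → ‖x / (ρ 1 / δ)‖ < 1 := fun x hx => by
    rw [norm_div, norm_div, hn, div_div_eq_mul_div, div_lt_one h1]
    exact (mul_le_mul_of_nonneg_right hx hδ0.le).trans_lt (mul_lt_of_lt_one_right h1 hlt)
  have hr' : ∀ i, ‖ρ 1 / δ * r i‖ < 1 := fun i => norm_mul_lt_one hc1 (hr i).2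
  have hρ' : ∀ i, ‖ρ i / (ρ 1 / δ)‖ < 1 := fun i => by
    fin_cases i
    · exact hdiv _ h0.le
    · exact hdiv _ le_rfl
    · exact hdiv _ h2.le
  have hscale := hyperRatio_mul hp1 hc0 n m hr hρ hr' hρ'
  have er : (fun i => ρ 1 / δ * r i) = ![ρ 1 / δ * r 0, ρ 1 * r 1 / δ, ρ 1 * r 2 / δ] := by
    rw [← vec_three_eta fun i => ρ 1 / δ * r i]
    simp only [div_mul_eq_mul_div]
  have eρ : (fun i => ρ i / (ρ 1 / δ)) = ![ρ 0 / (ρ 1 / δ), (δ : ℂ), ρ 2 / ρ 1 * δ] := by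
    rw [← vec_three_eta fun i => ρ i / (ρ 1 / δ)]
    congr 2
    · field_simp
    · congr 1
      field_simp
  have gr : ∀ i, (fun i => ρ 1 / δ * r i) i ≠ 0 ∧ ‖(fun i => ρ 1 / δ * r i) i‖ < 1 :=
    fun i => ⟨mul_ne_zero hc0 (hr i).1, hr' i⟩
  have gρ : ∀ i, (fun i => ρ i / (ρ 1 / δ)) i ≠ 0 ∧ ‖(fun i => ρ i / (ρ 1 / δ)) i‖ < 1 :=
    fun i => ⟨div_ne_zero (hρ i).1 hc0, hρ' i⟩
  rw [er] at gr
  rw [eρ] at gρ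
  have hcancel : ρ 1 / δ * r 0 * (ρ 0 / (ρ 1 / δ)) = r 0 * ρ 0 := by field_simp
  have hδcc : ‖r 0 * ρ 0 / δ‖ < 1 := by rwa [norm_div, hn, div_lt_one hδ0]
  have hpr : ρ 1 / δ * r 0 * (ρ 0 / (ρ 1 / δ)) * (ρ 1 * r 1 / δ * δ) *
      (ρ 1 * r 2 / δ * (ρ 2 / ρ 1 * δ)) = -p ^ 2 := by
    rw [hcancel, ← hprod]
    field_simp
  have hmove := hyperRatio_eq_of_mul_eq (n₀ := n 0) (n₁ := n 1) (n₂ := n 2) (m₀ := m 0) (m₁ := m 1)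
    (m₂ := m 2) (r₀' := (δ : ℂ)) (ρ₀' := r 0 * ρ 0 / δ) (n₀' := -m 1) (m₀' := n 0 + m 0 + m 1) hp0 hp1
    gr gρ hpr (by linarith)
    (by rwa [hcancel]) (by rwa [hn]) hδcc (by rw [hcancel, mul_div_cancel₀ _ hδ]) (by ring)
  rw [er, eρ] at hscale
  rw [vec_three_eta n, vec_three_eta m, hscale] at hmove
  rw [← hmove, hyperRatio, div_mul_cancel₀]
  refine hyperProd_ne_zero hp0 hp1 _ _ ?_ ?_ ?_
  · rw [forall_vec_three (P := fun x => x ≠ 0 ∧ ‖x‖ < 1)] at gr ⊢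
    exact ⟨⟨hδ, by rwa [hn]⟩, gr.2⟩
  · rw [forall_vec_three (P := fun x => x ≠ 0 ∧ ‖x‖ < 1)] at gρ ⊢
    exact ⟨⟨div_ne_zero (mul_ne_zero (hr 0).1 (hρ 0).1) hδ, hδcc⟩, gρ.2⟩
  · simp only [Fin.prod_univ_three, Matrix.cons_val]
    rw [← hprod]
    field_simp

theorem norm_mul_exp_mul_ofReal (a τ : ℂ) (x : ℝ) :
    ‖a * exp (τ * x)‖ = ‖a‖ * Real.exp (τ.re * x) := by
  rw [norm_mul, norm_exp, re_mul_ofReal]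

theorem isLinearMap_re_mul (x : ℝ) : IsLinearMap ℝ fun τ : ℂ => τ.re * x :=
  ⟨fun a b => by simp [add_mul], fun c a => by simp [mul_assoc]⟩

/-- The given parameters (τ = 0) are joined to parameters satisfying the size restrictions (τ = 1)
by an exponential path along the balanced locus. The admissible τ form a convex open set, on which
the identity theorem applies. -/
theorem hyperRatio_eq_one {p : ℂ} {r ρ : Fin 3 → ℂ} {n m : Fin 3 → ℤ} (hp0 : p ≠ 0)
    (hp1 : ‖p‖ < 1) (hr : ∀ i, r i ≠ 0 ∧ ‖r i‖ < 1) (hρ : ∀ i, ρ i ≠ 0 ∧ ‖ρ i‖ < 1)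
    (hprod : ∏ i, r i * ρ i = -p ^ 2) (hsum : ∑ i, (n i + m i) = 0) :
    hyperRatio p r ρ n m = 1 := by
  have hp : 0 < ‖p‖ := norm_pos_iff.2 hp0
  obtain ⟨t, ht0, ht6⟩ : ∃ t : ℝ, 0 < t ∧ t ^ 6 = ‖p‖ :=
    ⟨‖p‖ ^ (1 / 6 : ℝ), by positivity, by
      rw [← Real.rpow_natCast, ← Real.rpow_mul hp.le]
      norm_num⟩
  have ht1 : t < 1 := by
    by_contra h
    have := one_le_pow₀ (n := 6) (not_lt.1 h)
    linarith
  have htpow : ∀ {k l : ℕ}, k < l → t ^ l < t ^ k := fun h => pow_lt_pow_right_of_lt_one₀ ht0 ht1 h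
  have hrn : ∀ i, 0 < ‖r i‖ := fun i => norm_pos_iff.2 (hr i).1
  have hρn : ∀ i, 0 < ‖ρ i‖ := fun i => norm_pos_iff.2 (hρ i).1
  -- Target moduli are t for every rᵢ and t^6, t, t² for the ρᵢ. They multiply to t^12 = |p|², with
  -- t^7 < t^6 = |p| for r₀ρ₀ and ρ₁ the largest of the ρᵢ.
  let d : Fin 3 → ℕ := ![6, 1, 2]
  let x : Fin 3 → ℝ := fun i => Real.log (t / ‖r i‖)
  let w : Fin 3 → ℝ := fun i => Real.log (t ^ d i / ‖ρ i‖)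
  have hd : ∀ i, 0 < d i := by
    intro i
    fin_cases i <;> simp [d]
  have hx : ∀ i, ‖r i‖ * Real.exp (x i) = t := fun i => by
    have := hrn i
    rw [Real.exp_log (by positivity)]
    field_simp
  have hw : ∀ i, ‖ρ i‖ * Real.exp (w i) = t ^ d i := fun i => by
    have := hρn i
    rw [Real.exp_log (by positivity)]
    field_simp
  have hxw : (x 0 + w 0) + (x 1 + w 1) + (x 2 + w 2) = 0 := by
    rw [← Real.exp_eq_one_iff]
    simp only [Real.exp_add]
    have hP : ‖r 0‖ * ‖ρ 0‖ * (‖r 1‖ * ‖ρ 1‖) * (‖r 2‖ * ‖ρ 2‖) = ‖p‖ ^ 2 := by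
      have h := congrArg norm hprod
      rw [Fin.prod_univ_three, norm_neg, norm_pow] at h
      simpa only [norm_mul] using h
    have h12 : (‖r 0‖ * Real.exp (x 0)) * (‖ρ 0‖ * Real.exp (w 0)) *
        ((‖r 1‖ * Real.exp (x 1)) * (‖ρ 1‖ * Real.exp (w 1))) *
        ((‖r 2‖ * Real.exp (x 2)) * (‖ρ 2‖ * Real.exp (w 2))) = ‖p‖ ^ 2 := by
      simp only [hx, hw, d, Matrix.cons_val]
      rw [← ht6]
      ring
    have hne : ‖p‖ ^ 2 ≠ 0 := by positivity
    refine mul_left_cancel₀ hne ?_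
    rw [mul_one]
    conv_rhs => rw [← h12]
    rw [← hP]
    ring
  let rr : ℂ → Fin 3 → ℂ := fun τ i => r i * exp (τ * x i)
  let ρρ : ℂ → Fin 3 → ℂ := fun τ i => ρ i * exp (τ * w i)
  have hrr : ∀ τ i, rr τ i ≠ 0 := fun τ i => mul_ne_zero (hr i).1 (exp_ne_zero _)
  have hρρ : ∀ τ i, ρρ τ i ≠ 0 := fun τ i => mul_ne_zero (hρ i).1 (exp_ne_zero _)
  have hrd : ∀ i, Differentiable ℂ fun τ => rr τ i := fun i => by fun_prop
  have hρd : ∀ i, Differentiable ℂ fun τ => ρρ τ i := fun i => by fun_prop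
  have hpp : ∀ τ, ∏ i, rr τ i * ρρ τ i = -p ^ 2 := fun τ => by
    rw [← hprod, Fin.prod_univ_three, Fin.prod_univ_three]
    have hexp : exp (τ * x 0) * exp (τ * w 0) * (exp (τ * x 1) * exp (τ * w 1)) *
        (exp (τ * x 2) * exp (τ * w 2)) = 1 := by
      simp only [← exp_add]
      rw [exp_eq_one_iff]
      refine ⟨0, ?_⟩
      have : ((((x 0 + w 0) + (x 1 + w 1) + (x 2 + w 2) : ℝ)) : ℂ) = 0 := by rw [hxw, ofReal_zero]
      push_cast at this ⊢
      linear_combination τ * this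
    simp only [rr, ρρ]
    linear_combination (r 0 * ρ 0 * (r 1 * ρ 1) * (r 2 * ρ 2)) * hexp
  let V : Set ℂ := ⋂ i, ({τ : ℂ | τ.re * x i < -Real.log ‖r i‖} ∩ {τ : ℂ | τ.re * w i < -Real.log ‖ρ i‖})
  have hVmem : ∀ τ, τ ∈ V ↔ (∀ i, ‖rr τ i‖ < 1 ∧ ‖ρρ τ i‖ < 1) := fun τ => by
    have aux : ∀ (a : ℂ) (x : ℝ), 0 < ‖a‖ →
        (τ.re * x < -Real.log ‖a‖ ↔ ‖a * exp (τ * x)‖ < 1) := fun a x ha => by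
      rw [norm_mul_exp_mul_ofReal, ← Real.log_neg_iff (by positivity), Real.log_mul ha.ne'
        (Real.exp_ne_zero _), Real.log_exp]
      constructor <;> intro h <;> linarith
    simp only [V, Set.mem_iInter, Set.mem_inter_iff, Set.mem_ofPred_eq, aux _ _ (hrn _),
      aux _ _ (hρn _), rr, ρρ]
  have hVopen : IsOpen V := isOpen_iInter_of_finite fun i =>
    (isOpen_lt (by fun_prop) continuous_const).inter (isOpen_lt (by fun_prop) continuous_const)
  have hVconv : Convex ℝ V := convex_iInter fun i =>
    (convex_halfSpace_lt (isLinearMap_re_mul _) _).inter (convex_halfSpace_lt (isLinearMap_re_mul _) _)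
  have hV0 : (0 : ℂ) ∈ V := (hVmem 0).2 fun i => by simpa [rr, ρρ] using ⟨(hr i).2, (hρ i).2⟩
  have n1 : ∀ i, ‖rr 1 i‖ = t := fun i => by
    simp only [rr]
    rw [norm_mul_exp_mul_ofReal, one_re, one_mul, hx]
  have n2 : ∀ i, ‖ρρ 1 i‖ = t ^ d i := fun i => by
    simp only [ρρ]
    rw [norm_mul_exp_mul_ofReal, one_re, one_mul, hw]
  have hV1 : (1 : ℂ) ∈ V := (hVmem 1).2 fun i => by
    rw [n1, n2]
    exact ⟨ht1, pow_lt_one₀ ht0.le ht1 (hd i).ne'⟩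
  have hdiff : DifferentiableOn ℂ (fun τ => hyperRatio p (rr τ) (ρρ τ) n m - 1) V := fun τ hτ => by
    have hτ' := (hVmem τ).1 hτ
    exact ((differentiableAt_hyperRatio hp0 hp1 n m (.of_forall fun z i => (hrd i) z)
      (.of_forall fun z i => (hρd i) z) (fun i => ⟨hrr τ i, (hτ' i).1⟩) (fun i => ⟨hρρ τ i, (hτ' i).2⟩)
      (.of_forall hpp)).sub_const 1).differentiableWithinAt
  have hev : (fun τ => hyperRatio p (rr τ) (ρρ τ) n m - 1) =ᶠ[nhds 1] 0 := by
    have cr : ∀ i, Filter.Tendsto (fun τ => ‖rr τ i‖) (nhds 1) (nhds t) := fun i => by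
      rw [← n1 i]
      exact (hrd i).continuous.norm.continuousAt
    have cρ : ∀ i, Filter.Tendsto (fun τ => ‖ρρ τ i‖) (nhds 1) (nhds (t ^ d i)) := fun i => by
      rw [← n2 i]
      exact (hρd i).continuous.norm.continuousAt
    have l1 := ((cr 0).mul (cρ 0)).eventually_lt_const (u := ‖p‖) (by
      rw [← ht6, ← pow_succ']
      exact htpow (by simp [d]))
    have l2 := (cρ 0).eventually_lt (cρ 1) (htpow (by simp [d]))
    have l3 := (cρ 2).eventually_lt (cρ 1) (htpow (by simp [d]))
    filter_upwards [hVopen.mem_nhds hV1, l1, l2, l3] with τ hτ h1 h2 h3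
    have hτ' := (hVmem τ).1 hτ
    have := hyperRatio_eq_one_of_small (n := n) (m := m) hp0 hp1 (fun i => ⟨hrr τ i, (hτ' i).1⟩)
      (fun i => ⟨hρρ τ i, (hτ' i).2⟩) (hpp τ) hsum (by rwa [norm_mul]) h2 h3
    rw [this, sub_self, Pi.zero_apply]
  have h0 := (hdiff.analyticOnNhd hVopen).eqOn_zero_of_preconnected_of_eventuallyEq_zero
    hVconv.isPreconnected hV1 hev hV0
  have e1 : rr 0 = r := by ext i; simp [rr]
  have e2 : ρρ 0 = ρ := by ext i; simp [ρρ]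
  simp only [e1, e2, Pi.zero_apply] at h0
  exact sub_eq_zero.1 h0

/-- The star-triangle relation. -/
theorem hyperSum_eq_hyperProd {p : ℂ} {r ρ : Fin 3 → ℂ} {n m : Fin 3 → ℤ} (hp0 : p ≠ 0)
    (hp1 : ‖p‖ < 1) (hr : ∀ i, r i ≠ 0 ∧ ‖r i‖ < 1) (hρ : ∀ i, ρ i ≠ 0 ∧ ‖ρ i‖ < 1)
    (hprod : ∏ i, r i * ρ i = -p ^ 2) (hsum : ∑ i, (n i + m i) = 0) :
    hyperSum p r ρ n m = hyperProd p r ρ n m :=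
  (div_eq_one_iff_eq (hyperProd_ne_zero hp0 hp1 n m hr hρ hprod)).1
    (hyperRatio_eq_one hp0 hp1 hr hρ hprod hsum)

/-! ### The kernels in terms of `tetG` -/

theorem csqrt_sq (z : ℂ) : csqrt z ^ 2 = z := by
  rw [csqrt, one_div]
  exact cpow_nat_inv_pow z two_ne_zero

theorem csqrt_ne_zero {z : ℂ} (hz : z ≠ 0) : csqrt z ≠ 0 := by
  intro h
  rw [← csqrt_sq z, h] at hz
  simp at hz

theorem norm_csqrt_sq (z : ℂ) : ‖csqrt z‖ ^ 2 = ‖z‖ := by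
  rw [← norm_pow, csqrt_sq]

theorem norm_csqrt_lt {z : ℂ} {a : ℝ} (ha : 0 ≤ a) (hz : ‖z‖ < a ^ 2) : ‖csqrt z‖ < a :=
  lt_of_pow_lt_pow_left₀ 2 ha (by rwa [norm_csqrt_sq])

theorem norm_csqrt_eq_one {z : ℂ} (hz : ‖z‖ = 1) : ‖csqrt z‖ = 1 := by
  have := norm_csqrt_sq z
  rw [hz] at this
  exact (pow_eq_one_iff_of_nonneg (norm_nonneg _) two_ne_zero).1 this

theorem measurable_csqrt : Measurable csqrt := measurable_id.pow_const _

theorem baileyKernel_eq_tetG {p t w z : ℂ} (hp0 : p ≠ 0) (ht : t ≠ 0) (hw : w ≠ 0) (hz : z ≠ 0)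
    (nt m n : ℤ) :
    baileyKernel (p ^ 2) t nt m w n z =
      tetG p (csqrt t * csqrt w * (csqrt z)⁻¹) (m - n + nt) *
        tetG p (csqrt t * (csqrt w)⁻¹ * csqrt z) (-m + n + nt) / tetG p t (2 * nt) := by
  have h1 := csqrt_ne_zero ht
  have h2 := csqrt_ne_zero hw
  have h3 := csqrt_ne_zero hz
  rw [baileyKernel, pentB_eq_tetG hp0 (by simp [*]) (by simp [*])]
  have e : csqrt t * csqrt w * (csqrt z)⁻¹ * (csqrt t * (csqrt w)⁻¹ * csqrt z) = t := by
    conv_rhs => rw [← csqrt_sq t]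
    field_simp
  rw [e, show m - n + nt + (-m + n + nt) = 2 * nt by ring]

theorem tetG_mul_tetG_neg (p a b : ℂ) {n m : ℤ} (h : Even (n + m)) :
    tetG p (-a) n * tetG p (-b) m = tetG p a n * tetG p b m := by
  have : Even (n.natAbs + m.natAbs) := by
    rcases h with ⟨c, hc⟩
    rw [Nat.even_iff]
    omega
  rw [tetG_neg, tetG_neg, show (-1 : ℂ) ^ n.natAbs * tetG p a n * ((-1) ^ m.natAbs * tetG p b m) =
    (-1) ^ (n.natAbs + m.natAbs) * (tetG p a n * tetG p b m) by ring, this.neg_one_pow, one_mul]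

theorem hyperTerm_neg_arg (p : ℂ) (r ρ : Fin 3 → ℂ) {n m : Fin 3 → ℤ} (h : Even (∑ i, (n i + m i)))
    (k : ℤ) (y : ℂ) : hyperTerm p r ρ n m k (-y) = hyperTerm p r ρ n m k y := by
  have key : ∀ i, tetG p (r i * -y) (n i + k) * tetG p (ρ i / -y) (m i - k) =
      (-1) ^ (n i + m i).natAbs * (tetG p (r i * y) (n i + k) * tetG p (ρ i / y) (m i - k)) := by
    intro i
    rw [mul_neg, div_neg, tetG_neg, tetG_neg]
    have : (-1 : ℂ) ^ (n i + k).natAbs * (-1) ^ (m i - k).natAbs = (-1) ^ (n i + m i).natAbs := by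
      rw [← pow_add]
      refine neg_one_pow_congr ?_
      rw [Nat.even_iff, Nat.even_iff]
      omega
    rw [← this]
    ring
  simp only [hyperTerm, key, Finset.prod_mul_distrib]
  rw [Finset.prod_pow_eq_pow_sum, Even.neg_one_pow, one_mul]
  simp only [Fin.sum_univ_three, Int.even_iff, Nat.even_iff] at h ⊢
  omega

/-! ### Matching the three Bailey kernels with the star-triangle relation -/

section parameters

variable {p S T U W Z V Y : ℂ} {n k j ns nt nu : ℤ}

/-- Of the denominators only the gamma of S²T²UY depends on the integration variable; reflection
moves it to the numerator as the sixth gamma, with parameter -p² / (S²T²U). -/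
theorem kernel_product_eq_hyperTerm (hp0 : p ≠ 0) (hp1 : ‖p‖ < 1) (hS : S ≠ 0) (hT : T ≠ 0)
    (hU : U ≠ 0) (hW : W ≠ 0) (hY : Y ≠ 0)
    (h1 : ‖p‖ ^ 2 < ‖S ^ 2 * T ^ 2 * U * Y‖) (h2 : ‖S ^ 2 * T ^ 2 * U * Y‖ < 1) :
    pentB (p ^ 2) (S * W * Y⁻¹) (-j + n + ns) (U * Y) (nu + j) *
        pentB (p ^ 2) (S * T ^ 2 * U * W) (n + 2 * nt + nu + ns) (S * W⁻¹ * Y) (-n + j + ns) *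
        (tetG p (T * Y * Z⁻¹) (j - k + nt) * tetG p (T * Y⁻¹ * Z) (-j + k + nt) /
          tetG p (T ^ 2) (2 * nt)) =
      tetG p (S * T ^ 2 * U * W) (n + 2 * nt + nu + ns) /
          (tetG p (S * W * U) (n + ns + nu) * tetG p (T ^ 2) (2 * nt)) *
        hyperTerm p ![U, S / W, T / Z] ![S * W, T * Z, -p ^ 2 / (S ^ 2 * T ^ 2 * U)]
          ![nu, ns - n, nt - k] ![n + ns, k + nt, -(2 * nt + nu + 2 * ns)] j Y := by
  have hY' := inv_ne_zero hY
  rw [pentB_eq_tetG hp0 (by simp [*]) (by simp [*]), pentB_eq_tetG hp0 (by simp [*]) (by simp [*])]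
  have hr := tetG_mul_reflect hp0 hp1 h1 h2 (2 * nt + nu + 2 * ns + j)
  have e1 : S * W * Y⁻¹ * (U * Y) = S * W * U := by field_simp
  have e2 : S * T ^ 2 * U * W * (S * W⁻¹ * Y) = S ^ 2 * T ^ 2 * U * Y := by field_simp
  have e3 : -p ^ 2 / (S ^ 2 * T ^ 2 * U * Y) = -p ^ 2 / (S ^ 2 * T ^ 2 * U) / Y := by
    rw [div_div]
  rw [e1, e2, show -j + n + ns + (nu + j) = n + ns + nu by ring,
    show n + 2 * nt + nu + ns + (-n + j + ns) = 2 * nt + nu + 2 * ns + j by ring]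
  rw [e3] at hr
  have hr' := eq_inv_of_mul_eq_one_right hr
  simp only [hyperTerm, Fin.prod_univ_three, Matrix.cons_val]
  rw [show -(2 * nt + nu + 2 * ns) - j = -(2 * nt + nu + 2 * ns + j) by ring, hr',
    show -j + n + ns = n + ns - j by ring, show -n + j + ns = ns - n + j by ring,
    show j - k + nt = nt - k + j by ring, show -j + k + nt = k + nt - j by ring,
    show S * W * Y⁻¹ = S * W / Y by ring, show S * W⁻¹ * Y = S / W * Y by ring,
    show T * Y * Z⁻¹ = T / Z * Y by ring, show T * Y⁻¹ * Z = T * Z / Y by ring]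
  ring

/-- The three gammas containing the reflected parameter become inverses of `tetG`, supplying the
denominators of the two new kernels and cancelling the prefactor. -/
theorem hyperProd_eq_kernel_product (hp0 : p ≠ 0) (hp1 : ‖p‖ < 1)
    (hr : ∀ i, ![U, S / W, T / Z] i ≠ 0 ∧ ‖![U, S / W, T / Z] i‖ < 1)
    (hρ : ∀ i, ![S * W, T * Z, -p ^ 2 / (S ^ 2 * T ^ 2 * U)] i ≠ 0 ∧
      ‖![S * W, T * Z, -p ^ 2 / (S ^ 2 * T ^ 2 * U)] i‖ < 1)
    (hV : V ^ 2 = S ^ 2 * T ^ 2) :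
    tetG p (S * T ^ 2 * U * W) (n + 2 * nt + nu + ns) /
          (tetG p (S * W * U) (n + ns + nu) * tetG p (T ^ 2) (2 * nt)) *
        hyperProd p ![U, S / W, T / Z] ![S * W, T * Z, -p ^ 2 / (S ^ 2 * T ^ 2 * U)]
          ![nu, ns - n, nt - k] ![n + ns, k + nt, -(2 * nt + nu + 2 * ns)] =
      tetG p (V * W * Z⁻¹) (n - k + (ns + nt)) * tetG p (V * W⁻¹ * Z) (-n + k + (ns + nt)) /
          tetG p (S ^ 2 * T ^ 2) (2 * (ns + nt)) *
        pentB (p ^ 2) (T * U * Z) (k + nu + nt) (S ^ 2) (2 * ns) := by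
  have hprod : ∏ i, ![U, S / W, T / Z] i * ![S * W, T * Z, -p ^ 2 / (S ^ 2 * T ^ 2 * U)] i =
      -p ^ 2 := by
    obtain ⟨⟨hU, -⟩, ⟨-, -⟩, hT, -⟩ := (forall_vec_three (P := fun x => x ≠ 0 ∧ ‖x‖ < 1)).1 hr
    obtain ⟨⟨hS, -⟩, ⟨hT', -⟩, -⟩ := (forall_vec_three (P := fun x => x ≠ 0 ∧ ‖x‖ < 1)).1 hρ
    simp only [ne_eq, mul_eq_zero, div_eq_zero_iff, not_or] at hU hT hS hT'
    obtain ⟨hS, hW⟩ := hS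
    obtain ⟨hT, hZ⟩ := hT
    simp only [Fin.prod_univ_three, Matrix.cons_val]
    field_simp
  have hlt := norm_sq_lt_norm_mul hr hρ hprod
  have hlt1 := fun i j => norm_mul_lt_one (hr i).2 (hρ j).2
  have hne := fun i j => tetG_ne_zero hp0 hp1 (hlt i j) (hlt1 i j)
  have hrefl := fun i j => tetG_mul_reflect hp0 hp1 (hlt i j) (hlt1 i j)
  obtain ⟨⟨hU, -⟩, ⟨-, -⟩, hT, -⟩ := (forall_vec_three (P := fun x => x ≠ 0 ∧ ‖x‖ < 1)).1 hr
  obtain ⟨⟨hS, -⟩, ⟨hT', -⟩, -⟩ := (forall_vec_three (P := fun x => x ≠ 0 ∧ ‖x‖ < 1)).1 hρ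
  simp only [ne_eq, mul_eq_zero, div_eq_zero_iff, not_or] at hU hT hS hT'
  obtain ⟨hS, hW⟩ := hS
  obtain ⟨hT, hZ⟩ := hT
  have f02 := eq_inv_of_mul_eq_one_left (hrefl 0 2 (-(2 * nt + 2 * ns)))
  have f12 := eq_inv_of_mul_eq_one_left (hrefl 1 2 (-(n + 2 * nt + nu + ns)))
  have f22 := eq_inv_of_mul_eq_one_left (hrefl 2 2 (-(k + nt + nu + 2 * ns)))
  have g12 := right_ne_zero_of_mul_eq_one (hrefl 1 2 (-(n + 2 * nt + nu + ns)))
  have g00 := hne 0 0 (n + ns + nu)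
  have g21 := hne 2 1 (2 * nt)
  simp only [Matrix.cons_val, neg_neg] at f02 f12 f22 g12 g00 g21
  have e02 : -p ^ 2 / (U * (-p ^ 2 / (S ^ 2 * T ^ 2 * U))) = S ^ 2 * T ^ 2 := by field_simp
  have e12 : -p ^ 2 / (S / W * (-p ^ 2 / (S ^ 2 * T ^ 2 * U))) = S * T ^ 2 * U * W := by field_simp
  have e22 : -p ^ 2 / (T / Z * (-p ^ 2 / (S ^ 2 * T ^ 2 * U))) = S ^ 2 * T * U * Z := by field_simp
  have e21 : T / Z * (T * Z) = T ^ 2 := by field_simp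
  have e00 : U * (S * W) = S * W * U := by ring
  rw [e02] at f02
  rw [e12] at f12 g12
  rw [e22] at f22
  rw [e21] at g21
  rw [e00] at g00
  -- The chosen root V of the product st may differ from S T by a sign; the two indices have even
  -- sum, so the sign drops out.
  have hsign : tetG p (V * W * Z⁻¹) (n - k + (ns + nt)) *
      tetG p (V * W⁻¹ * Z) (-n + k + (ns + nt)) =
      tetG p (T / Z * (S * W)) (n - k + (ns + nt)) *
        tetG p (S / W * (T * Z)) (-n + k + (ns + nt)) := by
    have hV' : V ^ 2 = (S * T) ^ 2 := by rw [hV, mul_pow]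
    have a1 : T / Z * (S * W) = S * T * W * Z⁻¹ := by ring
    have a2 : S / W * (T * Z) = S * T * W⁻¹ * Z := by ring
    rw [a1, a2]
    rcases sq_eq_sq_iff_eq_or_eq_neg.1 hV' with rfl | rfl
    · rfl
    · simp only [neg_mul]
      exact tetG_mul_tetG_neg _ _ _ ⟨ns + nt, by ring⟩
  rw [hsign, pentB_eq_tetG hp0 (by simp [*]) (by simp [*])]
  simp only [hyperProd, Fin.prod_univ_three, Matrix.cons_val]
  rw [show nu + -(2 * nt + nu + 2 * ns) = -(2 * nt + 2 * ns) by ring, f02,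
    show ns - n + -(2 * nt + nu + 2 * ns) = -(n + 2 * nt + nu + ns) by ring, f12,
    show nt - k + -(2 * nt + nu + 2 * ns) = -(k + nt + nu + 2 * ns) by ring, f22, e21, e00,
    show nt - k + (k + nt) = 2 * nt by ring, show nu + (n + ns) = n + ns + nu by ring,
    show S / W * (S * W) = S ^ 2 by field_simp, show ns - n + (n + ns) = 2 * ns by ring,
    show U * (T * Z) = T * U * Z by ring, show nu + (k + nt) = k + nu + nt by ring,
    show ns - n + (k + nt) = -n + k + (ns + nt) by ring,
    show nt - k + (n + ns) = n - k + (ns + nt) by ring,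
    show T * U * Z * S ^ 2 = S ^ 2 * T * U * Z by ring,
    show k + nu + nt + 2 * ns = k + nt + nu + 2 * ns by ring,
    show 2 * nt + 2 * ns = 2 * (ns + nt) by ring]
  generalize tetG p (S * W * U) (n + ns + nu) = A at g00 ⊢
  generalize tetG p (S * T ^ 2 * U * W) (n + 2 * nt + nu + ns) = B at g12 ⊢
  generalize tetG p (T ^ 2) (2 * nt) = C at g21 ⊢
  field_simp

end parameters

/-- Evenness makes the jump of the principal root harmless: it can be replaced by half the angle,
and the integrand then has period π. -/
theorem circleAverage_comp_csqrt {f : ℂ → ℂ} (hf : ∀ y, f (-y) = f y)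
    (hint : CircleIntegrable f 0 1) :
    Real.circleAverage (fun x => f (csqrt x)) 0 1 = Real.circleAverage f 0 1 := by
  have h1 : ∀ θ : ℝ, f (csqrt (circleMap 0 1 θ)) = f (circleMap 0 1 (θ / 2)) := by
    intro θ
    have h2 : csqrt (circleMap 0 1 θ) ^ 2 = circleMap 0 1 (θ / 2) ^ 2 := by
      rw [csqrt_sq]
      simp only [circleMap, zero_add, ofReal_one, one_mul, ← exp_nat_mul]
      congr 1
      push_cast
      ring
    rcases sq_eq_sq_iff_eq_or_eq_neg.1 h2 with h | h
    · rw [h]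
    · rw [h, hf]
  have hper : Function.Periodic (fun θ : ℝ => f (circleMap 0 1 θ)) Real.pi := fun θ => by
    simp only
    rw [← hf (circleMap 0 1 θ)]
    congr 1
    simp [circleMap, add_mul, exp_add]
  have hii : ∀ a b : ℝ, IntervalIntegrable (fun θ => f (circleMap 0 1 θ)) volume a b := fun a b =>
    (periodic_circleMap 0 1).comp f |>.intervalIntegrable₀ Real.two_pi_pos.ne' hint a b
  simp only [Real.circleAverage_def, h1]
  rw [intervalIntegral.integral_comp_div (fun θ => f (circleMap 0 1 θ)) two_ne_zero]
  have h2 := hper.intervalIntegral_add_eq_add 0 Real.pi hii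
  simp only [zero_add] at h2
  rw [two_mul, h2, zero_div, ← two_mul, mul_div_cancel_left₀ _ two_ne_zero, two_smul ℝ]

/-- The kernel of the sum/integral defining `baileyBeta`. -/
noncomputable def betaKernel (h s t u : ℂ) (ns nt nu n : ℤ) (w : ℂ) (m : ℤ) (x : ℂ) : ℂ :=
  pentB h (csqrt s * csqrt w * (csqrt x)⁻¹) (-m + n + ns) (csqrt u * csqrt x) (nu + m) *
    pentB h (csqrt s * t * csqrt u * csqrt w) (n + 2 * nt + nu + ns)
      (csqrt s * (csqrt w)⁻¹ * csqrt x) (-n + m + ns)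

/-! ### The evaluated product of kernels in terms of s, t, u -/

section parameters

variable {p s t u w z x : ℂ} {n k j ns nt nu : ℤ}

theorem norm_sq_lt_norm_mul_csqrt (hstu : ‖p‖ ^ 4 < ‖s ^ 2 * t ^ 2 * u‖) :
    ‖p‖ ^ 2 < ‖s * t * csqrt u‖ := by
  refine lt_of_pow_lt_pow_left₀ 2 (norm_nonneg _) ?_
  rw [← norm_pow (s * t * _), mul_pow, csqrt_sq, mul_pow, ← pow_mul]
  exact hstu

/-- The domain |s| < |w| < |s|⁻¹ handles the two parameters with w, and |q| < |s²t²u| is precisely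
the bound for the reflected one. -/
theorem norm_parameters_lt_one (hp0 : p ≠ 0) (ht : ‖t‖ < 1) (hu : ‖u‖ < 1)
    (hstu : ‖p‖ ^ 4 < ‖s ^ 2 * t ^ 2 * u‖) (hw : ‖s‖ < ‖w‖) (hw' : ‖s‖ * ‖w‖ < 1) (hz : ‖z‖ = 1) :
    (∀ i, ![csqrt u, csqrt s / csqrt w, csqrt t / csqrt z] i ≠ 0 ∧
        ‖![csqrt u, csqrt s / csqrt w, csqrt t / csqrt z] i‖ < 1) ∧
      ∀ i, ![csqrt s * csqrt w, csqrt t * csqrt z,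
          -p ^ 2 / (csqrt s ^ 2 * csqrt t ^ 2 * csqrt u)] i ≠ 0 ∧
        ‖![csqrt s * csqrt w, csqrt t * csqrt z,
          -p ^ 2 / (csqrt s ^ 2 * csqrt t ^ 2 * csqrt u)] i‖ < 1 := by
  have h0 : s ^ 2 * t ^ 2 * u ≠ 0 := norm_pos_iff.1 (lt_of_le_of_lt (by positivity) hstu)
  simp only [ne_eq, mul_eq_zero, pow_eq_zero_iff, not_false_eq_true, OfNat.ofNat_ne_zero,
    not_or] at h0
  obtain ⟨⟨hs0, ht0⟩, hu0⟩ := h0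
  have hw0 : w ≠ 0 := norm_pos_iff.1 ((norm_nonneg _).trans_lt hw)
  have hz0 : z ≠ 0 := norm_pos_iff.1 (hz ▸ one_pos)
  have hz1 := norm_csqrt_eq_one hz
  have hlt := norm_sq_lt_norm_mul_csqrt hstu
  have hsq : ∀ a : ℂ, ‖a‖ ^ 2 < 1 → ‖a‖ < 1 := fun a ha =>
    (pow_lt_one_iff_of_nonneg (norm_nonneg _) two_ne_zero).1 ha
  refine ⟨(forall_vec_three (P := fun x => x ≠ 0 ∧ ‖x‖ < 1)).2 ⟨⟨csqrt_ne_zero hu0, ?_⟩,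
    ⟨div_ne_zero (csqrt_ne_zero hs0) (csqrt_ne_zero hw0), ?_⟩,
    ⟨div_ne_zero (csqrt_ne_zero ht0) (csqrt_ne_zero hz0), ?_⟩⟩,
    (forall_vec_three (P := fun x => x ≠ 0 ∧ ‖x‖ < 1)).2
    ⟨⟨mul_ne_zero (csqrt_ne_zero hs0) (csqrt_ne_zero hw0), ?_⟩,
    ⟨mul_ne_zero (csqrt_ne_zero ht0) (csqrt_ne_zero hz0), ?_⟩, ⟨?_, ?_⟩⟩⟩
  · exact hsq _ (by rwa [norm_csqrt_sq])
  · refine hsq _ ?_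
    rw [norm_div, div_pow, norm_csqrt_sq, norm_csqrt_sq]
    exact (div_lt_one ((norm_nonneg _).trans_lt hw)).2 hw
  · rw [norm_div, hz1, div_one]
    exact hsq _ (by rwa [norm_csqrt_sq])
  · refine hsq _ ?_
    rwa [norm_mul, mul_pow, norm_csqrt_sq, norm_csqrt_sq]
  · rw [norm_mul, hz1, mul_one]
    exact hsq _ (by rwa [norm_csqrt_sq])
  · rw [csqrt_sq, csqrt_sq]
    have := csqrt_ne_zero hu0
    simp [*]
  · rw [csqrt_sq, csqrt_sq, norm_div, norm_neg, norm_pow]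
    exact (div_lt_one (lt_of_le_of_lt (by positivity) hlt)).2 hlt

theorem tsum_circleAverage_betaKernel (hp0 : p ≠ 0) (hp1 : ‖p‖ < 1) (hs : ‖s‖ < 1) (ht : ‖t‖ < 1)
    (hu : ‖u‖ < 1) (hstu : ‖p‖ ^ 4 < ‖s ^ 2 * t ^ 2 * u‖) (hw : ‖s‖ < ‖w‖) (hw' : ‖s‖ * ‖w‖ < 1)
    (hz : ‖z‖ = 1) :
    ∑' j : ℤ, Real.circleAverage (fun x => betaKernel (p ^ 2) s t u ns nt nu n w j x *
        baileyKernel (p ^ 2) t nt j x k z) 0 1 =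
      baileyKernel (p ^ 2) (s * t) (ns + nt) n w k z *
        pentB (p ^ 2) (csqrt t * csqrt u * csqrt z) (k + nu + nt) s (2 * ns) := by
  obtain ⟨hr, hρ⟩ := norm_parameters_lt_one hp0 ht hu hstu hw hw' hz
  have h0 : s ^ 2 * t ^ 2 * u ≠ 0 := norm_pos_iff.1 (lt_of_le_of_lt (by positivity) hstu)
  simp only [ne_eq, mul_eq_zero, pow_eq_zero_iff, not_false_eq_true, OfNat.ofNat_ne_zero,
    not_or] at h0
  obtain ⟨⟨hs0, ht0⟩, hu0⟩ := h0
  have hw0 : w ≠ 0 := norm_pos_iff.1 ((norm_nonneg _).trans_lt hw)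
  have hz0 : z ≠ 0 := norm_pos_iff.1 (hz ▸ one_pos)
  have hlt := norm_sq_lt_norm_mul_csqrt hstu
  have hu1 : ‖csqrt u‖ < 1 := (hr 0).2
  have hlt1 : ‖s * t * csqrt u‖ < 1 := norm_mul_lt_one (norm_mul_lt_one hs ht) hu1
  have hprod : ∏ i, ![csqrt u, csqrt s / csqrt w, csqrt t / csqrt z] i *
      ![csqrt s * csqrt w, csqrt t * csqrt z,
        -p ^ 2 / (csqrt s ^ 2 * csqrt t ^ 2 * csqrt u)] i = -p ^ 2 := by
    have := csqrt_ne_zero hs0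
    have := csqrt_ne_zero ht0
    have := csqrt_ne_zero hu0
    have := csqrt_ne_zero hw0
    have := csqrt_ne_zero hz0
    simp only [Fin.prod_univ_three, Matrix.cons_val]
    field_simp
  have hsum : ∑ i, (![nu, ns - n, nt - k] i + ![n + ns, k + nt, -(2 * nt + nu + 2 * ns)] i) =
      0 := by
    simp only [Fin.sum_univ_three, Matrix.cons_val]
    ring
  have hB := hyperProd_eq_kernel_product (n := n) (k := k) (ns := ns) (nt := nt) (nu := nu)
    (V := csqrt (s * t)) hp0 hp1 hr hρ (by simp only [csqrt_sq])
  rw [← hyperSum_eq_hyperProd hp0 hp1 hr hρ hprod hsum, hyperSum, ← tsum_mul_left] at hB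
  rw [baileyKernel_eq_tetG hp0 (mul_ne_zero hs0 ht0) hw0 hz0]
  simp only [csqrt_sq] at hB ⊢
  rw [← hB]
  congr 1
  funext j
  have hev := hyperTerm_neg_arg p ![csqrt u, csqrt s / csqrt w, csqrt t / csqrt z]
    ![csqrt s * csqrt w, csqrt t * csqrt z,
        -p ^ 2 / (csqrt s ^ 2 * csqrt t ^ 2 * csqrt u)] (hsum ▸ Even.zero) j
  have hint := circleIntegrable_hyperTerm hp1 ![nu, ns - n, nt - k]
    ![n + ns, k + nt, -(2 * nt + nu + 2 * ns)] j hr hρ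
  rw [csqrt_sq, csqrt_sq] at hev hint
  rw [← circleAverage_comp_csqrt hev hint, ← smul_eq_mul, ← Real.circleAverage_fun_smul]
  refine Real.circleAverage_congr_sphere fun x hx => ?_
  have hx1 : ‖x‖ = 1 := by simpa using hx
  have hx0 : x ≠ 0 := norm_pos_iff.1 (hx1 ▸ one_pos)
  have hA := kernel_product_eq_hyperTerm (p := p) (S := csqrt s) (T := csqrt t) (U := csqrt u)
    (W := csqrt w) (Z := csqrt z) (Y := csqrt x) (n := n) (k := k) (j := j) (ns := ns) (nt := nt)
    (nu := nu) hp0 hp1 (csqrt_ne_zero hs0) (csqrt_ne_zero ht0) (csqrt_ne_zero hu0)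
    (csqrt_ne_zero hw0) (csqrt_ne_zero hx0)
    (by rwa [csqrt_sq, csqrt_sq, norm_mul, norm_csqrt_eq_one hx1, mul_one])
    (by rwa [csqrt_sq, csqrt_sq, norm_mul, norm_csqrt_eq_one hx1, mul_one])
  simp only [csqrt_sq] at hA
  simp only [smul_eq_mul]
  rw [← hA, betaKernel, baileyKernel_eq_tetG hp0 ht0 hx0 hz0]

end parameters

/-! ### Bounds and measurability of the kernels -/

theorem exists_norm_tetG_add_le_of_norm_eq {p : ℂ} (hp0 : p ≠ 0) (hp1 : ‖p‖ < 1) {a : ℝ}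
    (ha0 : 0 < a) (ha1 : a < 1) (n : ℤ) :
    ∃ C > 0, ∀ (r : ℂ) (k : ℤ), ‖r‖ = a → ‖tetG p r (n + k)‖ ≤ C * (‖p‖ / a) ^ k.natAbs := by
  obtain ⟨C, hC0, hC⟩ := exists_norm_tetG_add_le hp0 hp1 ha0
    (pow_lt_one₀ ha0.le ha1 two_ne_zero) n
  refine ⟨C, hC0, fun r k hr => ?_⟩
  have := hC r k hr.ge (hr.trans_lt ha1).le (norm_pow_mul_sq_le hp1 hr.le _)
  rwa [hr] at this

theorem exists_le_norm_tetG_add_of_norm_eq {p : ℂ} (hp0 : p ≠ 0) (hp1 : ‖p‖ < 1) {a : ℝ}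
    (ha0 : ‖p‖ ^ 2 < a) (ha1 : a < 1) (n : ℤ) :
    ∃ c > 0, ∀ (r : ℂ) (k : ℤ), ‖r‖ = a → c * (‖p‖ / a) ^ k.natAbs ≤ ‖tetG p r (n + k)‖ := by
  obtain ⟨c, hc0, hc⟩ := exists_le_norm_tetG hp1 ha0 ha1
  have hp : 0 < ‖p‖ := norm_pos_iff.2 hp0
  have ha : 0 < a := lt_of_le_of_lt (by positivity) ha0
  have hM : 0 < ‖p‖ / a + (‖p‖ / a)⁻¹ := by positivity
  refine ⟨c / (‖p‖ / a + (‖p‖ / a)⁻¹) ^ n.natAbs, by positivity, fun r k hr => ?_⟩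
  have h1 := hc r (n + k) hr.ge hr.le
  rw [hr] at h1
  refine le_trans ?_ h1
  rw [div_mul_eq_mul_div, div_le_iff₀ (by positivity)]
  have h2 := pow_natAbs_le_add (x := ‖p‖ / a) (M := ‖p‖ / a + (‖p‖ / a)⁻¹) (by positivity)
    (le_add_of_nonneg_right (by positivity)) (le_add_of_nonneg_left (by positivity)) n k
  calc _ ≤ c * ((‖p‖ / a + (‖p‖ / a)⁻¹) ^ n.natAbs * (‖p‖ / a) ^ (n + k).natAbs) := by gcongr
    _ = _ := by ring

section kernels

variable {p s t u w : ℂ}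

theorem exists_norm_baileyKernel_le (hp0 : p ≠ 0) (hp1 : ‖p‖ < 1) (ht : t ≠ 0) {ω : ℝ}
    (hω : ‖t‖ * ω < 1) (hω' : ‖t‖ < ω) (nt m : ℤ) :
    ∃ C ≥ 0, ∀ (l : ℤ) (w : ℂ) (k : ℤ) (z : ℂ), ‖w‖ = ω → ‖z‖ = 1 →
      ‖baileyKernel (p ^ 2) t nt (m + l) w k z‖ ≤ C * (‖p‖ ^ 2 / ‖t‖) ^ (l - k).natAbs := by
  have hω0 : 0 < ω := (norm_nonneg _).trans_lt hω'
  have ht0 : 0 < ‖csqrt t‖ := norm_pos_iff.2 (csqrt_ne_zero ht)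
  have hsq := Real.sq_sqrt hω0.le
  have hsq0 := Real.sqrt_pos.2 hω0
  obtain ⟨A, hA0, hA⟩ := exists_norm_tetG_add_le_of_norm_eq hp0 hp1
    (a := ‖csqrt t‖ * √ω) (by positivity)
    ((pow_lt_one_iff_of_nonneg (by positivity) two_ne_zero).1
      (by rwa [mul_pow, hsq, norm_csqrt_sq])) (m + nt)
  obtain ⟨B, hB0, hB⟩ := exists_norm_tetG_add_le_of_norm_eq hp0 hp1
    (a := ‖csqrt t‖ / √ω) (by positivity)
    ((pow_lt_one_iff_of_nonneg (by positivity) two_ne_zero).1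
      (by rwa [div_pow, hsq, norm_csqrt_sq, div_lt_one hω0])) (m - nt)
  refine ⟨A * B / ‖tetG p t (2 * nt)‖, by positivity, fun l w k z hw hz => ?_⟩
  have hw1 : ‖csqrt w‖ = √ω := by
    rw [← hw, ← norm_csqrt_sq w, Real.sqrt_sq (norm_nonneg _)]
  have hz1 := norm_csqrt_eq_one hz
  rw [baileyKernel_eq_tetG hp0 ht (norm_pos_iff.1 (hw ▸ hω0)) (norm_pos_iff.1 (hz ▸ one_pos)),
    norm_div, norm_mul, show m + l - k + nt = m + nt + (l - k) by ring,
    ← tetG_neg_index p _ (-(m + l) + k + nt), show -(-(m + l) + k + nt) = m - nt + (l - k) by ring,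
    div_mul_eq_mul_div]
  refine div_le_div_of_nonneg_right ?_ (norm_nonneg _)
  calc _ ≤ (A * (‖p‖ / (‖csqrt t‖ * √ω)) ^ (l - k).natAbs) *
        (B * (‖p‖ / (‖csqrt t‖ / √ω)) ^ (l - k).natAbs) := by
        gcongr
        · exact hA _ _ (by rw [norm_mul, norm_mul, norm_inv, hw1, hz1, inv_one, mul_one])
        · exact hB _ _ (by rw [norm_mul, norm_mul, norm_inv, hw1, hz1, mul_one]; rfl)
    _ = A * B * ((‖p‖ / (‖csqrt t‖ * √ω)) * (‖p‖ / (‖csqrt t‖ / √ω))) ^ (l - k).natAbs := by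
        rw [mul_pow]
        ring
    _ = _ := by
        rw [← norm_csqrt_sq t]
        congr 2
        field_simp

/-- This allows the kernel to be divided out, so that convergence of the given pair yields an
estimate for α itself. -/
theorem exists_le_norm_baileyKernel (hp0 : p ≠ 0) (hp1 : ‖p‖ < 1) (ht : ‖p‖ ^ 2 < ‖t‖)
    (ht1 : ‖t‖ < 1) (nt : ℤ) :
    ∃ c > 0, ∀ (l : ℤ) (w : ℂ) (k : ℤ) (z : ℂ), ‖w‖ = 1 → ‖z‖ = 1 →
      c * (‖p‖ ^ 2 / ‖t‖) ^ (l - k).natAbs ≤ ‖baileyKernel (p ^ 2) t nt l w k z‖ := by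
  have ht0 : t ≠ 0 := norm_pos_iff.1 (lt_of_le_of_lt (by positivity) ht)
  have h1 : ‖csqrt t‖ < 1 := norm_csqrt_lt zero_le_one (by simpa using ht1)
  have h2 : ‖p‖ ^ 2 < ‖csqrt t‖ := by
    refine ht.trans ?_
    rw [← norm_csqrt_sq t, sq]
    exact mul_lt_of_lt_one_left (norm_pos_iff.2 (csqrt_ne_zero ht0)) h1
  obtain ⟨A, hA0, hA⟩ := exists_le_norm_tetG_add_of_norm_eq hp0 hp1 h2 h1 nt
  obtain ⟨B, hB0, hB⟩ := exists_le_norm_tetG_add_of_norm_eq hp0 hp1 h2 h1 (-nt)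
  have hne := norm_pos_iff.2 (tetG_ne_zero hp0 hp1 ht ht1 (2 * nt))
  refine ⟨A * B / ‖tetG p t (2 * nt)‖, by positivity, fun l w k z hw hz => ?_⟩
  have hw1 := norm_csqrt_eq_one hw
  have hz1 := norm_csqrt_eq_one hz
  rw [baileyKernel_eq_tetG hp0 ht0 (norm_pos_iff.1 (hw ▸ one_pos)) (norm_pos_iff.1 (hz ▸ one_pos)),
    norm_div, norm_mul, show l - k + nt = nt + (l - k) by ring,
    ← tetG_neg_index p _ (-l + k + nt), show -(-l + k + nt) = -nt + (l - k) by ring,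
    div_mul_eq_mul_div]
  refine div_le_div_of_nonneg_right ?_ (norm_nonneg _)
  calc _ = (A * (‖p‖ / ‖csqrt t‖) ^ (l - k).natAbs) *
        (B * (‖p‖ / ‖csqrt t‖) ^ (l - k).natAbs) := by
        rw [← norm_csqrt_sq t, ← div_pow, ← pow_mul, mul_comm 2, pow_mul]
        ring
    _ ≤ _ := by
        gcongr
        · exact hA _ _ (by simp [hw1, hz1])
        · exact hB _ _ (by simp [hw1, hz1])

/-- After reflection four gammas depend on j; their rates multiply to |p|²|t|, the dependence on s,
u and w cancelling. -/
theorem exists_norm_betaKernel_le (hp0 : p ≠ 0) (hp1 : ‖p‖ < 1) (hs : ‖s‖ < 1) (ht : ‖t‖ < 1)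
    (hu : ‖u‖ < 1) (hstu : ‖p‖ ^ 4 < ‖s ^ 2 * t ^ 2 * u‖) (hw : ‖s‖ < ‖w‖) (hw' : ‖s‖ * ‖w‖ < 1)
    (ns nt nu n : ℤ) :
    ∃ C ≥ 0, ∀ (j : ℤ) (x : ℂ), ‖x‖ = 1 →
      ‖betaKernel (p ^ 2) s t u ns nt nu n w j x‖ ≤ C * (‖p‖ ^ 2 * ‖t‖) ^ j.natAbs := by
  have h0 : s ^ 2 * t ^ 2 * u ≠ 0 := norm_pos_iff.1 (lt_of_le_of_lt (by positivity) hstu)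
  simp only [ne_eq, mul_eq_zero, pow_eq_zero_iff, not_false_eq_true, OfNat.ofNat_ne_zero,
    not_or] at h0
  obtain ⟨⟨hs0, ht0⟩, hu0⟩ := h0
  have hw0 : w ≠ 0 := norm_pos_iff.1 ((norm_nonneg _).trans_lt hw)
  have hp : 0 < ‖p‖ := norm_pos_iff.2 hp0
  have hS := norm_pos_iff.2 (csqrt_ne_zero hs0)
  have hU := norm_pos_iff.2 (csqrt_ne_zero hu0)
  have hW := norm_pos_iff.2 (csqrt_ne_zero hw0)
  have hT := norm_pos_iff.2 ht0
  have hr := norm_parameters_lt_one (z := 1) hp0 ht hu hstu hw hw' (by simp)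
  have hlt := norm_sq_lt_norm_mul_csqrt hstu
  have hlt1 : ‖s * t * csqrt u‖ < 1 := norm_mul_lt_one (norm_mul_lt_one hs ht) (hr.1 0).2
  have hbd := fun (a : ℂ) (h : a ≠ 0 ∧ ‖a‖ < 1) =>
    exists_norm_tetG_add_le_of_norm_eq hp0 hp1 (norm_pos_iff.2 h.1) h.2
  obtain ⟨A, hA0, hA⟩ := hbd _ (hr.2 0) (-(n + ns))
  obtain ⟨B, hB0, hB⟩ := hbd _ (hr.1 0) nu
  obtain ⟨C, hC0, hC⟩ := hbd _ (hr.1 1) (ns - n)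
  obtain ⟨E, hE0, hE⟩ := hbd _ (hr.2 2) (2 * nt + nu + 2 * ns)
  simp only [Matrix.cons_val, csqrt_sq] at hA hB hC hE
  refine ⟨‖tetG p (csqrt s * t * csqrt u * csqrt w) (n + 2 * nt + nu + ns)‖ /
    ‖tetG p (csqrt s * csqrt w * csqrt u) (n + ns + nu)‖ * (A * B * C * E), by positivity,
    fun j x hx => ?_⟩
  have hx1 := norm_csqrt_eq_one hx
  have hX : csqrt x ≠ 0 := csqrt_ne_zero (norm_pos_iff.1 (hx ▸ one_pos))
  have hlt' : ‖s * t * csqrt u * csqrt x‖ = ‖s * t * csqrt u‖ := by rw [norm_mul, hx1, mul_one]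
  have hrefl := eq_inv_of_mul_eq_one_right (tetG_mul_reflect hp0 hp1 (hlt'.symm ▸ hlt)
    (hlt'.symm ▸ hlt1) (2 * nt + nu + 2 * ns + j))
  rw [tetG_neg_index] at hrefl
  have e : betaKernel (p ^ 2) s t u ns nt nu n w j x =
      tetG p (csqrt s * t * csqrt u * csqrt w) (n + 2 * nt + nu + ns) /
        tetG p (csqrt s * csqrt w * csqrt u) (n + ns + nu) *
      (tetG p (csqrt s * csqrt w * (csqrt x)⁻¹) (-(n + ns) + j) *
        tetG p (csqrt u * csqrt x) (nu + j) *
        tetG p (csqrt s * (csqrt w)⁻¹ * csqrt x) (ns - n + j) *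
        tetG p (-p ^ 2 / (s * t * csqrt u * csqrt x)) (2 * nt + nu + 2 * ns + j)) := by
    have := csqrt_ne_zero hs0
    have := csqrt_ne_zero hu0
    have := csqrt_ne_zero hw0
    rw [hrefl, betaKernel, pentB_eq_tetG hp0 (by simp [*]) (by simp [*]),
      pentB_eq_tetG hp0 (by simp [*]) (by simp [*]),
      ← tetG_neg_index p _ (-j + n + ns), show -(-j + n + ns) = -(n + ns) + j by ring,
      show -n + j + ns = ns - n + j by ring,
      show n + 2 * nt + nu + ns + (ns - n + j) = 2 * nt + nu + 2 * ns + j by ring,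
      show -j + n + ns + (nu + j) = n + ns + nu by ring]
    have e1 : csqrt s * csqrt w * (csqrt x)⁻¹ * (csqrt u * csqrt x) =
      csqrt s * csqrt w * csqrt u := by field_simp
    have e2 : csqrt s * t * csqrt u * csqrt w * (csqrt s * (csqrt w)⁻¹ * csqrt x) =
        s * t * csqrt u * csqrt x := by
      conv_rhs => rw [← csqrt_sq s]
      field_simp
    rw [e1, e2]
    ring
  rw [e, norm_mul, norm_div, mul_assoc (_ / _)]
  gcongr
  rw [norm_mul, norm_mul, norm_mul]
  calc _ ≤ A * (‖p‖ / ‖csqrt s * csqrt w‖) ^ j.natAbs * (B * (‖p‖ / ‖csqrt u‖) ^ j.natAbs) *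
        (C * (‖p‖ / ‖csqrt s / csqrt w‖) ^ j.natAbs) *
        (E * (‖p‖ / ‖-p ^ 2 / (s * t * csqrt u)‖) ^ j.natAbs) := by
        gcongr
        · exact hA _ _ (by simp [hx1])
        · exact hB _ _ (by simp [hx1])
        · exact hC _ _ (by simp [hx1]; rfl)
        · exact hE _ _ (by simp [hx1])
    _ = A * B * C * E * ((‖p‖ / ‖csqrt s * csqrt w‖) * (‖p‖ / ‖csqrt u‖) *
          (‖p‖ / ‖csqrt s / csqrt w‖) * (‖p‖ / ‖-p ^ 2 / (s * t * csqrt u)‖)) ^ j.natAbs := by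
        simp only [mul_pow]
        ring
    _ = _ := by
        congr 2
        simp only [norm_mul, norm_div, norm_neg, norm_pow]
        rw [← norm_csqrt_sq s]
        field_simp

theorem exists_norm_pentB_le (hp0 : p ≠ 0) (hp1 : ‖p‖ < 1) (hs : ‖s‖ < 1) (ht : ‖t‖ < 1)
    (hu : ‖u‖ < 1) (hstu : ‖p‖ ^ 4 < ‖s ^ 2 * t ^ 2 * u‖) (ns l : ℤ) :
    ∃ C ≥ 0, ∀ (k : ℤ) (z : ℂ), ‖z‖ = 1 →
      ‖pentB (p ^ 2) (csqrt t * csqrt u * csqrt z) (k + l) s (2 * ns)‖ ≤ C * ‖s‖ ^ k.natAbs := by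
  have h0 : s ^ 2 * t ^ 2 * u ≠ 0 := norm_pos_iff.1 (lt_of_le_of_lt (by positivity) hstu)
  simp only [ne_eq, mul_eq_zero, pow_eq_zero_iff, not_false_eq_true, OfNat.ofNat_ne_zero,
    not_or] at h0
  obtain ⟨⟨hs0, ht0⟩, hu0⟩ := h0
  have hp : 0 < ‖p‖ := norm_pos_iff.2 hp0
  have hS := norm_pos_iff.2 hs0
  have hU := norm_pos_iff.2 (csqrt_ne_zero hu0)
  have hT := norm_pos_iff.2 (csqrt_ne_zero ht0)
  have hT1 : ‖csqrt t‖ < 1 := norm_csqrt_lt zero_le_one (by simpa using ht)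
  have hU1 : ‖csqrt u‖ < 1 := norm_csqrt_lt zero_le_one (by simpa using hu)
  have hTU := norm_mul_lt_one hT1 hU1
  have hlt : ‖p‖ ^ 2 < ‖csqrt t * csqrt u * s‖ := by
    refine (norm_sq_lt_norm_mul_csqrt hstu).trans_le ?_
    simp only [norm_mul]
    rw [← norm_csqrt_sq t]
    nlinarith [mul_pos (mul_pos hS hT) hU]
  have hlt1 := norm_mul_lt_one hTU hs
  have hlt0 : 0 < ‖csqrt t * csqrt u * s‖ := lt_of_le_of_lt (by positivity) hlt
  have hbd := fun (a : ℂ) (h : a ≠ 0) (h1 : ‖a‖ < 1) =>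
    exists_norm_tetG_add_le_of_norm_eq hp0 hp1 (norm_pos_iff.2 h) h1
  obtain ⟨A, hA0, hA⟩ := hbd _ (norm_pos_iff.1 (by rw [norm_mul]; positivity)) hTU l
  obtain ⟨B, hB0, hB⟩ := hbd (-p ^ 2 / (csqrt t * csqrt u * s))
    (div_ne_zero (by simp [hp0]) (norm_pos_iff.1 hlt0))
    (by rw [norm_div, norm_neg, norm_pow]; exact (div_lt_one hlt0).2 hlt) (l + 2 * ns)
  refine ⟨‖tetG p s (2 * ns)‖ * (A * B), by positivity, fun k z hz => ?_⟩
  have hz1 := norm_csqrt_eq_one hz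
  have hZ : csqrt z ≠ 0 := csqrt_ne_zero (norm_pos_iff.1 (hz ▸ one_pos))
  have hlt' : ‖csqrt t * csqrt u * csqrt z * s‖ = ‖csqrt t * csqrt u * s‖ := by
    simp [hz1]
  have hrefl := eq_inv_of_mul_eq_one_right (tetG_mul_reflect hp0 hp1 (hlt'.symm ▸ hlt)
    (hlt'.symm ▸ hlt1) (l + 2 * ns + k))
  rw [tetG_neg_index] at hrefl
  have := csqrt_ne_zero ht0
  have := csqrt_ne_zero hu0
  rw [pentB_eq_tetG hp0 (by simp [*]) hs0, div_eq_mul_inv,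
    show k + l + 2 * ns = l + 2 * ns + k by ring, ← hrefl, norm_mul, norm_mul, add_comm k l]
  calc _ ≤ A * (‖p‖ / ‖csqrt t * csqrt u‖) ^ k.natAbs * ‖tetG p s (2 * ns)‖ *
        (B * (‖p‖ / ‖-p ^ 2 / (csqrt t * csqrt u * s)‖) ^ k.natAbs) := by
        gcongr
        · exact hA _ _ (by simp [hz1])
        · exact hB _ _ (by simp [hz1])
    _ = ‖tetG p s (2 * ns)‖ * (A * B) * ((‖p‖ / ‖csqrt t * csqrt u‖) *
          (‖p‖ / ‖-p ^ 2 / (csqrt t * csqrt u * s)‖)) ^ k.natAbs := by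
        simp only [mul_pow]
        ring
    _ = _ := by
        congr 2
        simp only [norm_mul, norm_div, norm_neg, norm_pow]
        field_simp

end kernels

theorem measurable_pentB_of_index {h : ℂ} (hh : ‖h‖ < 1) (n m : ℤ) :
    Measurable fun a : ℂ × ℂ => pentB h a.1 n a.2 m := by
  have hq : ‖h ^ 2‖ < 1 := by
    rw [norm_pow]
    exact pow_lt_one₀ (norm_nonneg _) hh two_ne_zero
  have hqm : Measurable fun z => qPoch z (h ^ 2) := (differentiable_qPoch hq).continuous.measurable
  have h1 : Measurable fun a : ℂ × ℂ => a.1 ^ 2 := measurable_fst.pow_const 2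
  have h2 : Measurable fun a : ℂ × ℂ => a.2 ^ 2 := measurable_snd.pow_const 2
  have h12 : Measurable fun a : ℂ × ℂ => a.1 ^ 2 * a.2 ^ 2 := h1.mul h2
  have hA : Measurable fun a : ℂ × ℂ => (-h) ^ ((|n| + |m| - |n + m|) / 2) *
      a.1 ^ (-|n|) * a.2 ^ (-|m|) * (a.1 * a.2) ^ |n + m| :=
    ((measurable_const.mul (measurable_fst.pow_const _)).mul
      (measurable_snd.pow_const _)).mul ((measurable_fst.mul measurable_snd).pow_const _)
  have hc : ∀ f : ℂ × ℂ → ℂ, Measurable f → ∀ c : ℂ, Measurable fun a => qPoch (c * f a) (h ^ 2) :=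
    fun f hf c => hqm.comp (hf.const_mul c)
  have hB := ((hc _ h1.inv (h ^ 2 * h ^ |n|)).mul (hc _ h2.inv (h ^ 2 * h ^ |m|))).mul
    (hc _ h12 (h ^ |n + m|))
  have hC := ((hc _ h1 (h ^ |n|)).mul (hc _ h2 (h ^ |m|))).mul
    (hc _ h12.inv (h ^ 2 * h ^ |n + m|))
  exact hA.mul (hB.div hC)

theorem measurable_pentB {h : ℂ} (hh : ‖h‖ < 1) {X : Type*} [MeasurableSpace X] {f g : X → ℂ}
    {n m : X → ℤ} (hf : Measurable f) (hg : Measurable g) (hn : Measurable n) (hm : Measurable m) :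
    Measurable fun x => pentB h (f x) (n x) (g x) (m x) := by
  -- The indices range over a countable set, so measurability for each fixed pair suffices.
  have key : Measurable fun a : (ℤ × ℤ) × ℂ × ℂ => pentB h a.2.1 a.1.1 a.2.2 a.1.2 :=
    measurable_from_prod_countable_right fun i => measurable_pentB_of_index hh i.1 i.2
  have e : (fun x => pentB h (f x) (n x) (g x) (m x)) =
      (fun a : (ℤ × ℤ) × ℂ × ℂ => pentB h a.2.1 a.1.1 a.2.2 a.1.2) ∘
        fun x => ((n x, m x), f x, g x) := rfl
  rw [e]
  exact key.comp ((hn.prodMk hm).prodMk (hf.prodMk hg))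

theorem measurable_baileyKernel {h : ℂ} (hh : ‖h‖ < 1) (t : ℂ) (nt : ℤ) {X : Type*}
    [MeasurableSpace X] {f g : X → ℂ} {n m : X → ℤ} (hf : Measurable f) (hg : Measurable g)
    (hn : Measurable n) (hm : Measurable m) :
    Measurable fun x => baileyKernel h t nt (m x) (f x) (n x) (g x) := by
  have hf' := measurable_csqrt.comp hf
  have hg' := measurable_csqrt.comp hg
  exact measurable_pentB hh ((hf'.const_mul _).mul hg'.inv) ((hf'.inv.const_mul _).mul hg')
    (by fun_prop) (by fun_prop)

theorem measurable_betaKernel {h : ℂ} (hh : ‖h‖ < 1) (s t u w : ℂ) (ns nt nu n : ℤ) {X : Type*}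
    [MeasurableSpace X] {f : X → ℂ} {m : X → ℤ} (hf : Measurable f) (hm : Measurable m) :
    Measurable fun x => betaKernel h s t u ns nt nu n w (m x) (f x) := by
  have hf' := measurable_csqrt.comp hf
  exact (measurable_pentB hh (hf'.inv.const_mul _) (hf'.const_mul _) (by fun_prop)
    (by fun_prop)).mul (measurable_pentB hh measurable_const (hf'.const_mul _) (by fun_prop)
    (by fun_prop))

/-! ### The product of the counting measure and the arc length -/

/-- The product of the counting measure on `ℤ` and the Lebesgue measure on `(0, 2π]`. -/
noncomputable def circleCount : Measure (ℤ × ℝ) :=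
  Measure.sum fun n : ℤ => (volume.restrict (Set.Ioc 0 (2 * Real.pi))).map (Prod.mk n)

instance : SFinite circleCount := by
  unfold circleCount
  infer_instance

theorem integrable_circleCount_iff {E : Type*} [NormedAddCommGroup E] {f : ℤ × ℝ → E} :
    Integrable f circleCount ↔
      (∀ n, IntervalIntegrable (fun θ => f (n, θ)) volume 0 (2 * Real.pi)) ∧
        Summable fun n => ∫ θ in (0 : ℝ)..(2 * Real.pi), ‖f (n, θ)‖ := by
  have he : ∀ n : ℤ, MeasurableEmbedding (Prod.mk n : ℝ → ℤ × ℝ) := measurableEmbedding_prodMk_left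
  rw [circleCount, integrable_sum_measure_iff]
  simp only [(he _).integrable_map_iff, (he _).integral_map,
    intervalIntegrable_iff_integrableOn_Ioc_of_le Real.two_pi_pos.le,
    intervalIntegral.integral_of_le Real.two_pi_pos.le, IntegrableOn, Function.comp_def]

theorem integral_circleCount {E : Type*} [NormedAddCommGroup E] [NormedSpace ℝ E] {f : ℤ × ℝ → E}
    (hf : Integrable f circleCount) :
    ∫ a, f a ∂circleCount = ∑' n : ℤ, ∫ θ in (0 : ℝ)..(2 * Real.pi), f (n, θ) := by
  have he : ∀ n : ℤ, MeasurableEmbedding (Prod.mk n : ℝ → ℤ × ℝ) := measurableEmbedding_prodMk_left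
  rw [circleCount] at hf ⊢
  rw [integral_sum_measure hf]
  simp only [(he _).integral_map, intervalIntegral.integral_of_le Real.two_pi_pos.le]

theorem absConvOnCircle_iff {F : ℤ → ℂ → ℂ} :
    AbsConvOnCircle F ↔ Integrable (fun a : ℤ × ℝ => F a.1 (circleMap 0 1 a.2)) circleCount :=
  (integrable_circleCount_iff (f := fun a : ℤ × ℝ => F a.1 (circleMap 0 1 a.2))).symm

theorem measurable_circleMap_snd : Measurable fun a : ℤ × ℝ => circleMap 0 1 a.2 :=
  (continuous_circleMap 0 1).measurable.comp measurable_snd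

/-- The extra factor is dz/dθ; it has modulus 1, so it does not affect integrability. -/
theorem sumCircleIntegral_eq {F : ℤ → ℂ → ℂ} (hF : AbsConvOnCircle F) :
    sumCircleIntegral F =
      ∫ a : ℤ × ℝ, F a.1 (circleMap 0 1 a.2) * (circleMap 0 1 a.2 * I) ∂circleCount := by
  rw [absConvOnCircle_iff] at hF
  rw [integral_circleCount, sumCircleIntegral]
  · simp only [circleIntegral, deriv_circleMap, smul_eq_mul, mul_comm]
  · refine hF.mul_bdd (c := 1) (measurable_circleMap_snd.mul_const I).aestronglyMeasurable
      (.of_forall fun a => by simp)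

theorem integrable_pow_natAbs_circleCount {x : ℝ} (h0 : 0 ≤ x) (h1 : x < 1) :
    Integrable (fun a : ℤ × ℝ => x ^ a.1.natAbs) circleCount := by
  refine integrable_circleCount_iff.2 ⟨fun n => intervalIntegrable_const (c := x ^ n.natAbs), ?_⟩
  simp only [intervalIntegral.integral_const, smul_eq_mul, norm_pow, Real.norm_of_nonneg h0]
  exact (summable_pow_natAbs_int h0 h1).mul_left _

/-! ### Integrability of α, of the new pair and of the double sum/integral -/

section bailey

variable {p s t u w : ℂ} {ns nt nu : ℤ} {α : ℤ → ℂ → ℂ}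

theorem aestronglyMeasurable_and_integrable_of_absConv (hp0 : p ≠ 0) (hp1 : ‖p‖ < 1)
    (ht : ‖p‖ ^ 2 < ‖t‖) (ht1 : ‖t‖ < 1)
    (hα : AbsConvOnCircle fun n z => baileyKernel (p ^ 2) t nt 0 1 n z * α n z) :
    AEStronglyMeasurable (fun a : ℤ × ℝ => α a.1 (circleMap 0 1 a.2)) circleCount ∧
      Integrable (fun a : ℤ × ℝ =>
        (‖p‖ ^ 2 / ‖t‖) ^ a.1.natAbs * ‖α a.1 (circleMap 0 1 a.2)‖) circleCount := by
  rw [absConvOnCircle_iff] at hα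
  have hp : 0 < ‖p‖ := norm_pos_iff.2 hp0
  have ht0 : 0 < ‖t‖ := lt_of_le_of_lt (by positivity) ht
  obtain ⟨c, hc0, hc⟩ := exists_le_norm_baileyKernel hp0 hp1 ht ht1 nt
  have hh : ‖p ^ 2‖ < 1 := by
    rw [norm_pow]
    exact pow_lt_one₀ (norm_nonneg _) hp1 two_ne_zero
  have hE : Measurable fun a : ℤ × ℝ => baileyKernel (p ^ 2) t nt 0 1 a.1 (circleMap 0 1 a.2) :=
    measurable_baileyKernel hh t nt measurable_const measurable_circleMap_snd measurable_fst
      measurable_const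
  have hlow : ∀ a : ℤ × ℝ, c * (‖p‖ ^ 2 / ‖t‖) ^ a.1.natAbs ≤
      ‖baileyKernel (p ^ 2) t nt 0 1 a.1 (circleMap 0 1 a.2)‖ := fun a => by
    have := hc 0 1 a.1 (circleMap 0 1 a.2) (by simp) (by simp)
    rwa [zero_sub, Int.natAbs_neg] at this
  have hmeas : AEStronglyMeasurable (fun a : ℤ × ℝ => α a.1 (circleMap 0 1 a.2)) circleCount := by
    refine (hα.aestronglyMeasurable.mul hE.inv.aestronglyMeasurable).congr
      (.of_forall fun a => ?_)
    have : baileyKernel (p ^ 2) t nt 0 1 a.1 (circleMap 0 1 a.2) ≠ 0 :=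
      norm_pos_iff.1 (lt_of_lt_of_le (by positivity) (hlow a))
    simp only [Pi.mul_apply, Pi.inv_apply]
    field_simp
  refine ⟨hmeas, (hα.norm.const_mul c⁻¹).mono' ?_ (.of_forall fun a => ?_)⟩
  · have : Measurable fun a : ℤ × ℝ => (‖p‖ ^ 2 / ‖t‖) ^ a.1.natAbs :=
      (measurable_of_countable fun n : ℤ => (‖p‖ ^ 2 / ‖t‖) ^ n.natAbs).comp measurable_fst
    exact this.aestronglyMeasurable.mul hmeas.norm
  · rw [Real.norm_of_nonneg (by positivity), norm_mul, ← mul_assoc]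
    gcongr
    rw [inv_mul_eq_div, le_div_iff₀ hc0, mul_comm]
    exact hlow a

/-- The kernel for st decays at rate |p|²/|st| and the factor in α' at rate |s|; the product of the
rates is exactly the weight available for α. -/
theorem absConvOnCircle_baileyAlpha (hp0 : p ≠ 0) (hp1 : ‖p‖ < 1) (hs : ‖s‖ < 1) (ht : ‖t‖ < 1)
    (hu : ‖u‖ < 1) (hstu : ‖p‖ ^ 4 < ‖s ^ 2 * t ^ 2 * u‖) (hw : ‖s‖ < ‖w‖) (hw' : ‖s‖ * ‖w‖ < 1)
    (hα : AEStronglyMeasurable (fun a : ℤ × ℝ => α a.1 (circleMap 0 1 a.2)) circleCount)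
    (hα' : Integrable (fun a : ℤ × ℝ =>
      (‖p‖ ^ 2 / ‖t‖) ^ a.1.natAbs * ‖α a.1 (circleMap 0 1 a.2)‖) circleCount) (n : ℤ) :
    AbsConvOnCircle fun k z => baileyKernel (p ^ 2) (s * t) (ns + nt) n w k z *
      baileyAlpha (p ^ 2) s t u ns nt nu α k z := by
  have h0 : s ^ 2 * t ^ 2 * u ≠ 0 := norm_pos_iff.1 (lt_of_le_of_lt (by positivity) hstu)
  simp only [ne_eq, mul_eq_zero, pow_eq_zero_iff, not_false_eq_true, OfNat.ofNat_ne_zero,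
    not_or] at h0
  obtain ⟨⟨hs0, ht0⟩, hu0⟩ := h0
  have hS := norm_pos_iff.2 hs0
  have hT := norm_pos_iff.2 ht0
  have hh : ‖p ^ 2‖ < 1 := by
    rw [norm_pow]
    exact pow_lt_one₀ (norm_nonneg _) hp1 two_ne_zero
  have hst : ‖s * t‖ ≤ ‖s‖ := by
    rw [norm_mul]
    exact mul_le_of_le_one_right hS.le ht.le
  obtain ⟨A, hA0, hA⟩ := exists_norm_baileyKernel_le hp0 hp1 (mul_ne_zero hs0 ht0) (ω := ‖w‖)
    ((mul_le_mul_of_nonneg_right hst (norm_nonneg w)).trans_lt hw') (hst.trans_lt hw) (ns + nt) n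
  obtain ⟨B, hB0, hB⟩ := exists_norm_pentB_le hp0 hp1 hs ht hu hstu ns (nu + nt)
  rw [absConvOnCircle_iff]
  refine (hα'.const_mul (A * B)).mono' ?_ (.of_forall fun a => ?_)
  · refine Measurable.aestronglyMeasurable ?_ |>.mul (Measurable.aestronglyMeasurable ?_ |>.mul hα)
    · exact measurable_baileyKernel hh _ _ measurable_const measurable_circleMap_snd
        measurable_fst measurable_const
    · exact measurable_pentB hh ((measurable_csqrt.comp measurable_circleMap_snd).const_mul _)
        measurable_const (by fun_prop) measurable_const
  · have h1 := hA 0 w a.1 (circleMap 0 1 a.2) rfl (by simp)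
    have h2 := hB a.1 (circleMap 0 1 a.2) (by simp)
    rw [add_zero, zero_sub, Int.natAbs_neg] at h1
    rw [← add_assoc] at h2
    rw [baileyAlpha, ← mul_assoc, norm_mul, norm_mul, ← mul_assoc]
    refine mul_le_mul_of_nonneg_right ?_ (norm_nonneg _)
    calc _ ≤ A * (‖p‖ ^ 2 / ‖s * t‖) ^ a.1.natAbs * (B * ‖s‖ ^ a.1.natAbs) := by gcongr
      _ = A * B * (‖p‖ ^ 2 / ‖s * t‖ * ‖s‖) ^ a.1.natAbs := by
          rw [mul_pow]
          ring
      _ = _ := by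
          congr 2
          rw [norm_mul]
          field_simp

/-- Splitting κ^|j-k| ≤ κ^(-|j|) κ^|k| with κ = |p|²/|t| separates the variables: the index j keeps
the rate |p|²|t|/κ = |t|² < 1, and k receives the weight of α. -/
theorem integrable_betaKernel_mul (hp0 : p ≠ 0) (hp1 : ‖p‖ < 1) (hs : ‖s‖ < 1) (ht : ‖t‖ < 1)
    (hu : ‖u‖ < 1) (hstu : ‖p‖ ^ 4 < ‖s ^ 2 * t ^ 2 * u‖) (hw : ‖s‖ < ‖w‖) (hw' : ‖s‖ * ‖w‖ < 1)
    (hpt : ‖p‖ ^ 2 < ‖t‖)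
    (hα : AEStronglyMeasurable (fun a : ℤ × ℝ => α a.1 (circleMap 0 1 a.2)) circleCount)
    (hα' : Integrable (fun a : ℤ × ℝ =>
      (‖p‖ ^ 2 / ‖t‖) ^ a.1.natAbs * ‖α a.1 (circleMap 0 1 a.2)‖) circleCount) (n : ℤ) :
    Integrable (fun c : (ℤ × ℝ) × ℤ × ℝ =>
      betaKernel (p ^ 2) s t u ns nt nu n w c.1.1 (circleMap 0 1 c.1.2) *
        (baileyKernel (p ^ 2) t nt c.1.1 (circleMap 0 1 c.1.2) c.2.1 (circleMap 0 1 c.2.2) *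
          α c.2.1 (circleMap 0 1 c.2.2))) (circleCount.prod circleCount) := by
  have hp : 0 < ‖p‖ := norm_pos_iff.2 hp0
  have hT : 0 < ‖t‖ := lt_of_le_of_lt (by positivity) hpt
  have hh : ‖p ^ 2‖ < 1 := by
    rw [norm_pow]
    exact pow_lt_one₀ (norm_nonneg _) hp1 two_ne_zero
  obtain ⟨A, hA0, hA⟩ := exists_norm_betaKernel_le hp0 hp1 hs ht hu hstu hw hw' ns nt nu n
  obtain ⟨B, hB0, hB⟩ := exists_norm_baileyKernel_le hp0 hp1 (norm_pos_iff.1 hT) (ω := 1)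
    (by rwa [mul_one]) ht nt 0
  have hg := ((integrable_pow_natAbs_circleCount (by positivity)
    (pow_lt_one₀ hT.le ht two_ne_zero)).mul_prod hα').const_mul (A * B)
  refine hg.mono' ?_ (.of_forall fun c => ?_)
  · refine Measurable.aestronglyMeasurable ?_ |>.mul
      (Measurable.aestronglyMeasurable ?_ |>.mul hα.comp_snd)
    · exact measurable_betaKernel hh _ _ _ _ _ _ _ _ (measurable_circleMap_snd.comp measurable_fst)
        (measurable_fst.comp measurable_fst)
    · exact measurable_baileyKernel hh _ _ (measurable_circleMap_snd.comp measurable_fst)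
        (measurable_circleMap_snd.comp measurable_snd) (measurable_fst.comp measurable_snd)
        (measurable_fst.comp measurable_fst)
  · have h1 := hA c.1.1 (circleMap 0 1 c.1.2) (by simp)
    have h2 := hB c.1.1 (circleMap 0 1 c.1.2) c.2.1 (circleMap 0 1 c.2.2) (by simp) (by simp)
    have hκ : ‖p‖ ^ 2 / ‖t‖ ≤ 1 := (div_le_one hT).2 hpt.le
    have h3 := pow_natAbs_add_le (x := ‖p‖ ^ 2 / ‖t‖) (M := (‖p‖ ^ 2 / ‖t‖)⁻¹) (by positivity)
      (hκ.trans ((one_le_inv₀ (by positivity)).2 hκ)) le_rfl c.1.1 (-c.2.1)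
    rw [zero_add] at h2
    rw [← sub_eq_add_neg, Int.natAbs_neg] at h3
    rw [← mul_assoc, norm_mul, norm_mul, ← mul_assoc, ← mul_assoc]
    refine mul_le_mul_of_nonneg_right ?_ (norm_nonneg _)
    calc _ ≤ A * (‖p‖ ^ 2 * ‖t‖) ^ c.1.1.natAbs *
          (B * ((‖p‖ ^ 2 / ‖t‖)⁻¹ ^ c.1.1.natAbs * (‖p‖ ^ 2 / ‖t‖) ^ c.2.1.natAbs)) := by
          gcongr
          exact h2.trans (by gcongr)
      _ = A * B * (‖p‖ ^ 2 * ‖t‖ * (‖p‖ ^ 2 / ‖t‖)⁻¹) ^ c.1.1.natAbs *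
          (‖p‖ ^ 2 / ‖t‖) ^ c.2.1.natAbs := by
          rw [mul_pow _ (‖p‖ ^ 2 / ‖t‖)⁻¹]
          ring
      _ = _ := by
          congr 3
          field_simp

theorem integral_betaKernel_mul_baileyKernel (hp0 : p ≠ 0) (hp1 : ‖p‖ < 1) (hs : ‖s‖ < 1)
    (ht : ‖t‖ < 1) (hu : ‖u‖ < 1) (hstu : ‖p‖ ^ 4 < ‖s ^ 2 * t ^ 2 * u‖) (hw : ‖s‖ < ‖w‖)
    (hw' : ‖s‖ * ‖w‖ < 1) (hpt : ‖p‖ ^ 2 < ‖t‖) (n k : ℤ) {z : ℂ} (hz : ‖z‖ = 1) :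
    ∫ b : ℤ × ℝ, betaKernel (p ^ 2) s t u ns nt nu n w b.1 (circleMap 0 1 b.2) *
        baileyKernel (p ^ 2) t nt b.1 (circleMap 0 1 b.2) k z ∂circleCount =
      2 * Real.pi * (baileyKernel (p ^ 2) (s * t) (ns + nt) n w k z *
        pentB (p ^ 2) (csqrt t * csqrt u * csqrt z) (k + nu + nt) s (2 * ns)) := by
  have hp : 0 < ‖p‖ := norm_pos_iff.2 hp0
  have hT : 0 < ‖t‖ := lt_of_le_of_lt (by positivity) hpt
  have hh : ‖p ^ 2‖ < 1 := by
    rw [norm_pow]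
    exact pow_lt_one₀ (norm_nonneg _) hp1 two_ne_zero
  obtain ⟨A, hA0, hA⟩ := exists_norm_betaKernel_le hp0 hp1 hs ht hu hstu hw hw' ns nt nu n
  obtain ⟨B, hB0, hB⟩ := exists_norm_baileyKernel_le hp0 hp1 (norm_pos_iff.1 hT) (ω := 1)
    (by rwa [mul_one]) ht nt 0
  have hlt : ‖p‖ ^ 2 * ‖t‖ < 1 :=
    mul_lt_one_of_nonneg_of_lt_one_left (by positivity) (by rwa [← norm_pow]) ht.le
  rw [integral_circleCount, ← tsum_circleAverage_betaKernel hp0 hp1 hs ht hu hstu hw hw' hz,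
    ← tsum_mul_left]
  · congr 1
    funext j
    have hpi : (Real.pi : ℂ) ≠ 0 := ofReal_ne_zero.2 Real.pi_ne_zero
    rw [Real.circleAverage_def, real_smul]
    push_cast
    field_simp
  · refine ((integrable_pow_natAbs_circleCount (by positivity) hlt).const_mul (A * B)).mono'
      (Measurable.aestronglyMeasurable ?_) (.of_forall fun b => ?_)
    · exact (measurable_betaKernel hh _ _ _ _ _ _ _ _ measurable_circleMap_snd
        measurable_fst).mul (measurable_baileyKernel hh _ _ measurable_circleMap_snd
        measurable_const measurable_const measurable_fst)
    · have h1 := hA b.1 (circleMap 0 1 b.2) (by simp)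
      have h2 := hB b.1 (circleMap 0 1 b.2) k z (by simp) hz
      have h3 : (‖p‖ ^ 2 / ‖t‖) ^ (b.1 - k).natAbs ≤ 1 :=
        pow_le_one₀ (by positivity) ((div_le_one hT).2 hpt.le)
      rw [zero_add] at h2
      rw [norm_mul]
      calc _ ≤ A * (‖p‖ ^ 2 * ‖t‖) ^ b.1.natAbs * (B * 1) := by
            gcongr
            exact h2.trans (by gcongr)
        _ = _ := by ring

end bailey

/-! ### The Bailey lemma -/

theorem mainTheorem1 (q h s t u : ℂ) (ns nt nu : ℤ) (D : Set ℂ) (α β : ℤ → ℂ → ℂ)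
    (hq : h ^ 2 = q) (hq0 : q ≠ 0) (hq1 : ‖q‖ < 1)
    (hs : ‖s‖ < 1) (ht : ‖t‖ < 1) (hu : ‖u‖ < 1) (hstu : ‖q‖ < ‖s ^ 2 * t ^ 2 * u‖)
    (hn : nu + ns + nt = 0)
    (hD : Metric.sphere (0 : ℂ) 1 ⊆ D)
    (hD' : ∀ w ∈ D, ‖s‖ < ‖w‖ ∧ ‖s‖ * ‖w‖ < 1)
    (hpair : IsBaileyPair h D t nt α β) :
    (∀ n : ℤ, ∀ w ∈ D, AbsConvOnCircle (baileyBetaIntegrand h s t u ns nt nu β n w)) ∧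
      IsBaileyPair h D (s * t) (ns + nt)
        (baileyAlpha h s t u ns nt nu α) (baileyBeta h s t u ns nt nu β) := by
  obtain ⟨p, rfl⟩ : ∃ p : ℂ, h = p ^ 2 := ⟨csqrt h, (csqrt_sq h).symm⟩
  have hqp : ‖q‖ = ‖p‖ ^ 4 := by rw [← hq, ← pow_mul, norm_pow]
  have hp0 : p ≠ 0 := by
    rintro rfl
    exact hq0 (by rw [← hq]; simp)
  have hp : 0 < ‖p‖ := norm_pos_iff.2 hp0
  have hp1 : ‖p‖ < 1 := (pow_lt_one_iff_of_nonneg (norm_nonneg _) (by norm_num)).1 (hqp ▸ hq1)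
  rw [hqp] at hstu
  have hpt : ‖p‖ ^ 2 < ‖t‖ := by
    refine (norm_sq_lt_norm_mul_csqrt hstu).trans_le ?_
    have hu1 : ‖csqrt u‖ < 1 := norm_csqrt_lt zero_le_one (by simpa using hu)
    rw [norm_mul, norm_mul]
    calc _ ≤ 1 * ‖t‖ * 1 := by gcongr
      _ = _ := by ring
  have hcirc : ∀ θ : ℝ, circleMap 0 1 θ ∈ D := fun θ => hD (by simp)
  -- The hypothesis at m = 0, w = 1 already controls α for all later estimates.
  obtain ⟨hα, hα'⟩ := aestronglyMeasurable_and_integrable_of_absConv hp0 hp1 hpt ht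
    (hpair 0 1 (hD (by simp))).1
  have hpi : (Real.pi : ℂ) ≠ 0 := ofReal_ne_zero.2 Real.pi_ne_zero
  have hz0 : ∀ θ : ℝ, circleMap 0 1 θ ≠ 0 := fun θ => by simp
  have hβ : ∀ b : ℤ × ℝ, β b.1 (circleMap 0 1 b.2) = ∫ a : ℤ × ℝ,
      baileyKernel (p ^ 2) t nt b.1 (circleMap 0 1 b.2) a.1 (circleMap 0 1 a.2) *
        α a.1 (circleMap 0 1 a.2) * (circleMap 0 1 a.2 * I) ∂circleCount := fun b => by
    rw [(hpair b.1 _ (hcirc b.2)).2, sumCircleIntegral_eq (hpair b.1 _ (hcirc b.2)).1]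
  let Φ : ℤ → ℂ → ℤ × ℝ → ℤ × ℝ → ℂ := fun n w b a =>
    betaKernel (p ^ 2) s t u ns nt nu n w b.1 (circleMap 0 1 b.2) *
      (baileyKernel (p ^ 2) t nt b.1 (circleMap 0 1 b.2) a.1 (circleMap 0 1 a.2) *
        α a.1 (circleMap 0 1 a.2)) * (circleMap 0 1 a.2 * I)
  have hΦ : ∀ n, ∀ w ∈ D, Integrable (Function.uncurry (Φ n w)) (circleCount.prod circleCount) :=
    fun n w hw => (integrable_betaKernel_mul hp0 hp1 hs ht hu hstu (hD' w hw).1 (hD' w hw).2 hpt hα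
      hα' n).mul_bdd (c := 1)
      ((measurable_circleMap_snd.comp measurable_snd).mul_const I).aestronglyMeasurable
      (.of_forall fun a => by simp)
  have hint : ∀ n w b, ∫ a, Φ n w b a ∂circleCount =
      betaKernel (p ^ 2) s t u ns nt nu n w b.1 (circleMap 0 1 b.2) *
        β b.1 (circleMap 0 1 b.2) := fun n w b => by
    rw [hβ, ← integral_const_mul]
    simp only [Φ, mul_assoc]
  have hconv : ∀ n, ∀ w ∈ D,
      AbsConvOnCircle (baileyBetaIntegrand (p ^ 2) s t u ns nt nu β n w) := fun n w hw => by
    rw [absConvOnCircle_iff]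
    have h1 := (hΦ n w hw).integral_prod_left
    simp only [Function.uncurry_apply_pair, hint] at h1
    exact h1.mul_bdd (c := ‖(2 * Real.pi * I : ℂ)⁻¹‖)
      (measurable_circleMap_snd.const_mul _).inv.aestronglyMeasurable
      (.of_forall fun a => by simp)
  refine ⟨hconv, fun n w hw => ?_⟩
  have hnew := absConvOnCircle_baileyAlpha (ns := ns) (nt := nt) (nu := nu) hp0 hp1 hs ht hu hstu
    (hD' w hw).1 (hD' w hw).2 hα hα' n
  refine ⟨hnew, ?_⟩
  rw [sumCircleIntegral_eq hnew, baileyBeta, sumCircleIntegral_eq (hconv n w hw)]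
  -- On the circle dx / (2πi x) is dθ / 2π, which explains the constant; the factor dz/dθ for α is
  -- part of Φ.
  calc _ = ∫ b, ∫ a, (2 * Real.pi : ℂ)⁻¹ * Φ n w b a ∂circleCount ∂circleCount := by
        refine integral_congr_ae (.of_forall fun b => ?_)
        simp only [integral_const_mul, hint]
        have := hz0 b.2
        simp only [baileyBetaIntegrand, betaKernel]
        field_simp
    _ = ∫ a, ∫ b, (2 * Real.pi : ℂ)⁻¹ * Φ n w b a ∂circleCount ∂circleCount :=
        integral_integral_swap ((hΦ n w hw).const_mul _)
    _ = _ := by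
        refine integral_congr_ae (.of_forall fun a => ?_)
        have h1 := integral_betaKernel_mul_baileyKernel (ns := ns) (nt := nt) (nu := nu) hp0 hp1 hs
          ht hu hstu (hD' w hw).1 (hD' w hw).2 hpt n a.1 (z := circleMap 0 1 a.2) (by simp)
        have h2 : ∀ b, (2 * Real.pi : ℂ)⁻¹ * Φ n w b a =
            (2 * Real.pi : ℂ)⁻¹ * (α a.1 (circleMap 0 1 a.2) * (circleMap 0 1 a.2 * I)) *
              (betaKernel (p ^ 2) s t u ns nt nu n w b.1 (circleMap 0 1 b.2) *
                baileyKernel (p ^ 2) t nt b.1 (circleMap 0 1 b.2) a.1 (circleMap 0 1 a.2)) :=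
          fun b => by
            simp only [Φ]
            ring
        simp only [h2, integral_const_mul, h1, baileyAlpha]
        field_simp
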